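/- Let $D\ge 2$ be an integer and $p>1$ a real number. Call a nonempty, open, bounded, convex set $\Omega\subset\mathbb{R}^D$ a bounded convex domain, let $|\Omega|$ be its Lebesgue measure and let $R_\Omega$ be its inradius, that is, the supremum of the radii of the balls contained in $\Omega$. Let $u_p\in W_0^{1,p}(\Omega)$ be the $p$-torsion function of $\Omega$, i.e. the unique weak solution of $-\operatorname{div}(|\nabla u|^{p-2}\nabla u)=1$ in $\Omega$, $u=0$ on $\partial\Omega$, and set $$T_p(\Omega)=\int_\Omega u_p\,dx,\qquad T(p;\Omega)=|\Omega|^{p-1}\,T_p(\Omega)^{1-p},\qquad Q_p(\Omega)=\left(\frac{T(p;\Omega)\,R_\Omega^{\,p}}{\left(\frac{2p-1}{p-1}\right)^{p-1}}\right)^{1/p}.$$ Then $Q_p$ is bounded above on the family of all bounded convex domains in $\mathbb{R}^D$, and the number $$\gamma_{D,p}:=\frac{\inf_\Omega Q_p(\Omega)}{\sup_\Omega Q_p(\Omega)}$$ (infimum and supremum over all bounded convex domains $\Omega\subset\mathbb{R}^D$), which depends only on $D$ and $p$, satisfies $\frac1D\le\gamma_{D,p}<1$. Moreover, for all real numbers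 $0<a<b$: (i) the inequality $T(p;\Omega_b)\le T(p;\Omega_a)$ holds for all bounded convex domains $\Omega_a,\Omega_b\subset\mathbb{R}^D$ with $R_{\Omega_a}=a$ and $R_{\Omega_b}=b$ if and only if $\gamma_{D,p}\,b\ge a$; (ii) if $\gamma_{D,p}\,b>a$, then $T(p;\Omega_b)<T(p;\Omega_a)$ for all bounded convex domains $\Omega_a,\Omega_b\subset\mathbb{R}^D$ with $R_{\Omega_a}=a$ and $R_{\Omega_b}=b$; (iii) if $\gamma_{D,p}\,b=a$, then there are sequences $(\omega_n)_n$ and $(\Omega_n)_n$ of bounded convex domains in $\mathbb{R}^D$ with $R_{\omega_n}=a$ and $R_{\Omega_n}=b$ for all $n$ such that the limits $\lim_{n\to\infty}T(p;\Omega_n)$ and $\lim_{n\to\infty}T(p;\omega_n)$ exist, are finite and are equal. -/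

import Mathlib

open MeasureTheory Filter Topology
open scoped ContDiff

noncomputable section

namespace PTorsion

/-- The Euclidean space `ℝ^D`. -/
abbrev E (D : ℕ) : Type := EuclideanSpace ℝ (Fin D)

variable {D : ℕ}

/-! ### Convex domains and the inradius -/

/-- The family of all bounded convex domains (nonempty open sets) of `ℝ^D`. -/
def convexDomains (D : ℕ) : Set (Set (E D)) :=
  {Ω | Ω.Nonempty ∧ IsOpen Ω ∧ Bornology.IsBounded Ω ∧ Convex ℝ Ω}

/-- The inradius of `Ω`: the supremum of the radii of the balls contained in `Ω`. -/
def inradius (Ω : Set (E D)) : ℝ :=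
  sSup {r : ℝ | 0 ≤ r ∧ ∃ x : E D, Metric.ball x r ⊆ Ω}

/-- The family of all bounded convex domains of `ℝ^D` with inradius `r`. -/
def convexDomainsOfInradius (D : ℕ) (r : ℝ) : Set (Set (E D)) :=
  {Ω | Ω ∈ convexDomains D ∧ inradius Ω = r}

/-! ### The space `W₀^{1,p}(Ω)` -/

/-- `φ ∈ C_c^∞(Ω)`. -/
def IsTestFunction (Ω : Set (E D)) (φ : E D → ℝ) : Prop :=
  ContDiff ℝ ∞ φ ∧ HasCompactSupport φ ∧ tsupport φ ⊆ Ω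

/-- `g` is a weak gradient of `u` on `Ω` (for `u` and `g` integrable on `Ω`). -/
def IsWeakGradient (Ω : Set (E D)) (u : E D → ℝ) (g : E D → E D) : Prop :=
  ∀ φ : E D → ℝ, IsTestFunction Ω φ →
    ∫ x in Ω, u x • gradient φ x = - ∫ x in Ω, φ x • g x

/-- `u ∈ W^{1,p}(Ω)` with weak gradient `g`. Only the restrictions of `u` and `g` to `Ω`
matter. -/
def MemW (p : ℝ) (Ω : Set (E D)) (u : E D → ℝ) (g : E D → E D) : Prop :=
  MemLp u (ENNReal.ofReal p) (volume.restrict Ω) ∧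
  MemLp g (ENNReal.ofReal p) (volume.restrict Ω) ∧
  IsWeakGradient Ω u g

/-- `u ∈ W₀^{1,p}(Ω)` with weak gradient `g`: `u` lies in `W^{1,p}(Ω)` and is the limit in
`W^{1,p}(Ω)` of a sequence of functions in `C_c^∞(Ω)`. -/
def MemWZero (p : ℝ) (Ω : Set (E D)) (u : E D → ℝ) (g : E D → E D) : Prop :=
  MemW p Ω u g ∧
  ∃ φ : ℕ → E D → ℝ, (∀ n, IsTestFunction Ω (φ n)) ∧
    Tendsto (fun n => eLpNorm (fun x => φ n x - u x) (ENNReal.ofReal p) (volume.restrict Ω))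
      atTop (𝓝 0) ∧
    Tendsto (fun n => eLpNorm (fun x => gradient (φ n) x - g x) (ENNReal.ofReal p)
      (volume.restrict Ω)) atTop (𝓝 0)

/-! ### The `p`-torsion function and the `p`-torsional rigidity -/

/-- `u` is a `p`-torsion function on `Ω`: the weak solution in `W₀^{1,p}(Ω)` of
`-div(|∇u|^{p-2} ∇u) = 1` in `Ω`, `u = 0` on `∂Ω`. (Where the weak gradient vanishes, so does
the vector `|∇u|^{p-2} ∇u`, whatever the value of the real power.) -/
def IsTorsionFunction (p : ℝ) (Ω : Set (E D)) (u : E D → ℝ) : Prop :=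
  ∃ g : E D → E D, MemWZero p Ω u g ∧
    ∀ φ : E D → ℝ, IsTestFunction Ω φ →
      ∫ x in Ω, ‖g x‖ ^ (p - 2) * inner ℝ (g x) (gradient φ x) = ∫ x in Ω, φ x

open Classical in
/-- The `p`-torsional rigidity `T_p(Ω) = ∫_Ω u_p dx`, where `u_p` is the `p`-torsion function
(which exists and is unique almost everywhere on `Ω` for `p > 1` and every bounded convex
domain `Ω`; the value is set to `0` if there is none). -/
def torsionalRigidity (p : ℝ) (Ω : Set (E D)) : ℝ :=
  if h : ∃ u : E D → ℝ, IsTorsionFunction p Ω u then ∫ x in Ω, h.choose x else 0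

/-- The normalized `p`-torsional rigidity `T(p;Ω) = |Ω|^{p-1} T_p(Ω)^{1-p}`. -/
def normTorsion (p : ℝ) (Ω : Set (E D)) : ℝ :=
  (volume.real Ω) ^ (p - 1) * (torsionalRigidity p Ω) ^ (1 - p)

/-! ### The scale-invariant quantity and the comparison constant -/

/-- `Q_p(Ω) = (T(p;Ω) R_Ω^p / ((2p-1)/(p-1))^{p-1})^{1/p}`. -/
def Q (p : ℝ) (Ω : Set (E D)) : ℝ :=
  (normTorsion p Ω * inradius Ω ^ p / ((2 * p - 1) / (p - 1)) ^ (p - 1)) ^ (1 / p)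

/-- `γ_{D,p}`: the infimum of `Q_p` over all bounded convex domains of `ℝ^D` divided by its
supremum. -/
def gammaConst (D : ℕ) (p : ℝ) : ℝ :=
  sInf (Q p '' convexDomains D) / sSup (Q p '' convexDomains D)

end PTorsion

end

/-!
`T_p(Ω)^(p-1)` is the supremum of `(∫ φ)^p / ∫ |∇φ|^p` over test functions `φ`, which the
`p`-torsion function attains; existence is the direct method, with strong convergence of minimizing
sequences forced by a Clarkson-type inequality for the midpoint defect of `‖·‖ ^ p`.

Let `J` be the gauge of `Ω` about an incenter, `R` the inradius and `q` the exponent conjugate to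
`p`. Testing with `1 - J ^ q` bounds `T_p(Ω)` from below. For the upper bound let `d` be the
distance to the complement of `Ω`. Since `d` is concave with `|∇d| = 1`, the function
`w = (c - d)² / 2` satisfies `Δw ≥ 1` for `c ≥ R`, hence `∫ φ ≤ ∫ |∇φ| (R - d)`; apply Hölder's
inequality and `R - d ≤ R J`. Both bounds involve only `∫_Ω J ^ q = |Ω| D / (D + q)`, so up to a
constant factor `Q_p` takes values in `[1, D]`, which gives `γ ≥ 1 / D`. The value for the ball is
`D`; it is strictly smaller as soon as `|∇J| < 1 / R` on an open set, as happens for a ball of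
radius two cut off by a slab of width two; hence `γ < 1`. The remaining claims follow from the scale
invariance of `Q_p` and from `T(p; Ω) = c (Q_p(Ω) / R)^p`.
-/

noncomputable section

namespace PTorsion

section Convexity

variable {V : Type*} [NormedAddCommGroup V] [NormedSpace ℝ V] {p : ℝ}

/-- The failure of equality in the midpoint convexity inequality for `‖·‖ ^ p`. Energies of
midpoints are controlled through it, as in Clarkson's inequalities. -/
def midpointDefect (p : ℝ) (a b : V) : ℝ :=
  (‖a‖ ^ p + ‖b‖ ^ p) / 2 - ‖(1 / 2 : ℝ) • (a + b)‖ ^ p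

theorem continuous_midpointDefect (hp : 0 ≤ p) :
    Continuous fun x : V × V => midpointDefect p x.1 x.2 := by
  unfold midpointDefect
  fun_prop (disch := exact hp)

theorem norm_half_smul_add_le (a b : V) :
    ‖(1 / 2 : ℝ) • (a + b)‖ ≤ (1 / 2 : ℝ) • ‖a‖ + (1 / 2 : ℝ) • ‖b‖ := by
  rw [norm_smul, Real.norm_of_nonneg (by norm_num), ← smul_add, smul_eq_mul]
  gcongr
  exact norm_add_le a b

theorem midpointDefect_nonneg (hp : 1 ≤ p) (a b : V) : 0 ≤ midpointDefect p a b := by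
  have hconvex := (convexOn_rpow hp).2 (norm_nonneg a) (norm_nonneg b)
    (by norm_num : (0 : ℝ) ≤ 1 / 2) (by norm_num : (0 : ℝ) ≤ 1 / 2) (by norm_num)
  have hmono := Real.rpow_le_rpow (norm_nonneg _) (norm_half_smul_add_le a b)
    (by linarith : 0 ≤ p)
  simp only [smul_eq_mul] at hconvex hmono
  unfold midpointDefect
  linarith

theorem midpointDefect_pos [StrictConvexSpace ℝ V] (hp : 1 < p) {a b : V} (hab : a ≠ b) :
    0 < midpointDefect p a b := by
  unfold midpointDefect
  by_cases hnorm : ‖a‖ = ‖b‖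
  · have hlt := Real.rpow_lt_rpow (norm_nonneg _) ((norm_midpoint_lt_iff hnorm).2 hab)
      (by linarith : 0 < p)
    rw [← hnorm]
    linarith
  · have hconvex := (strictConvexOn_rpow hp).2 (norm_nonneg a) (norm_nonneg b) hnorm
      (by norm_num : (0 : ℝ) < 1 / 2) (by norm_num : (0 : ℝ) < 1 / 2) (by norm_num)
    have hmono := Real.rpow_le_rpow (norm_nonneg _) (norm_half_smul_add_le a b)
      (by linarith : 0 ≤ p)
    simp only [smul_eq_mul] at hconvex hmono
    linarith

theorem norm_smul_rpow_of_nonneg {t : ℝ} (ht : 0 ≤ t) (a : V) :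
    ‖t • a‖ ^ p = t ^ p * ‖a‖ ^ p := by
  rw [norm_smul, Real.norm_of_nonneg ht, Real.mul_rpow ht (norm_nonneg _)]

theorem midpointDefect_smul {t : ℝ} (ht : 0 ≤ t) (a b : V) :
    midpointDefect p (t • a) (t • b) = t ^ p * midpointDefect p a b := by
  simp only [midpointDefect]
  rw [← smul_add, smul_comm]
  simp only [norm_smul_rpow_of_nonneg ht]
  ring

theorem exists_pos_le_midpointDefect_of_norm_eq_one [StrictConvexSpace ℝ V]
    [FiniteDimensional ℝ V] (hp : 1 < p) {η : ℝ} (hη : 0 < η) :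
    ∃ c > 0, ∀ x : V × V, ‖x‖ = 1 → η ≤ ‖x.1 - x.2‖ ^ p → c ≤ midpointDefect p x.1 x.2 := by
  have hp0 : 0 < p := by linarith
  have := FiniteDimensional.proper_real V
  let K : Set (V × V) := Metric.sphere 0 1 ∩ {x | η ≤ ‖x.1 - x.2‖ ^ p}
  have hK : IsCompact K := (isCompact_sphere _ _).inter_right
    (isClosed_le continuous_const (by fun_prop (disch := exact hp0.le)))
  have hpos : ∀ x ∈ K, 0 < midpointDefect p x.1 x.2 := fun x hx => by
    refine midpointDefect_pos hp fun h => ?_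
    have : η ≤ ‖x.1 - x.2‖ ^ p := hx.2
    rw [h, sub_self, norm_zero, Real.zero_rpow hp0.ne'] at this
    linarith
  rcases K.eq_empty_or_nonempty with hempty | hne
  · refine ⟨1, one_pos, fun x hx hηx => ?_⟩
    have : x ∈ K := ⟨by simpa using hx, hηx⟩
    simp [hempty] at this
  · obtain ⟨x, hx, hmin⟩ := hK.exists_isMinOn hne (continuous_midpointDefect hp0.le).continuousOn
    exact ⟨_, hpos x hx, fun y hy hηy => hmin ⟨by simpa using hy, hηy⟩⟩

theorem exists_pos_mul_rpow_le_midpointDefect [StrictConvexSpace ℝ V] [FiniteDimensional ℝ V]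
    (hp : 1 < p) {η : ℝ} (hη : 0 < η) :
    ∃ c > 0, ∀ x : V × V, η * ‖x‖ ^ p ≤ ‖x.1 - x.2‖ ^ p →
      c * ‖x‖ ^ p ≤ midpointDefect p x.1 x.2 := by
  have hp0 : 0 < p := by linarith
  obtain ⟨c, hc, hcx⟩ := exists_pos_le_midpointDefect_of_norm_eq_one (V := V) hp hη
  refine ⟨c, hc, fun x hx => ?_⟩
  rcases eq_or_ne x 0 with rfl | hx0
  · simp [midpointDefect, Real.zero_rpow hp0.ne']
  have hnorm : 0 < ‖x‖ := norm_pos_iff.2 hx0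
  have hinv : 0 ≤ ‖x‖⁻¹ := by positivity
  have key := hcx (‖x‖⁻¹ • x) (by rw [norm_smul, norm_inv, norm_norm, inv_mul_cancel₀ hnorm.ne'])
  simp only [Prod.smul_fst, Prod.smul_snd, midpointDefect_smul hinv, ← smul_sub,
    norm_smul_rpow_of_nonneg hinv, Real.inv_rpow hnorm.le] at key
  have hxp : 0 < ‖x‖ ^ p := by positivity
  rw [le_inv_mul_iff₀ hxp, le_inv_mul_iff₀ hxp] at key
  rw [mul_comm] at hx ⊢
  exact key hx

theorem exists_norm_sub_rpow_le [StrictConvexSpace ℝ V] [FiniteDimensional ℝ V] (hp : 1 < p)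
    {η : ℝ} (hη : 0 < η) :
    ∃ C : ℝ, 0 ≤ C ∧ ∀ a b : V,
      ‖a - b‖ ^ p ≤ η * (‖a‖ ^ p + ‖b‖ ^ p) + C * midpointDefect p a b := by
  have hp0 : 0 < p := by linarith
  obtain ⟨c, hc, hcx⟩ := exists_pos_mul_rpow_le_midpointDefect (V := V) hp hη
  refine ⟨2 ^ p / c, by positivity, fun a b => ?_⟩
  have hdefect := midpointDefect_nonneg hp.le a b
  rcases le_total (η * ‖(a, b)‖ ^ p) (‖a - b‖ ^ p) with hfar | hclose
  · have hsub : ‖a - b‖ ≤ 2 * ‖(a, b)‖ :=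
      (norm_sub_le a b).trans (by linarith [norm_fst_le (a, b), norm_snd_le (a, b)])
    have hfirst : 0 ≤ η * (‖a‖ ^ p + ‖b‖ ^ p) := by positivity
    calc ‖a - b‖ ^ p ≤ (2 * ‖(a, b)‖) ^ p := Real.rpow_le_rpow (norm_nonneg _) hsub hp0.le
      _ = 2 ^ p / c * (c * ‖(a, b)‖ ^ p) := by
        rw [Real.mul_rpow zero_le_two (norm_nonneg _)]
        field_simp
      _ ≤ 2 ^ p / c * midpointDefect p a b := by
        gcongr
        exact hcx (a, b) hfar
      _ ≤ _ := by linarith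
  · have hmax : ‖(a, b)‖ ^ p ≤ ‖a‖ ^ p + ‖b‖ ^ p := by
      have ha : 0 ≤ ‖a‖ ^ p := by positivity
      have hb : 0 ≤ ‖b‖ ^ p := by positivity
      rw [Prod.norm_def]
      rcases max_choice ‖a‖ ‖b‖ with h | h <;> simp only [h] <;> linarith
    calc ‖a - b‖ ^ p ≤ η * ‖(a, b)‖ ^ p := hclose
      _ ≤ η * (‖a‖ ^ p + ‖b‖ ^ p) := by gcongr
      _ ≤ _ := le_add_of_nonneg_right (by positivity)

end Convexity

section LebesgueSpaces

variable {α V W Z : Type*} [MeasurableSpace α] {μ : Measure α}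
  [NormedAddCommGroup V] [NormedAddCommGroup W] [NormedAddCommGroup Z] {p q : ℝ}

theorem fact_one_le_ofReal (hp : 1 ≤ p) : Fact (1 ≤ ENNReal.ofReal p) :=
  ⟨by simpa using hp⟩

theorem integrable_bilin [NormedSpace ℝ V] [NormedSpace ℝ W] [NormedSpace ℝ Z]
    (hpq : p.HolderConjugate q) (B : V →L[ℝ] W →L[ℝ] Z) {f : α → V} {g : α → W}
    (hf : MemLp f (ENNReal.ofReal q) μ) (hg : MemLp g (ENNReal.ofReal p) μ) :
    Integrable (fun x => B (f x) (g x)) μ := by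
  have := hpq.symm.ennrealOfReal
  exact memLp_one_iff_integrable.1 (B.memLp_of_bilin 1 hf hg)

theorem tendsto_toLp [Fact (1 ≤ ENNReal.ofReal p)] {G : ℕ → α → V} {g : α → V}
    (hG : ∀ n, MemLp (G n) (ENNReal.ofReal p) μ) (hg : MemLp g (ENNReal.ofReal p) μ)
    (h : Tendsto (fun n => eLpNorm (fun x => G n x - g x) (ENNReal.ofReal p) μ) atTop (𝓝 0)) :
    Tendsto (fun n => (hG n).toLp (G n)) atTop (𝓝 (hg.toLp g)) :=
  (Lp.tendsto_Lp_iff_tendsto_eLpNorm'' _ hG _ hg).2 h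

theorem tendsto_integral_bilin [NormedSpace ℝ V] [NormedSpace ℝ W] [NormedSpace ℝ Z]
    [CompleteSpace Z] (hpq : p.HolderConjugate q) (B : V →L[ℝ] W →L[ℝ] Z)
    {f : α → V} {G : ℕ → α → W} {g : α → W} (hf : MemLp f (ENNReal.ofReal q) μ)
    (hG : ∀ n, MemLp (G n) (ENNReal.ofReal p) μ) (hg : MemLp g (ENNReal.ofReal p) μ)
    (h : Tendsto (fun n => eLpNorm (fun x => G n x - g x) (ENNReal.ofReal p) μ) atTop (𝓝 0)) :
    Tendsto (fun n => ∫ x, B (f x) (G n x) ∂μ) atTop (𝓝 (∫ x, B (f x) (g x) ∂μ)) := by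
  have := hpq.symm.ennrealOfReal
  have := fact_one_le_ofReal hpq.lt.le
  have := fact_one_le_ofReal hpq.symm.lt.le
  let L := ContinuousLinearMap.lpPairing μ (ENNReal.ofReal q) (ENNReal.ofReal p) B (hf.toLp f)
  have hL : ∀ {u : α → W} (hu : MemLp u (ENNReal.ofReal p) μ),
      L (hu.toLp u) = ∫ x, B (f x) (u x) ∂μ := fun hu => by
    simp only [L, ContinuousLinearMap.lpPairing_eq_integral]
    refine integral_congr_ae ?_
    filter_upwards [hf.coeFn_toLp, hu.coeFn_toLp] with x hfx hux
    rw [hfx, hux]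
  have := (L.continuous.tendsto _).comp (tendsto_toLp hG hg h)
  simpa only [Function.comp_def, hL] using this

theorem integrable_norm_rpow (hp : 0 < p) {f : α → V} (hf : MemLp f (ENNReal.ofReal p) μ) :
    Integrable (fun x => ‖f x‖ ^ p) μ := by
  have := hf.integrable_norm_rpow (by simpa using hp) ENNReal.ofReal_ne_top
  rwa [ENNReal.toReal_ofReal hp.le] at this

theorem norm_toLp_rpow (hp : 0 < p) {f : α → V} (hf : MemLp f (ENNReal.ofReal p) μ) :
    ‖hf.toLp f‖ ^ p = ∫ x, ‖f x‖ ^ p ∂μ := by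
  have hInt : 0 ≤ ∫ x, ‖f x‖ ^ p ∂μ := integral_nonneg fun x => by positivity
  rw [Lp.norm_toLp, hf.eLpNorm_eq_integral_rpow_norm (by simpa using hp) ENNReal.ofReal_ne_top,
    ENNReal.toReal_ofReal hp.le, ENNReal.toReal_ofReal (by positivity), ← Real.rpow_mul hInt,
    inv_mul_cancel₀ hp.ne', Real.rpow_one]

theorem tendsto_integral_norm_rpow (hp : 1 ≤ p) {G : ℕ → α → V} {g : α → V}
    (hG : ∀ n, MemLp (G n) (ENNReal.ofReal p) μ) (hg : MemLp g (ENNReal.ofReal p) μ)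
    (h : Tendsto (fun n => eLpNorm (fun x => G n x - g x) (ENNReal.ofReal p) μ) atTop (𝓝 0)) :
    Tendsto (fun n => ∫ x, ‖G n x‖ ^ p ∂μ) atTop (𝓝 (∫ x, ‖g x‖ ^ p ∂μ)) := by
  have hp0 : 0 < p := by linarith
  have := fact_one_le_ofReal hp
  have := ((tendsto_toLp hG hg h).norm).rpow_const (p := p) (Or.inr hp0.le)
  simpa only [norm_toLp_rpow hp0] using this

theorem exists_tendsto_eLpNorm_of_integral_cauchy [CompleteSpace V] (hp : 1 ≤ p)
    {G : ℕ → α → V} (hG : ∀ n, MemLp (G n) (ENNReal.ofReal p) μ)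
    (h : ∀ ε > 0, ∃ N, ∀ m ≥ N, ∀ n ≥ N, ∫ x, ‖G m x - G n x‖ ^ p ∂μ < ε) :
    ∃ g : α → V, MemLp g (ENNReal.ofReal p) μ ∧
      Tendsto (fun n => eLpNorm (fun x => G n x - g x) (ENNReal.ofReal p) μ) atTop (𝓝 0) := by
  have hp0 : 0 < p := by linarith
  have := fact_one_le_ofReal hp
  have hcauchy : CauchySeq fun n => (hG n).toLp (G n) := by
    refine Metric.cauchySeq_iff.2 fun ε hε => ?_
    obtain ⟨N, hN⟩ := h (ε ^ p) (by positivity)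
    refine ⟨N, fun m hm n hn => ?_⟩
    have hlt := hN m hm n hn
    rw [dist_eq_norm, ← MemLp.toLp_sub]
    refine (Real.rpow_lt_rpow_iff (norm_nonneg _) hε.le hp0).1 ?_
    rw [norm_toLp_rpow hp0 ((hG m).sub (hG n))]
    exact hlt
  obtain ⟨g, hg⟩ := cauchySeq_tendsto_of_complete hcauchy
  refine ⟨g, Lp.memLp g, ((Lp.tendsto_Lp_iff_tendsto_eLpNorm' _ _).1 hg).congr fun n => ?_⟩
  refine eLpNorm_congr_ae ?_
  filter_upwards [(hG n).coeFn_toLp] with x hx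
  simp [hx]

theorem memLp_norm_rpow_sub_one (hpq : p.HolderConjugate q) {f : α → V}
    (hf : MemLp f (ENNReal.ofReal p) μ) :
    MemLp (fun x => ‖f x‖ ^ (p - 1)) (ENNReal.ofReal q) μ := by
  have h := hf.norm_rpow_div (ENNReal.ofReal (p - 1))
  rw [ENNReal.toReal_ofReal hpq.sub_one_pos.le, ← ENNReal.ofReal_div_of_pos hpq.sub_one_pos] at h
  rwa [hpq.conjugate_eq]

theorem integral_norm_rpow_mul_le (hp : 1 < p) {f : α → V} {b : α → ℝ}
    (hf : MemLp f (ENNReal.ofReal p) μ) (hb : MemLp b (ENNReal.ofReal p) μ) (hb0 : ∀ x, 0 ≤ b x) :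
    ∫ x, ‖f x‖ ^ (p - 1) * b x ∂μ ≤
      (∫ x, ‖f x‖ ^ p ∂μ) ^ (1 - 1 / p) * (∫ x, b x ^ p ∂μ) ^ (1 / p) := by
  have hpq := Real.HolderConjugate.conjExponent hp
  have hHolder := integral_mul_le_Lp_mul_Lq_of_nonneg (μ := μ) hpq.symm
    (f := fun x => ‖f x‖ ^ (p - 1)) (g := b)
    (Eventually.of_forall fun x => by positivity) (Eventually.of_forall hb0)
    (memLp_norm_rpow_sub_one hpq hf) hb
  have hpow : ∀ x, (‖f x‖ ^ (p - 1)) ^ p.conjExponent = ‖f x‖ ^ p := fun x => by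
    rw [← Real.rpow_mul (norm_nonneg _), hpq.sub_one_mul_conj]
  have hexp : 1 / p.conjExponent = 1 - 1 / p := by
    rw [one_div, one_div, ← hpq.inv_add_inv_eq_one, add_sub_cancel_left]
  simpa only [hpow, hexp] using hHolder

end LebesgueSpaces

section Gradient

variable {F : Type*} [NormedAddCommGroup F] [InnerProductSpace ℝ F] [CompleteSpace F]
  {f g : F → ℝ} {x : F}

theorem norm_gradient (f : F → ℝ) (x : F) : ‖gradient f x‖ = ‖fderiv ℝ f x‖ := by
  rw [gradient, LinearIsometryEquiv.norm_map]

theorem continuous_gradient (hf : ContDiff ℝ 1 f) : Continuous (gradient f) :=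
  (InnerProductSpace.toDual ℝ F).symm.continuous.comp (hf.continuous_fderiv one_ne_zero)

theorem gradient_eq_zero_of_notMem_tsupport (hx : x ∉ tsupport f) : gradient f x = 0 := by
  rw [gradient, fderiv_of_notMem_tsupport ℝ hx, map_zero]

theorem hasCompactSupport_gradient (hf : HasCompactSupport f) : HasCompactSupport (gradient f) :=
  hf.mono' fun _ hx => by_contra fun h => hx (gradient_eq_zero_of_notMem_tsupport h)

theorem gradient_fun_add (hf : DifferentiableAt ℝ f x) (hg : DifferentiableAt ℝ g x) :
    gradient (fun y => f y + g y) x = gradient f x + gradient g x := by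
  simp only [gradient, fderiv_fun_add hf hg, map_add]

theorem gradient_fun_const_mul (c : ℝ) : gradient (fun y => c * f y) x = c • gradient f x := by
  simp only [gradient, ← map_smul]
  congr 1
  exact congrFun (fderiv_const_smul_field (𝕜 := ℝ) (f := f) c) x

end Gradient

section IntegrationByParts

variable {F : Type*} [NormedAddCommGroup F] [NormedSpace ℝ F] [FiniteDimensional ℝ F]
  [MeasurableSpace F] [BorelSpace F] {μ : Measure F} [μ.IsAddHaarMeasure] {f g : F → ℝ}

theorem integral_mul_fderiv_of_hasCompactSupport (hf : ContDiff ℝ 1 f) (hg : ContDiff ℝ 1 g)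
    (hc : HasCompactSupport g) (v : F) :
    ∫ x, f x * fderiv ℝ g x v ∂μ = -∫ x, fderiv ℝ f x v * g x ∂μ := by
  have hf' : Continuous fun x => fderiv ℝ f x v :=
    (hf.continuous_fderiv one_ne_zero).clm_apply continuous_const
  have hg' : Continuous fun x => fderiv ℝ g x v :=
    (hg.continuous_fderiv one_ne_zero).clm_apply continuous_const
  exact integral_mul_fderiv_eq_neg_fderiv_mul_of_integrable
    ((hf'.mul hg.continuous).integrable_of_hasCompactSupport hc.mul_left)
    ((hf.continuous.mul hg').integrable_of_hasCompactSupport (hc.fderiv_apply ℝ v).mul_left)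
    ((hf.continuous.mul hg.continuous).integrable_of_hasCompactSupport hc.mul_left)
    (fun x _ => hf.differentiable one_ne_zero x) (fun x _ => hg.differentiable one_ne_zero x)

theorem integral_fderiv_apply_self (hf : ContDiff ℝ 1 f) (hc : HasCompactSupport f) :
    ∫ x, fderiv ℝ f x x ∂μ = -(Module.finrank ℝ F * ∫ x, f x ∂μ) := by
  let b := Module.finBasis ℝ F
  let coord : Fin (Module.finrank ℝ F) → F →L[ℝ] ℝ := fun i => (b.coord i).toContinuousLinearMap
  have hsum : ∀ x : F, fderiv ℝ f x x = ∑ i, coord i x * fderiv ℝ f x (b i) := fun x => by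
    conv_lhs => rw [← b.sum_repr x, map_sum, b.sum_repr x]
    simp only [map_smul, smul_eq_mul]
    rfl
  have hparts : ∀ i, ∫ x, coord i x * fderiv ℝ f x (b i) ∂μ = -∫ x, f x ∂μ := fun i => by
    have hcoord : coord i (b i) = 1 := by simp [coord]
    rw [integral_mul_fderiv_of_hasCompactSupport (coord i).contDiff hf hc]
    simp only [(coord i).fderiv, hcoord, one_mul]
  have hInt : ∀ i, Integrable (fun x => coord i x * fderiv ℝ f x (b i)) μ := fun i =>
    ((coord i).continuous.mul ((hf.continuous_fderiv one_ne_zero).clm_apply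
      continuous_const)).integrable_of_hasCompactSupport (hc.fderiv_apply ℝ (b i)).mul_left
  simp only [hsum]
  rw [integral_finsetSum _ fun i _ => hInt i]
  simp [hparts]

end IntegrationByParts

section Poincare

variable {F : Type*} [NormedAddCommGroup F] [InnerProductSpace ℝ F] [FiniteDimensional ℝ F]
  [MeasurableSpace F] [BorelSpace F] {μ : Measure F} [μ.IsAddHaarMeasure] {f : F → ℝ} {p r : ℝ}

theorem finrank_mul_integral_le_integral_norm_gradient_mul (hf : ContDiff ℝ 1 f)
    (hc : HasCompactSupport f) :
    Module.finrank ℝ F * ∫ x, f x ∂μ ≤ ∫ x, ‖gradient f x‖ * ‖x‖ ∂μ := by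
  have hInt : Integrable (fun x => fderiv ℝ f x x) μ :=
    ((hf.continuous_fderiv one_ne_zero).clm_apply
      continuous_id).integrable_of_hasCompactSupport <| (hc.fderiv ℝ).mono fun x hx h0 =>
        hx (congrArg (fun L : F →L[ℝ] ℝ => L x) h0)
  have hInt' : Integrable (fun x => ‖gradient f x‖ * ‖x‖) μ :=
    ((continuous_gradient hf).norm.mul continuous_norm).integrable_of_hasCompactSupport
      (hasCompactSupport_gradient hc).norm.mul_right
  calc _ = ∫ x, -fderiv ℝ f x x ∂μ := by
        rw [integral_neg, integral_fderiv_apply_self hf hc, neg_neg]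
    _ ≤ ∫ x, ‖gradient f x‖ * ‖x‖ ∂μ := integral_mono hInt.neg hInt' fun x => by
        simpa only [norm_gradient] using (neg_le_abs _).trans ((fderiv ℝ f x).le_opNorm x)

theorem finrank_mul_integral_le (hf : ContDiff ℝ 1 f) (hc : HasCompactSupport f)
    (hr : ∀ x ∈ tsupport f, ‖x‖ ≤ r) :
    Module.finrank ℝ F * ∫ x, f x ∂μ ≤ r * ∫ x, ‖gradient f x‖ ∂μ := by
  have hgrad := hasCompactSupport_gradient hc
  have hcont := continuous_gradient hf
  refine (finrank_mul_integral_le_integral_norm_gradient_mul hf hc).trans ?_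
  rw [← integral_const_mul]
  refine integral_mono
    ((hcont.norm.mul continuous_norm).integrable_of_hasCompactSupport hgrad.norm.mul_right)
    ((hcont.norm.integrable_of_hasCompactSupport hgrad.norm).const_mul r) fun x => ?_
  by_cases hx : x ∈ tsupport f
  · rw [mul_comm]
    exact mul_le_mul_of_nonneg_right (hr x hx) (norm_nonneg _)
  · simp [gradient_eq_zero_of_notMem_tsupport hx]

theorem finrank_mul_integral_norm_rpow_le (hp : 1 < p) (hf : ContDiff ℝ 1 f)
    (hc : HasCompactSupport f) (hr0 : 0 ≤ r) (hr : ∀ x ∈ tsupport f, ‖x‖ ≤ r) :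
    Module.finrank ℝ F * ∫ x, ‖f x‖ ^ p ∂μ ≤
      r * (p * ∫ x, ‖f x‖ ^ (p - 1) * ‖gradient f x‖ ∂μ) := by
  have hp0 : p ≠ 0 := by linarith
  have hp1 : 0 ≤ p - 1 := by linarith
  have hcp : HasCompactSupport fun x => ‖f x‖ ^ p :=
    hc.norm.comp_left (g := fun t : ℝ => t ^ p) (Real.zero_rpow hp0)
  have hsupp : tsupport (fun x => ‖f x‖ ^ p) ⊆ tsupport f :=
    closure_mono fun x hx h0 => hx (by simp [h0, Real.zero_rpow hp0])
  have hInt : Integrable (fun x => ‖f x‖ ^ (p - 1) * ‖gradient f x‖) μ := by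
    have hgrad := continuous_gradient hf
    have hcont := hf.continuous
    exact Continuous.integrable_of_hasCompactSupport (by fun_prop (disch := exact hp1))
      (hasCompactSupport_gradient hc).norm.mul_left
  have hInt' : Integrable (fun x => ‖gradient (fun x => ‖f x‖ ^ p) x‖) μ :=
    (continuous_gradient (hf.norm_rpow hp)).norm.integrable_of_hasCompactSupport
      (hasCompactSupport_gradient hcp).norm
  refine (finrank_mul_integral_le (hf.norm_rpow hp) hcp fun x hx => hr x (hsupp hx)).trans ?_
  rw [← integral_const_mul p]
  refine mul_le_mul_of_nonneg_left (integral_mono hInt' (hInt.const_mul p) fun x => ?_) hr0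
  simp only [norm_gradient, ← mul_assoc]
  exact norm_fderiv_norm_rpow_le (hf.differentiable one_ne_zero) hp

theorem poincare_inequality [Nontrivial F] (hp : 1 < p) (hf : ContDiff ℝ 1 f)
    (hc : HasCompactSupport f) (hr0 : 0 ≤ r) (hr : ∀ x ∈ tsupport f, ‖x‖ ≤ r) :
    ∫ x, ‖f x‖ ^ p ∂μ ≤
      (p * r / Module.finrank ℝ F) ^ p * ∫ x, ‖gradient f x‖ ^ p ∂μ := by
  have hp0 : 0 < p := by linarith
  have hdim : (0 : ℝ) < Module.finrank ℝ F := by exact_mod_cast Module.finrank_pos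
  have hgrad : MemLp (gradient f) (ENNReal.ofReal p) μ :=
    (continuous_gradient hf).memLp_of_hasCompactSupport (hasCompactSupport_gradient hc)
  have hHolder := integral_norm_rpow_mul_le hp
    (hf.continuous.memLp_of_hasCompactSupport (μ := μ) hc) hgrad.norm fun x => norm_nonneg _
  have hmain := (finrank_mul_integral_norm_rpow_le (μ := μ) hp hf hc hr0 hr).trans
    (mul_le_mul_of_nonneg_left (mul_le_mul_of_nonneg_left hHolder hp0.le) hr0)
  set A := ∫ x, ‖f x‖ ^ p ∂μ
  set B := ∫ x, ‖gradient f x‖ ^ p ∂μ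
  have hA : 0 ≤ A := integral_nonneg fun x => by positivity
  have hB : 0 ≤ B := integral_nonneg fun x => by positivity
  rcases hA.eq_or_lt with hA0 | hApos
  · rw [← hA0]; positivity
  have hroot : A ^ (1 / p) ≤ p * r / Module.finrank ℝ F * B ^ (1 / p) := by
    have hAroot : 0 < A ^ (1 / p) := by positivity
    rw [Real.rpow_sub hApos, Real.rpow_one] at hmain
    field_simp at hmain ⊢
    linarith
  have hpow := Real.rpow_le_rpow (by positivity) hroot hp0.le
  rwa [Real.mul_rpow (by positivity) (by positivity), ← Real.rpow_mul hA, ← Real.rpow_mul hB,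
    one_div_mul_cancel hp0.ne', Real.rpow_one, Real.rpow_one] at hpow

end Poincare

namespace IsTestFunction

variable {D : ℕ} {Ω : Set (E D)} {φ ψ : E D → ℝ}

theorem contDiff_one (hφ : IsTestFunction Ω φ) : ContDiff ℝ 1 φ :=
  hφ.1.of_le (by exact_mod_cast le_top)

theorem differentiable (hφ : IsTestFunction Ω φ) : Differentiable ℝ φ :=
  hφ.contDiff_one.differentiable one_ne_zero

theorem add (hφ : IsTestFunction Ω φ) (hψ : IsTestFunction Ω ψ) :
    IsTestFunction Ω fun x => φ x + ψ x :=
  ⟨hφ.1.add hψ.1, hφ.2.1.add hψ.2.1, (tsupport_add φ ψ).trans (Set.union_subset hφ.2.2 hψ.2.2)⟩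

theorem const_mul (hφ : IsTestFunction Ω φ) (c : ℝ) : IsTestFunction Ω fun x => c * φ x :=
  ⟨contDiff_const.mul hφ.1, hφ.2.1.mul_left,
    (closure_mono (Function.support_mul_subset_right (fun _ => c) φ)).trans hφ.2.2⟩

theorem zero : IsTestFunction Ω fun _ => (0 : ℝ) :=
  ⟨contDiff_const, HasCompactSupport.zero, by simp [tsupport, Function.support]⟩

theorem gradient_add (hφ : IsTestFunction Ω φ) (hψ : IsTestFunction Ω ψ) (x : E D) :
    gradient (fun y => φ y + ψ y) x = gradient φ x + gradient ψ x :=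
  gradient_fun_add (hφ.differentiable x) (hψ.differentiable x)

theorem eq_zero (hφ : IsTestFunction Ω φ) {x : E D} (hx : x ∉ Ω) : φ x = 0 :=
  image_eq_zero_of_notMem_tsupport fun h => hx (hφ.2.2 h)

theorem gradient_eq_zero (hφ : IsTestFunction Ω φ) {x : E D} (hx : x ∉ Ω) : gradient φ x = 0 :=
  gradient_eq_zero_of_notMem_tsupport fun h => hx (hφ.2.2 h)

theorem continuous_gradient (hφ : IsTestFunction Ω φ) : Continuous (gradient φ) :=
  PTorsion.continuous_gradient hφ.contDiff_one

theorem integrable (hφ : IsTestFunction Ω φ) : Integrable φ :=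
  hφ.1.continuous.integrable_of_hasCompactSupport hφ.2.1

theorem memLp (hφ : IsTestFunction Ω φ) (r : ENNReal) : MemLp φ r volume :=
  hφ.1.continuous.memLp_of_hasCompactSupport hφ.2.1

theorem memLp_gradient (hφ : IsTestFunction Ω φ) (r : ENNReal) : MemLp (gradient φ) r volume :=
  hφ.continuous_gradient.memLp_of_hasCompactSupport (hasCompactSupport_gradient hφ.2.1)

theorem setIntegral_eq (hφ : IsTestFunction Ω φ) : ∫ x in Ω, φ x = ∫ x, φ x :=
  setIntegral_eq_integral_of_forall_compl_eq_zero fun _ hx => hφ.eq_zero hx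

theorem setIntegral_norm_gradient_rpow (hφ : IsTestFunction Ω φ) {p : ℝ} (hp : 0 < p) :
    ∫ x in Ω, ‖gradient φ x‖ ^ p = ∫ x, ‖gradient φ x‖ ^ p :=
  setIntegral_eq_integral_of_forall_compl_eq_zero fun x hx => by
    rw [hφ.gradient_eq_zero hx, norm_zero, Real.zero_rpow hp.ne']

theorem setIntegral_norm_rpow (hφ : IsTestFunction Ω φ) {p : ℝ} (hp : 0 < p) :
    ∫ x in Ω, ‖φ x‖ ^ p = ∫ x, ‖φ x‖ ^ p :=
  setIntegral_eq_integral_of_forall_compl_eq_zero fun x hx => by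
    rw [hφ.eq_zero hx, norm_zero, Real.zero_rpow hp.ne']

theorem isWeakGradient (hφ : IsTestFunction Ω φ) : IsWeakGradient Ω φ (gradient φ) := by
  intro ψ hψ
  rw [setIntegral_eq_integral_of_forall_compl_eq_zero
      (fun x hx => by rw [hφ.eq_zero hx, zero_smul]),
    setIntegral_eq_integral_of_forall_compl_eq_zero
      (fun x hx => by rw [hψ.eq_zero hx, zero_smul])]
  have hInt : Integrable fun x => φ x • gradient ψ x :=
    (hφ.1.continuous.smul hψ.continuous_gradient).integrable_of_hasCompactSupport
      hφ.2.1.smul_right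
  have hInt' : Integrable fun x => ψ x • gradient φ x :=
    (hψ.1.continuous.smul hφ.continuous_gradient).integrable_of_hasCompactSupport
      hψ.2.1.smul_right
  refine ext_inner_left ℝ fun v => ?_
  rw [inner_neg_right, ← integral_inner hInt, ← integral_inner hInt']
  simp only [real_inner_comm _ v, inner_smul_left, inner_gradient_left, conj_trivial]
  rw [integral_mul_fderiv_of_hasCompactSupport hφ.contDiff_one hψ.contDiff_one hψ.2.1]
  simp only [mul_comm]

end IsTestFunction

section LebesgueEnergies

variable {V : Type*} [NormedAddCommGroup V] {p q : ℝ}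

theorem norm_rpow_sub_two_mul_norm (hp : 1 < p) (v : V) :
    ‖v‖ ^ (p - 2) * ‖v‖ = ‖v‖ ^ (p - 1) := by
  by_cases h : ‖v‖ = 0
  · rw [h, mul_zero, Real.zero_rpow (by linarith)]
  · rw [← Real.rpow_add_one h]
    ring_nf

theorem norm_norm_rpow_smul_self [NormedSpace ℝ V] (hp : 1 < p) (v : V) :
    ‖‖v‖ ^ (p - 2) • v‖ = ‖v‖ ^ (p - 1) := by
  rw [norm_smul, Real.norm_of_nonneg (by positivity), norm_rpow_sub_two_mul_norm hp]

theorem inner_norm_rpow_smul_self [InnerProductSpace ℝ V] (hp : 1 < p) (v : V) :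
    inner ℝ (‖v‖ ^ (p - 2) • v) v = ‖v‖ ^ p := by
  rw [real_inner_smul_left, real_inner_self_eq_norm_mul_norm, ← mul_assoc,
    norm_rpow_sub_two_mul_norm hp]
  by_cases h : ‖v‖ = 0
  · rw [h, mul_zero, Real.zero_rpow (by linarith)]
  · rw [← Real.rpow_add_one h, sub_add_cancel]

variable {α : Type*} [MeasurableSpace α] {μ : Measure α}

theorem memLp_norm_rpow_smul_self [NormedSpace ℝ V] (hpq : p.HolderConjugate q) {g : α → V}
    (hg : MemLp g (ENNReal.ofReal p) μ) :
    MemLp (fun x => ‖g x‖ ^ (p - 2) • g x) (ENNReal.ofReal q) μ := by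
  refine (memLp_norm_rpow_sub_one hpq hg).of_le ?_ (Eventually.of_forall fun x => ?_)
  · exact (hg.1.norm.aemeasurable.pow_const _).aestronglyMeasurable.smul hg.1
  · rw [norm_norm_rpow_smul_self hpq.lt, Real.norm_of_nonneg (by positivity)]

theorem norm_inner_norm_rpow_smul_le [InnerProductSpace ℝ V] (hp : 1 < p) {t : ℝ}
    (ht : |t| ≤ 1) (v w : V) :
    ‖p * inner ℝ (‖v + t • w‖ ^ (p - 2) • (v + t • w)) w‖ ≤
      p * (‖‖v‖ + ‖w‖‖ ^ (p - 1) * ‖w‖) := by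
  have hadd : ‖v + t • w‖ ≤ ‖‖v‖ + ‖w‖‖ := by
    rw [Real.norm_of_nonneg (by positivity)]
    refine norm_add_le_of_le le_rfl ?_
    rw [norm_smul]
    exact mul_le_of_le_one_left (norm_nonneg w) ht
  rw [norm_mul, Real.norm_of_nonneg (by linarith : 0 ≤ p)]
  refine mul_le_mul_of_nonneg_left ((norm_inner_le_norm _ _).trans ?_) (by linarith)
  rw [norm_norm_rpow_smul_self hp]
  gcongr

theorem hasDerivAt_integral_norm_rpow [InnerProductSpace ℝ V] (hp : 1 < p) {g w : α → V}
    (hg : MemLp g (ENNReal.ofReal p) μ) (hw : MemLp w (ENNReal.ofReal p) μ) :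
    HasDerivAt (fun t : ℝ => ∫ x, ‖g x + t • w x‖ ^ p ∂μ)
      (p * ∫ x, inner ℝ (‖g x‖ ^ (p - 2) • g x) (w x) ∂μ) 0 := by
  have hp0 : 0 < p := by linarith
  have hpq := Real.HolderConjugate.conjExponent hp
  have hline : ∀ t : ℝ, MemLp (fun x => g x + t • w x) (ENNReal.ofReal p) μ :=
    fun t => hg.add (hw.const_smul t)
  have hderiv : ∀ (x : α) (t : ℝ), HasDerivAt (fun t : ℝ => ‖g x + t • w x‖ ^ p)
      (p * inner ℝ (‖g x + t • w x‖ ^ (p - 2) • (g x + t • w x)) (w x)) t := fun x t => by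
    have hinner : HasDerivAt (fun t : ℝ => g x + t • w x) (w x) t := by
      simpa using ((hasDerivAt_id t).smul_const (w x)).const_add (g x)
    refine ((hasFDerivAt_norm_rpow (g x + t • w x) hp).comp_hasDerivAt t hinner).congr_deriv ?_
    simp only [_root_.smul_apply, smul_eq_mul, innerSL_apply_apply, real_inner_smul_left,
      mul_assoc]
  have hmeas := (integrable_bilin hpq (innerSL ℝ) (memLp_norm_rpow_smul_self hpq (hline 0))
    hw).aestronglyMeasurable.const_mul p
  have hbound := (integrable_bilin hpq (ContinuousLinearMap.mul ℝ ℝ)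
    (memLp_norm_rpow_sub_one hpq (hg.norm.add hw.norm)) hw.norm).const_mul p
  have key := hasDerivAt_integral_of_dominated_loc_of_deriv_le (Metric.ball_mem_nhds 0 one_pos)
    (Eventually.of_forall fun t => (integrable_norm_rpow hp0 (hline t)).aestronglyMeasurable)
    (integrable_norm_rpow hp0 (hline 0)) hmeas
    (Eventually.of_forall fun x t ht => norm_inner_norm_rpow_smul_le hp
      (by simpa using (mem_ball_zero_iff.1 ht).le) (g x) (w x))
    hbound (Eventually.of_forall fun x t _ => hderiv x t)
  rw [← integral_const_mul]
  simpa using key.2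

theorem integrable_midpointDefect [NormedSpace ℝ V] (hp : 0 < p) {g h : α → V}
    (hg : MemLp g (ENNReal.ofReal p) μ) (hh : MemLp h (ENNReal.ofReal p) μ) :
    Integrable (fun x => midpointDefect p (g x) (h x)) μ :=
  (((integrable_norm_rpow hp hg).add (integrable_norm_rpow hp hh)).div_const 2).sub
    (integrable_norm_rpow hp ((hg.add hh).const_smul (1 / 2 : ℝ)))

theorem integral_midpointDefect [NormedSpace ℝ V] (hp : 0 < p) {g h : α → V}
    (hg : MemLp g (ENNReal.ofReal p) μ) (hh : MemLp h (ENNReal.ofReal p) μ) :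
    ∫ x, midpointDefect p (g x) (h x) ∂μ =
      (∫ x, ‖g x‖ ^ p ∂μ + ∫ x, ‖h x‖ ^ p ∂μ) / 2 -
        ∫ x, ‖(1 / 2 : ℝ) • (g x + h x)‖ ^ p ∂μ := by
  have hgi := integrable_norm_rpow hp hg
  have hhi := integrable_norm_rpow hp hh
  rw [← integral_add hgi hhi, ← integral_div]
  exact integral_sub ((hgi.add hhi).div_const 2)
    (integrable_norm_rpow hp ((hg.add hh).const_smul (1 / 2 : ℝ)))

/-- This is the uniform convexity of `L^p`. -/
theorem exists_pos_integral_norm_sub_rpow_lt [NormedSpace ℝ V] [StrictConvexSpace ℝ V]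
    [FiniteDimensional ℝ V] (hp : 1 < p) {B ε : ℝ} (hB : 0 ≤ B) (hε : 0 < ε) :
    ∃ δ > 0, ∀ g h : α → V, MemLp g (ENNReal.ofReal p) μ → MemLp h (ENNReal.ofReal p) μ →
      ∫ x, ‖g x‖ ^ p ∂μ ≤ B → ∫ x, ‖h x‖ ^ p ∂μ ≤ B →
      ∫ x, midpointDefect p (g x) (h x) ∂μ < δ → ∫ x, ‖g x - h x‖ ^ p ∂μ < ε := by
  have hp0 : 0 < p := by linarith
  obtain ⟨C, hC, hCab⟩ := exists_norm_sub_rpow_le (V := V) hp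
    (η := ε / (4 * (B + 1))) (by positivity)
  refine ⟨ε / (2 * (C + 1)), by positivity, fun g h hg hh hgB hhB hδ => ?_⟩
  have hnorms := (integrable_norm_rpow hp0 hg).add (integrable_norm_rpow hp0 hh)
  have hdefect := integrable_midpointDefect hp0 hg hh
  have hsmall : ε / (4 * (B + 1)) * (∫ x, ‖g x‖ ^ p ∂μ + ∫ x, ‖h x‖ ^ p ∂μ) ≤ ε / 2 := by
    calc _ ≤ ε / (4 * (B + 1)) * (2 * (B + 1)) := by gcongr; linarith
      _ = ε / 2 := by field_simp; norm_num
  have hsmall' : C * ∫ x, midpointDefect p (g x) (h x) ∂μ < ε / 2 := by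
    rw [lt_div_iff₀ (by positivity)] at hδ
    have hdefect0 : 0 ≤ ∫ x, midpointDefect p (g x) (h x) ∂μ :=
      integral_nonneg fun x => midpointDefect_nonneg hp.le _ _
    linarith
  calc ∫ x, ‖g x - h x‖ ^ p ∂μ
      ≤ ∫ x, (ε / (4 * (B + 1)) * (‖g x‖ ^ p + ‖h x‖ ^ p) +
          C * midpointDefect p (g x) (h x)) ∂μ :=
        integral_mono (integrable_norm_rpow hp0 (hg.sub hh))
          ((hnorms.const_mul _).add (hdefect.const_mul _)) fun x => hCab _ _
    _ = ε / (4 * (B + 1)) * (∫ x, ‖g x‖ ^ p ∂μ + ∫ x, ‖h x‖ ^ p ∂μ) +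
          C * ∫ x, midpointDefect p (g x) (h x) ∂μ := by
        rw [← integral_add (integrable_norm_rpow hp0 hg) (integrable_norm_rpow hp0 hh),
          ← integral_const_mul, ← integral_const_mul]
        exact integral_add (hnorms.const_mul _) (hdefect.const_mul _)
    _ < ε := by linarith

end LebesgueEnergies

section TorsionEnergy

variable {D : ℕ} {Ω : Set (E D)} {φ ψ u v : E D → ℝ} {g h : E D → E D} {Φ : ℕ → E D → ℝ} {p : ℝ}

/-- The energy `(1/p) ∫ |∇u|^p - ∫ u` minimized by the `p`-torsion function; the weak gradient
`g` of `u` is passed separately. -/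
def torsionEnergy (p : ℝ) (Ω : Set (E D)) (u : E D → ℝ) (g : E D → E D) : ℝ :=
  (1 / p) * (∫ x in Ω, ‖g x‖ ^ p) - ∫ x in Ω, u x

/-- The test functions `Φ n` converge to `u` in `W^{1,p}(Ω)`, and their gradients to `g`. -/
structure TendstoW (p : ℝ) (Ω : Set (E D)) (Φ : ℕ → E D → ℝ) (u : E D → ℝ)
    (g : E D → E D) : Prop where
  isTestFunction : ∀ n, IsTestFunction Ω (Φ n)
  memLp : MemLp u (ENNReal.ofReal p) (volume.restrict Ω)
  memLp_gradient : MemLp g (ENNReal.ofReal p) (volume.restrict Ω)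
  tendsto_eLpNorm : Tendsto
    (fun n => eLpNorm (fun x => Φ n x - u x) (ENNReal.ofReal p) (volume.restrict Ω)) atTop (𝓝 0)
  tendsto_eLpNorm_gradient : Tendsto
    (fun n => eLpNorm (fun x => gradient (Φ n) x - g x) (ENNReal.ofReal p) (volume.restrict Ω))
    atTop (𝓝 0)

theorem MemWZero.exists_tendstoW (h : MemWZero p Ω u g) : ∃ Φ, TendstoW p Ω Φ u g := by
  obtain ⟨⟨hu, hg, -⟩, Φ, hΦ, hΦu, hΦg⟩ := h
  exact ⟨Φ, hΦ, hu, hg, hΦu, hΦg⟩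

namespace TendstoW

theorem memLp_test (hW : TendstoW p Ω Φ u g) (n : ℕ) :
    MemLp (Φ n) (ENNReal.ofReal p) (volume.restrict Ω) :=
  ((hW.isTestFunction n).memLp _).restrict Ω

theorem memLp_gradient_test (hW : TendstoW p Ω Φ u g) (n : ℕ) :
    MemLp (gradient (Φ n)) (ENNReal.ofReal p) (volume.restrict Ω) :=
  ((hW.isTestFunction n).memLp_gradient _).restrict Ω

theorem isWeakGradient (hp : 1 < p) (hW : TendstoW p Ω Φ u g) : IsWeakGradient Ω u g := by
  intro ψ hψ
  have hpq := Real.HolderConjugate.conjExponent hp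
  have hleft := tendsto_integral_bilin hpq (ContinuousLinearMap.lsmul ℝ ℝ).flip
    ((hψ.memLp_gradient _).restrict Ω) hW.memLp_test hW.memLp hW.tendsto_eLpNorm
  have hright := tendsto_integral_bilin hpq (ContinuousLinearMap.lsmul ℝ ℝ)
    ((hψ.memLp _).restrict Ω) hW.memLp_gradient_test hW.memLp_gradient
    hW.tendsto_eLpNorm_gradient
  simp only [ContinuousLinearMap.flip_apply, ContinuousLinearMap.lsmul_apply] at hleft hright
  refine tendsto_nhds_unique hleft (hright.neg.congr fun n => ?_)
  exact ((hW.isTestFunction n).isWeakGradient ψ hψ).symm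

theorem memWZero (hp : 1 < p) (hW : TendstoW p Ω Φ u g) : MemWZero p Ω u g :=
  ⟨⟨hW.memLp, hW.memLp_gradient, hW.isWeakGradient hp⟩, Φ, hW.isTestFunction,
    hW.tendsto_eLpNorm, hW.tendsto_eLpNorm_gradient⟩

theorem integrableOn (hp : 1 ≤ p) (hΩ : volume Ω ≠ ⊤) (hW : TendstoW p Ω Φ u g) :
    IntegrableOn u Ω :=
  have := isFiniteMeasure_restrict.2 hΩ
  hW.memLp.integrable (by simpa using hp)

theorem tendsto_setIntegral (hp : 1 < p) (hΩ : volume Ω ≠ ⊤) (hW : TendstoW p Ω Φ u g) :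
    Tendsto (fun n => ∫ x in Ω, Φ n x) atTop (𝓝 (∫ x in Ω, u x)) := by
  have := isFiniteMeasure_restrict.2 hΩ
  simpa using tendsto_integral_bilin (Real.HolderConjugate.conjExponent hp)
    (ContinuousLinearMap.mul ℝ ℝ) (memLp_const (1 : ℝ)) hW.memLp_test hW.memLp hW.tendsto_eLpNorm

theorem tendsto_setIntegral_norm_gradient_rpow (hp : 1 ≤ p) (hW : TendstoW p Ω Φ u g) :
    Tendsto (fun n => ∫ x in Ω, ‖gradient (Φ n) x‖ ^ p) atTop (𝓝 (∫ x in Ω, ‖g x‖ ^ p)) :=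
  tendsto_integral_norm_rpow hp hW.memLp_gradient_test hW.memLp_gradient
    hW.tendsto_eLpNorm_gradient

theorem tendsto_torsionEnergy (hp : 1 < p) (hΩ : volume Ω ≠ ⊤) (hW : TendstoW p Ω Φ u g) :
    Tendsto (fun n => torsionEnergy p Ω (Φ n) (gradient (Φ n))) atTop
      (𝓝 (torsionEnergy p Ω u g)) :=
  ((hW.tendsto_setIntegral_norm_gradient_rpow hp.le).const_mul (1 / p)).sub
    (hW.tendsto_setIntegral hp hΩ)

theorem add_const_mul (hW : TendstoW p Ω Φ u g) (hψ : IsTestFunction Ω ψ) (t : ℝ) :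
    TendstoW p Ω (fun n x => Φ n x + t * ψ x) (fun x => u x + t * ψ x)
      fun x => g x + t • gradient ψ x where
  isTestFunction n := (hW.isTestFunction n).add (hψ.const_mul t)
  memLp := hW.memLp.add (((hψ.const_mul t).memLp _).restrict Ω)
  memLp_gradient := hW.memLp_gradient.add (((hψ.memLp_gradient _).restrict Ω).const_smul t)
  tendsto_eLpNorm := by simpa only [add_sub_add_right_eq_sub] using hW.tendsto_eLpNorm
  tendsto_eLpNorm_gradient := by
    simpa only [(hW.isTestFunction _).gradient_add (hψ.const_mul t), gradient_fun_const_mul,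
      add_sub_add_right_eq_sub] using hW.tendsto_eLpNorm_gradient

end TendstoW

theorem hasDerivAt_torsionEnergy (hp : 1 < p) (hu : IntegrableOn u Ω)
    (hg : MemLp g (ENNReal.ofReal p) (volume.restrict Ω)) (hψ : IsTestFunction Ω ψ) :
    HasDerivAt
      (fun t : ℝ => torsionEnergy p Ω (fun x => u x + t * ψ x) fun x => g x + t • gradient ψ x)
      ((∫ x in Ω, inner ℝ (‖g x‖ ^ (p - 2) • g x) (gradient ψ x)) - ∫ x in Ω, ψ x) 0 := by
  have hlinear : ∀ t : ℝ, ∫ x in Ω, (u x + t * ψ x) = (∫ x in Ω, u x) + t * ∫ x in Ω, ψ x :=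
    fun t => by rw [integral_add hu (hψ.integrable.restrict.const_mul t), integral_const_mul]
  have hgrad := (hasDerivAt_integral_norm_rpow hp hg
    ((hψ.memLp_gradient _).restrict Ω)).const_mul (1 / p)
  rw [← mul_assoc, one_div_mul_cancel (by linarith), one_mul] at hgrad
  unfold torsionEnergy
  simp only [hlinear]
  refine hgrad.sub ?_
  simpa using ((hasDerivAt_id (0 : ℝ)).mul_const (∫ x in Ω, ψ x)).const_add (∫ x in Ω, u x)

theorem TendstoW.isTorsionFunction_of_forall_le (hp : 1 < p) (hΩ : volume Ω ≠ ⊤)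
    (hW : TendstoW p Ω Φ u g)
    (hmin : ∀ φ, IsTestFunction Ω φ → torsionEnergy p Ω u g ≤ torsionEnergy p Ω φ (gradient φ)) :
    IsTorsionFunction p Ω u := by
  refine ⟨g, hW.memWZero hp, fun ψ hψ => ?_⟩
  have hlocal : IsLocalMin (fun t : ℝ => torsionEnergy p Ω (fun x => u x + t * ψ x)
      fun x => g x + t • gradient ψ x) 0 := Eventually.of_forall fun t => by
    have hWt := hW.add_const_mul hψ t
    simpa using ge_of_tendsto' (hWt.tendsto_torsionEnergy hp hΩ) fun n =>
      hmin _ (hWt.isTestFunction n)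
  have hderiv := hlocal.hasDerivAt_eq_zero
    (hasDerivAt_torsionEnergy hp (hW.integrableOn hp.le hΩ) hW.memLp_gradient hψ)
  simpa only [real_inner_smul_left] using sub_eq_zero.1 hderiv

end TorsionEnergy

section Existence

variable {D : ℕ} {Ω : Set (E D)} {φ ψ u : E D → ℝ} {g : E D → E D} {Φ : ℕ → E D → ℝ} {p : ℝ}

theorem exists_mul_le_rpow_div_add (hp : 1 < p) {k : ℝ} (hk : 0 ≤ k) :
    ∃ C, ∀ s, 0 ≤ s → k * s ≤ s ^ p / (2 * p) + C := by
  have hpq := Real.HolderConjugate.conjExponent hp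
  have htwo : (0 : ℝ) < 2 ^ (1 / p) := by positivity
  refine ⟨(2 ^ (1 / p) * k) ^ p.conjExponent / p.conjExponent, fun s hs => ?_⟩
  have hyoung := Real.young_inequality_of_nonneg (a := s / 2 ^ (1 / p)) (b := 2 ^ (1 / p) * k)
    (by positivity) (by positivity) hpq
  rwa [Real.div_rpow hs htwo.le, ← Real.rpow_mul zero_le_two, one_div_mul_cancel hpq.ne_zero,
    Real.rpow_one, div_div, div_mul_comm, mul_div_cancel_left₀ _ htwo.ne'] at hyoung

theorem exists_le_torsionEnergy [NeZero D] (hp : 1 < p) (hb : Bornology.IsBounded Ω) :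
    ∃ C, ∀ φ, IsTestFunction Ω φ →
      (∫ x in Ω, ‖gradient φ x‖ ^ p) / (2 * p) - C ≤ torsionEnergy p Ω φ (gradient φ) := by
  have hp0 : 0 < p := by linarith
  have hD : (0 : ℝ) < D := Nat.cast_pos.2 (NeZero.pos D)
  obtain ⟨r, hr0, hr⟩ := hb.exists_pos_norm_le
  obtain ⟨C, hC⟩ := exists_mul_le_rpow_div_add hp (div_nonneg hr0.le hD.le)
  have := isFiniteMeasure_restrict.2 (hb.measure_lt_top (μ := volume)).ne
  refine ⟨∫ _ in Ω, C, fun φ hφ => ?_⟩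
  have hgrad : Integrable (fun x => ‖gradient φ x‖) :=
    (memLp_one_iff_integrable.1 (hφ.memLp_gradient 1)).norm
  have hgradp : IntegrableOn (fun x => ‖gradient φ x‖ ^ p) Ω :=
    integrable_norm_rpow hp0 ((hφ.memLp_gradient _).restrict Ω)
  have hInt : ∫ x in Ω, φ x ≤ ∫ x in Ω, r / D * ‖gradient φ x‖ := by
    have hfin := finrank_mul_integral_le (μ := volume) hφ.contDiff_one hφ.2.1
      fun x hx => hr x (hφ.2.2 hx)
    rw [hφ.setIntegral_eq, setIntegral_eq_integral_of_forall_compl_eq_zero fun x hx => by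
      rw [hφ.gradient_eq_zero hx, norm_zero, mul_zero], integral_const_mul, div_mul_eq_mul_div,
      le_div_iff₀' hD]
    simpa using hfin
  have hyoung : ∫ x in Ω, r / D * ‖gradient φ x‖ ≤
      (∫ x in Ω, ‖gradient φ x‖ ^ p) / (2 * p) + ∫ _ in Ω, C := by
    rw [← integral_div, ← integral_add (hgradp.div_const _) (integrable_const C)]
    exact integral_mono (hgrad.restrict.const_mul _)
      ((hgradp.div_const _).add (integrable_const C)) fun x => hC _ (norm_nonneg _)
  have hhalf : 1 / p * ∫ x in Ω, ‖gradient φ x‖ ^ p =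
      2 * ((∫ x in Ω, ‖gradient φ x‖ ^ p) / (2 * p)) := by field_simp
  unfold torsionEnergy
  linarith

namespace IsTestFunction

theorem integral_midpointDefect_gradient (hp : 0 < p) (hφ : IsTestFunction Ω φ)
    (hψ : IsTestFunction Ω ψ) :
    ∫ x in Ω, midpointDefect p (gradient φ x) (gradient ψ x) =
      p * ((torsionEnergy p Ω φ (gradient φ) + torsionEnergy p Ω ψ (gradient ψ)) / 2 -
        torsionEnergy p Ω (fun x => 1 / 2 * (φ x + ψ x))
          (gradient fun x => 1 / 2 * (φ x + ψ x))) := by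
  rw [integral_midpointDefect hp ((hφ.memLp_gradient _).restrict Ω)
    ((hψ.memLp_gradient _).restrict Ω)]
  unfold torsionEnergy
  simp only [gradient_fun_const_mul, hφ.gradient_add hψ]
  rw [integral_const_mul, integral_add hφ.integrable.restrict hψ.integrable.restrict]
  field_simp
  ring

theorem setIntegral_norm_sub_rpow_le [NeZero D] (hp : 1 < p) {r : ℝ} (hr0 : 0 ≤ r)
    (hr : ∀ x ∈ Ω, ‖x‖ ≤ r) (hφ : IsTestFunction Ω φ) (hψ : IsTestFunction Ω ψ) :
    ∫ x in Ω, ‖φ x - ψ x‖ ^ p ≤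
      (p * r / D) ^ p * ∫ x in Ω, ‖gradient φ x - gradient ψ x‖ ^ p := by
  have hp0 : 0 < p := by linarith
  have hdiff := hφ.add (hψ.const_mul (-1))
  have hgrad : ∀ x, gradient (fun y => φ y + -1 * ψ y) x = gradient φ x - gradient ψ x :=
    fun x => by
      rw [hφ.gradient_add (hψ.const_mul _), gradient_fun_const_mul, neg_one_smul, sub_eq_add_neg]
  have hpoincare := poincare_inequality (μ := volume) hp hdiff.contDiff_one hdiff.2.1 hr0
    fun x hx => hr x (hdiff.2.2 hx)
  rw [← hdiff.setIntegral_norm_rpow hp0, ← hdiff.setIntegral_norm_gradient_rpow hp0] at hpoincare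
  simp only [hgrad] at hpoincare
  simpa only [neg_one_mul, ← sub_eq_add_neg, finrank_euclideanSpace_fin] using hpoincare

end IsTestFunction

theorem exists_setIntegral_norm_gradient_sub_rpow_lt (hp : 1 < p) {m B : ℝ}
    (hm : ∀ φ, IsTestFunction Ω φ → m ≤ torsionEnergy p Ω φ (gradient φ))
    (hΦ : ∀ n, IsTestFunction Ω (Φ n)) (hB : ∀ n, ∫ x in Ω, ‖gradient (Φ n) x‖ ^ p ≤ B)
    (hlim : Tendsto (fun n => torsionEnergy p Ω (Φ n) (gradient (Φ n))) atTop (𝓝 m))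
    {ε : ℝ} (hε : 0 < ε) :
    ∃ N, ∀ k ≥ N, ∀ n ≥ N, ∫ x in Ω, ‖gradient (Φ k) x - gradient (Φ n) x‖ ^ p < ε := by
  have hp0 : 0 < p := by linarith
  obtain ⟨δ, hδ, hconvex⟩ := exists_pos_integral_norm_sub_rpow_lt (V := E D)
    (μ := volume.restrict Ω) hp ((integral_nonneg fun x => by positivity).trans (hB 0)) hε
  obtain ⟨N, hN⟩ := eventually_atTop.1
    (hlim.eventually_lt_const (lt_add_of_pos_right m (div_pos hδ hp0)))
  refine ⟨N, fun k hk n hn => hconvex _ _ (((hΦ k).memLp_gradient _).restrict Ω)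
    (((hΦ n).memLp_gradient _).restrict Ω) (hB k) (hB n) ?_⟩
  rw [(hΦ k).integral_midpointDefect_gradient hp0 (hΦ n), ← lt_div_iff₀' hp0]
  have hmid := hm _ (((hΦ k).add (hΦ n)).const_mul (1 / 2))
  linarith [hN k hk, hN n hn]

theorem exists_tendstoW_of_forall_le [NeZero D] (hp : 1 < p) (hb : Bornology.IsBounded Ω) {m : ℝ}
    (hm : ∀ φ, IsTestFunction Ω φ → m ≤ torsionEnergy p Ω φ (gradient φ))
    (hΦ : ∀ n, IsTestFunction Ω (Φ n))
    (hlim : Tendsto (fun n => torsionEnergy p Ω (Φ n) (gradient (Φ n))) atTop (𝓝 m)) :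
    ∃ u g, TendstoW p Ω Φ u g := by
  have hp0 : 0 < p := by linarith
  obtain ⟨M, hM⟩ := hlim.bddAbove_range
  obtain ⟨C, hC⟩ := exists_le_torsionEnergy hp hb
  have hbound : ∀ n, ∫ x in Ω, ‖gradient (Φ n) x‖ ^ p ≤ (M + C) * (2 * p) := fun n => by
    rw [← div_le_iff₀ (mul_pos two_pos hp0)]
    linarith [hC _ (hΦ n), hM (Set.mem_range_self n)]
  have hcauchy := fun {ε : ℝ} => exists_setIntegral_norm_gradient_sub_rpow_lt (ε := ε) hp hm hΦ
    hbound hlim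
  obtain ⟨r, hr0, hr⟩ := hb.exists_pos_norm_le
  obtain ⟨g, hg, hΦg⟩ := exists_tendsto_eLpNorm_of_integral_cauchy hp.le
    (fun n => ((hΦ n).memLp_gradient _).restrict Ω) fun ε hε => hcauchy hε
  have hK : 0 < (p * r / D) ^ p := by
    have : (0 : ℝ) < D := Nat.cast_pos.2 (NeZero.pos D)
    positivity
  obtain ⟨u, hu, hΦu⟩ := exists_tendsto_eLpNorm_of_integral_cauchy hp.le
    (fun n => ((hΦ n).memLp _).restrict Ω) fun ε hε => by
      obtain ⟨N, hN⟩ := hcauchy (div_pos hε hK)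
      refine ⟨N, fun k hk n hn =>
        ((hΦ k).setIntegral_norm_sub_rpow_le hp hr0.le hr (hΦ n)).trans_lt ?_⟩
      exact (lt_div_iff₀' hK).1 (hN k hk n hn)
  exact ⟨u, g, hΦ, hu, hg, hΦu, hΦg⟩

theorem exists_isTorsionFunction [NeZero D] (hp : 1 < p) (hb : Bornology.IsBounded Ω) :
    ∃ u, IsTorsionFunction p Ω u := by
  have hp0 : 0 < p := by linarith
  let energies := (fun φ => torsionEnergy p Ω φ (gradient φ)) '' {φ | IsTestFunction Ω φ}
  obtain ⟨C, hC⟩ := exists_le_torsionEnergy hp hb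
  have hbdd : BddBelow energies := ⟨-C, by
    rintro _ ⟨φ, hφ, rfl⟩
    have hgrad : 0 ≤ (∫ x in Ω, ‖gradient φ x‖ ^ p) / (2 * p) :=
      div_nonneg (by positivity) (mul_pos two_pos hp0).le
    linarith [hC φ hφ]⟩
  obtain ⟨e, -, he, hmem⟩ :=
    exists_seq_tendsto_sInf (S := energies) ⟨_, _, IsTestFunction.zero, rfl⟩ hbdd
  choose Φ hΦ heΦ using hmem
  obtain rfl := funext heΦ
  have hm : ∀ φ, IsTestFunction Ω φ → sInf energies ≤ torsionEnergy p Ω φ (gradient φ) :=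
    fun φ hφ => csInf_le hbdd ⟨φ, hφ, rfl⟩
  obtain ⟨u, g, hW⟩ := exists_tendstoW_of_forall_le hp hb hm hΦ he
  refine ⟨u, hW.isTorsionFunction_of_forall_le hp hb.measure_lt_top.ne fun φ hφ => ?_⟩
  rw [tendsto_nhds_unique (hW.tendsto_torsionEnergy hp hb.measure_lt_top.ne) he]
  exact hm φ hφ

end Existence

section VariationalCharacterization

variable {D : ℕ} {Ω : Set (E D)} {φ u : E D → ℝ} {g : E D → E D} {Φ : ℕ → E D → ℝ} {p : ℝ}

theorem TendstoW.setIntegral_norm_rpow_eq (hp : 1 < p) (hΩ : volume Ω ≠ ⊤)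
    (hW : TendstoW p Ω Φ u g)
    (hweak : ∀ φ, IsTestFunction Ω φ →
      ∫ x in Ω, φ x = ∫ x in Ω, inner ℝ (‖g x‖ ^ (p - 2) • g x) (gradient φ x)) :
    ∫ x in Ω, ‖g x‖ ^ p = ∫ x in Ω, u x := by
  have hpq := Real.HolderConjugate.conjExponent hp
  have hlim : Tendsto (fun n => ∫ x in Ω, inner ℝ (‖g x‖ ^ (p - 2) • g x) (gradient (Φ n) x)) atTop
      (𝓝 (∫ x in Ω, inner ℝ (‖g x‖ ^ (p - 2) • g x) (g x))) :=
    tendsto_integral_bilin hpq (innerSL ℝ) (memLp_norm_rpow_smul_self hpq hW.memLp_gradient)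
      hW.memLp_gradient_test hW.memLp_gradient hW.tendsto_eLpNorm_gradient
  simp only [inner_norm_rpow_smul_self hp,
    fun n => (hweak _ (hW.isTestFunction n)).symm] at hlim
  exact tendsto_nhds_unique hlim (hW.tendsto_setIntegral hp hΩ)

theorem exists_tendstoW_torsionalRigidity [NeZero D] (hp : 1 < p) (hb : Bornology.IsBounded Ω) :
    ∃ Φ u g, TendstoW p Ω Φ u g ∧ ∫ x in Ω, u x = torsionalRigidity p Ω ∧
      ∫ x in Ω, ‖g x‖ ^ p = torsionalRigidity p Ω ∧ ∀ φ, IsTestFunction Ω φ →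
        ∫ x in Ω, φ x = ∫ x in Ω, inner ℝ (‖g x‖ ^ (p - 2) • g x) (gradient φ x) := by
  have hex := exists_isTorsionFunction hp hb
  obtain ⟨g, hg, hweak⟩ := hex.choose_spec
  obtain ⟨Φ, hW⟩ := hg.exists_tendstoW
  have hT : ∫ x in Ω, hex.choose x = torsionalRigidity p Ω := by
    rw [torsionalRigidity, dif_pos hex]
  have hweak' : ∀ φ, IsTestFunction Ω φ →
      ∫ x in Ω, φ x = ∫ x in Ω, inner ℝ (‖g x‖ ^ (p - 2) • g x) (gradient φ x) := fun φ hφ => by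
    simp only [real_inner_smul_left, hweak φ hφ]
  exact ⟨Φ, _, g, hW, hT,
    (hW.setIntegral_norm_rpow_eq hp hb.measure_lt_top.ne hweak').trans hT, hweak'⟩

theorem torsionalRigidity_nonneg [NeZero D] (hp : 1 < p) (hb : Bornology.IsBounded Ω) :
    0 ≤ torsionalRigidity p Ω := by
  obtain ⟨Φ, u, g, -, -, hg, -⟩ := exists_tendstoW_torsionalRigidity hp hb
  rw [← hg]
  positivity

theorem IsTestFunction.integral_le [NeZero D] (hp : 1 < p) (hb : Bornology.IsBounded Ω)
    (hφ : IsTestFunction Ω φ) :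
    ∫ x, φ x ≤ torsionalRigidity p Ω ^ (1 - 1 / p) * (∫ x, ‖gradient φ x‖ ^ p) ^ (1 / p) := by
  have hpq := Real.HolderConjugate.conjExponent hp
  obtain ⟨Φ, u, g, hW, -, hg, hweak⟩ := exists_tendstoW_torsionalRigidity hp hb
  have hφL := (hφ.memLp_gradient (ENNReal.ofReal p)).restrict Ω
  rw [← hφ.setIntegral_eq, hweak φ hφ, ← hg,
    ← hφ.setIntegral_norm_gradient_rpow (zero_lt_one.trans hp)]
  refine le_trans ?_ (integral_norm_rpow_mul_le hp hW.memLp_gradient hφL.norm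
    fun x => norm_nonneg _)
  refine integral_mono
    (integrable_bilin hpq (innerSL ℝ) (memLp_norm_rpow_smul_self hpq hW.memLp_gradient) hφL)
    (integrable_bilin hpq (ContinuousLinearMap.mul ℝ ℝ)
      (memLp_norm_rpow_sub_one hpq hW.memLp_gradient) hφL.norm) fun x => ?_
  exact (real_inner_le_norm _ _).trans_eq (by rw [norm_norm_rpow_smul_self hp])

theorem torsionalRigidity_rpow_le [NeZero D] (hp : 1 < p) (hb : Bornology.IsBounded Ω)
    {K : ℝ} (hK : 0 ≤ K) (h : ∀ φ, IsTestFunction Ω φ →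
      ∫ x, φ x ≤ K * (∫ x, ‖gradient φ x‖ ^ p) ^ (1 / p)) :
    torsionalRigidity p Ω ^ (1 - 1 / p) ≤ K := by
  have hp0 : 0 < p := by linarith
  have hpinv : 1 / p < 1 := (div_lt_one hp0).2 hp
  obtain ⟨Φ, u, g, hW, hu, hg, -⟩ := exists_tendstoW_torsionalRigidity hp hb
  have hΦu := hW.tendsto_setIntegral hp hb.measure_lt_top.ne
  have hΦg := hW.tendsto_setIntegral_norm_gradient_rpow hp.le
  have hle : torsionalRigidity p Ω ≤ K * torsionalRigidity p Ω ^ (1 / p) := by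
    rw [hu] at hΦu
    rw [hg] at hΦg
    refine le_of_tendsto_of_tendsto' hΦu
      ((hΦg.rpow_const (p := 1 / p) (Or.inr (by positivity))).const_mul K) fun n => ?_
    rw [(hW.isTestFunction n).setIntegral_eq,
      (hW.isTestFunction n).setIntegral_norm_gradient_rpow hp0]
    exact h _ (hW.isTestFunction n)
  rcases (torsionalRigidity_nonneg hp hb).eq_or_lt with hT | hT
  · rwa [← hT, Real.zero_rpow (by linarith)]
  · rwa [Real.rpow_sub hT, Real.rpow_one, div_le_iff₀ (by positivity)]

end VariationalCharacterization

theorem exists_contDiffBump_seq {X : Type*} [NormedAddCommGroup X] {δ : ℝ} (hδ : 0 < δ) :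
    ∃ ρ : ℕ → ContDiffBump (0 : X), (∀ n, (ρ n).rOut ≤ δ) ∧
      (∀ n, (ρ n).rOut ≤ 2 * (ρ n).rIn) ∧ Tendsto (fun n => (ρ n).rOut) atTop (𝓝 0) := by
  have hr : ∀ n : ℕ, 0 < δ / 2 / (n + 1) := fun n => by positivity
  have hout : ∀ n : ℕ, 2 * (δ / 2 / (n + 1)) = δ / (n + 1) := fun n => by ring
  refine ⟨fun n => ⟨δ / 2 / (n + 1), 2 * (δ / 2 / (n + 1)), hr n, by linarith [hr n]⟩,
    fun n => ?_, fun n => le_rfl, ?_⟩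
  · exact (hout n).trans_le (div_le_self hδ.le (by linarith [Nat.cast_nonneg (α := ℝ) n]))
  · simp only [hout]
    simpa [div_eq_mul_inv] using
      (tendsto_one_div_add_atTop_nhds_zero_nat (𝕜 := ℝ)).const_mul δ

section Mollification

open scoped Convolution

variable {F V : Type*} [NormedAddCommGroup F] [NormedSpace ℝ F] [FiniteDimensional ℝ F]
  [MeasurableSpace F] [BorelSpace F] (μ : Measure F) [μ.IsAddHaarMeasure]
  [NormedAddCommGroup V] [NormedSpace ℝ V] {f : F → V} {C : NNReal} {δ p : ℝ}

theorem locallyIntegrable_fderiv_of_lipschitzWith [FiniteDimensional ℝ V]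
    (hf : LipschitzWith C f) : LocallyIntegrable (fderiv ℝ f) μ := by
  have hmeas : Measurable (fderiv ℝ f) := measurable_fderiv ℝ f
  exact (memLp_top_of_bound hmeas.aestronglyMeasurable C
    (Eventually.of_forall fun x => norm_fderiv_le_of_lipschitz ℝ hf)).locallyIntegrable le_top

theorem integrable_norm_fderiv_rpow_of_lipschitzWith [FiniteDimensional ℝ V] (hp : 0 < p)
    (hf : LipschitzWith C f) (hc : HasCompactSupport f) :
    Integrable (fun x => ‖fderiv ℝ f x‖ ^ p) μ := by
  have hmeas : Measurable (fderiv ℝ f) := measurable_fderiv ℝ f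
  have hbound : MemLp (fderiv ℝ f) (ENNReal.ofReal p) μ :=
    (memLp_top_of_bound hmeas.aestronglyMeasurable C (Eventually.of_forall fun x =>
      norm_fderiv_le_of_lipschitz ℝ hf)).mono_exponent_of_measure_support_ne_top
      (fun x hx => image_eq_zero_of_notMem_tsupport fun h => hx (tsupport_fderiv_subset ℝ h))
      hc.isCompact.measure_lt_top.ne le_top
  exact integrable_norm_rpow hp hbound

variable [HasContDiffBump F]

/-- The mollification of `f` by the bump function `ρ`, normalized to have integral `1`. -/
def mollify (ρ : ContDiffBump (0 : F)) (f : F → V) : F → V :=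
  ρ.normed μ ⋆[ContinuousLinearMap.lsmul ℝ ℝ, μ] f

theorem integrable_normed (ρ : ContDiffBump (0 : F)) : Integrable (ρ.normed μ) μ :=
  ρ.continuous_normed.integrable_of_hasCompactSupport ρ.hasCompactSupport_normed

theorem norm_mollify_le (ρ : ContDiffBump (0 : F)) {c : ℝ} (hf : ∀ x, ‖f x‖ ≤ c) (x : F) :
    ‖mollify μ ρ f x‖ ≤ c := by
  calc ‖mollify μ ρ f x‖ ≤ ∫ t, ρ.normed μ t * c ∂μ := by
        refine norm_integral_le_of_norm_le ((integrable_normed μ ρ).mul_const _)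
          (Eventually.of_forall fun t => ?_)
        rw [ContinuousLinearMap.lsmul_apply, norm_smul, Real.norm_of_nonneg (ρ.nonneg_normed t)]
        exact mul_le_mul_of_nonneg_left (hf _) (ρ.nonneg_normed t)
    _ = c := by rw [integral_mul_const, ρ.integral_normed, one_mul]

theorem contDiff_mollify (ρ : ContDiffBump (0 : F)) (hf : LocallyIntegrable f μ) :
    ContDiff ℝ ∞ (mollify μ ρ f) :=
  ρ.hasCompactSupport_normed.contDiff_convolution_left _ ρ.contDiff_normed hf

theorem tsupport_mollify_subset (ρ : ContDiffBump (0 : F)) (hδ : ρ.rOut ≤ δ) (f : F → V) :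
    tsupport (mollify μ ρ f) ⊆ Metric.cthickening δ (tsupport f) := by
  refine closure_minimal ((support_convolution_subset _).trans ?_) Metric.isClosed_cthickening
  rintro _ ⟨a, ha, b, hb, rfl⟩
  rw [ρ.support_normed_eq] at ha
  refine Metric.mem_cthickening_of_dist_le (a + b) b δ _ (subset_tsupport f hb) ?_
  rw [dist_eq_norm, add_sub_cancel_right]
  exact (mem_ball_zero_iff.1 ha).le.trans hδ

theorem integral_mollify [CompleteSpace V] (ρ : ContDiffBump (0 : F)) (hf : Integrable f μ) :
    ∫ x, mollify μ ρ f x ∂μ = ∫ x, f x ∂μ := by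
  refine (integral_convolution _ (integrable_normed μ ρ) hf).trans ?_
  rw [ρ.integral_normed, ContinuousLinearMap.lsmul_apply, one_smul]

theorem hasFDerivAt_mollify [FiniteDimensional ℝ V] (ρ : ContDiffBump (0 : F))
    (hf : LipschitzWith C f) (x₀ : F) :
    HasFDerivAt (mollify μ ρ f) (mollify μ ρ (fderiv ℝ f) x₀) x₀ := by
  have hρ : Continuous (ρ.normed μ) := ρ.continuous_normed
  have hf' := hf.continuous
  have hdiff : ∀ᵐ t ∂μ, DifferentiableAt ℝ f (x₀ - t) :=
    (Measure.measurePreserving_sub_left μ x₀).quasiMeasurePreserving.ae hf.ae_differentiableAt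
  refine (hasFDerivAt_integral_of_dominated_loc_of_lip (μ := μ) (𝕜 := ℝ)
    (F := fun x t => ρ.normed μ t • f (x - t))
    (F' := fun t => ρ.normed μ t • fderiv ℝ f (x₀ - t)) (bound := fun t => ρ.normed μ t * C)
    (Metric.ball_mem_nhds x₀ one_pos) ?_ ?_ ?_ ?_ ?_ ?_).2
  · exact Eventually.of_forall fun x => Continuous.aestronglyMeasurable (by fun_prop)
  · exact Continuous.integrable_of_hasCompactSupport (by fun_prop)
      ρ.hasCompactSupport_normed.smul_right
  · have hmeas : Measurable (fderiv ℝ f) := measurable_fderiv ℝ f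
    exact hρ.aestronglyMeasurable.smul
      (hmeas.comp (measurable_const.sub measurable_id)).aestronglyMeasurable
  · refine Eventually.of_forall fun t => LipschitzOnWith.of_dist_le_mul fun x _ y _ => ?_
    have hdist := hf.dist_le_mul (x - t) (y - t)
    have hρt : 0 ≤ ρ.normed μ t := ρ.nonneg_normed t
    rw [dist_sub_right] at hdist
    rw [dist_smul₀, Real.norm_of_nonneg hρt, Real.coe_nnabs,
      abs_of_nonneg (mul_nonneg hρt C.coe_nonneg), mul_assoc]
    exact mul_le_mul_of_nonneg_left hdist hρt
  · exact (integrable_normed μ ρ).mul_const _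
  · filter_upwards [hdiff] with t ht
    exact (ht.hasFDerivAt.comp x₀ (hasFDerivAt_sub_const t)).const_smul (ρ.normed μ t)

theorem tendsto_integral_norm_fderiv_mollify_rpow [FiniteDimensional ℝ V] (hp : 0 < p)
    (hf : LipschitzWith C f) (hc : HasCompactSupport f) {ρ : ℕ → ContDiffBump (0 : F)}
    (hδ : ∀ n, (ρ n).rOut ≤ δ) (hρ : ∀ n, (ρ n).rOut ≤ 2 * (ρ n).rIn)
    (hlim : Tendsto (fun n => (ρ n).rOut) atTop (𝓝 0)) :
    Tendsto (fun n => ∫ x, ‖fderiv ℝ (mollify μ (ρ n) f) x‖ ^ p ∂μ) atTop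
      (𝓝 (∫ x, ‖fderiv ℝ f x‖ ^ p ∂μ)) := by
  have hfderiv : ∀ n x, fderiv ℝ (mollify μ (ρ n) f) x = mollify μ (ρ n) (fderiv ℝ f) x :=
    fun n x => (hasFDerivAt_mollify μ (ρ n) hf x).fderiv
  have hK : IsCompact (Metric.cthickening δ (tsupport f)) := hc.isCompact.cthickening
  have hae : ∀ᵐ x ∂μ, Tendsto (fun n => mollify μ (ρ n) (fderiv ℝ f) x) atTop
      (𝓝 (fderiv ℝ f x)) :=
    ContDiffBump.ae_convolution_tendsto_right_of_locallyIntegrable hlim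
      (Eventually.of_forall hρ) (locallyIntegrable_fderiv_of_lipschitzWith μ hf)
  refine tendsto_integral_of_dominated_convergence
    ((Metric.cthickening δ (tsupport f)).indicator fun _ => (C : ℝ) ^ p) (fun n => ?_)
    ((integrable_indicator_iff hK.measurableSet).2 (integrableOn_const hK.measure_lt_top.ne))
    (fun n => Eventually.of_forall fun x => ?_) ?_
  · have hcont := ((contDiff_mollify μ (ρ n) hf.continuous.locallyIntegrable).continuous_fderiv
      (by simp)).norm
    exact (hcont.rpow_const fun _ => Or.inr hp.le).aestronglyMeasurable
  · rw [Real.norm_of_nonneg (by positivity)]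
    by_cases hx : x ∈ Metric.cthickening δ (tsupport f)
    · rw [Set.indicator_of_mem hx, hfderiv]
      exact Real.rpow_le_rpow (norm_nonneg _)
        (norm_mollify_le μ _ (fun _ => norm_fderiv_le_of_lipschitz ℝ hf) x) hp.le
    · rw [Set.indicator_of_notMem hx, fderiv_of_notMem_tsupport ℝ
        fun h => hx (tsupport_mollify_subset μ (ρ n) (hδ n) f h), norm_zero,
        Real.zero_rpow hp.ne']
  · filter_upwards [hae] with x hx
    simp only [hfderiv]
    exact hx.norm.rpow_const (Or.inr hp.le)

end Mollification

section LipschitzTestFunctions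

variable {F : Type*} [NormedAddCommGroup F] [NormedSpace ℝ F] {s : Set F} {f : F → ℝ} {δ : ℝ}

theorem norm_fderiv_max_sub_zero_le (δ : ℝ) {x : F} (hx : DifferentiableAt ℝ f x) :
    ‖fderiv ℝ (fun y => max (f y - δ) 0) x‖ ≤ ‖fderiv ℝ f x‖ := by
  rcases lt_trichotomy (f x) δ with h | h | h
  · have hloc : (fun y => max (f y - δ) 0) =ᶠ[𝓝 x] fun _ => 0 := by
      filter_upwards [hx.continuousAt.eventually_lt_const h] with y hy
      exact max_eq_right (by linarith)
    simp [hloc.fderiv_eq]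
  · have hmin : IsLocalMin (fun y => max (f y - δ) 0) x :=
      Eventually.of_forall fun y => by simp [h]
    simp [hmin.fderiv_eq_zero]
  · have hloc : (fun y => max (f y - δ) 0) =ᶠ[𝓝 x] fun y => f y - δ := by
      filter_upwards [hx.continuousAt.eventually_const_lt h] with y hy
      exact max_eq_left (by linarith)
    rw [hloc.fderiv_eq, fderiv_sub_const]

theorem tsupport_max_sub_zero_subset {X : Type*} [TopologicalSpace X] {s : Set X} {f : X → ℝ}
    (hf : Continuous f) (hs : ∀ x ∉ s, f x = 0) (hδ : 0 < δ) :
    tsupport (fun y => max (f y - δ) 0) ⊆ s := by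
  have hle : tsupport (fun y => max (f y - δ) 0) ⊆ {x | δ ≤ f x} := by
    refine closure_minimal (fun x hx => ?_) (isClosed_le continuous_const hf)
    by_contra! h
    exact hx (max_eq_right (sub_nonpos.2 (not_le.1 h).le))
  refine hle.trans fun x hx => ?_
  by_contra h
  exact (hδ.trans_le hx).ne' (hs x h)

theorem hasCompactSupport_of_eq_zero [FiniteDimensional ℝ F] (hb : Bornology.IsBounded s)
    (hs : ∀ x ∉ s, f x = 0) : HasCompactSupport f :=
  have := FiniteDimensional.proper ℝ F
  HasCompactSupport.of_support_subset_isCompact hb.isCompact_closure fun x hx =>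
    subset_closure (by_contra fun h => hx (hs x h))

theorem integral_le_integral_max_sub_zero_add [MeasurableSpace F] [BorelSpace F]
    [FiniteDimensional ℝ F] (μ : Measure F) [IsFiniteMeasureOnCompacts μ] (ho : IsOpen s)
    (hb : Bornology.IsBounded s) (hf : Continuous f) (hs : ∀ x ∉ s, f x = 0) (hδ : 0 ≤ δ) :
    ∫ x, f x ∂μ ≤ (∫ x, max (f x - δ) 0 ∂μ) + δ * μ.real s := by
  have := FiniteDimensional.proper ℝ F
  have htrunc : Integrable (fun x => max (f x - δ) 0) μ := by
    refine Continuous.integrable_of_hasCompactSupport (by fun_prop)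
      (hasCompactSupport_of_eq_zero hb fun x hx => ?_)
    rw [hs x hx, zero_sub, max_eq_right (neg_nonpos.2 hδ)]
  have hind : Integrable (s.indicator fun _ => δ) μ :=
    (integrable_indicator_iff ho.measurableSet).2 (integrableOn_const hb.measure_lt_top.ne)
  have hindint : ∫ x, s.indicator (fun _ => δ) x ∂μ = δ * μ.real s := by
    rw [integral_indicator ho.measurableSet, setIntegral_const, smul_eq_mul, mul_comm]
  rw [← hindint, ← integral_add htrunc hind]
  refine integral_mono (hf.integrable_of_hasCompactSupport (hasCompactSupport_of_eq_zero hb hs))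
    (htrunc.add hind) fun x => ?_
  by_cases hx : x ∈ s
  · simp only [Set.indicator_of_mem hx]
    linarith [le_max_left (f x - δ) 0]
  · simp only [Set.indicator_of_notMem hx, hs x hx, add_zero]
    exact le_max_right _ _

variable {D : ℕ} {Ω : Set (E D)} {f : E D → ℝ} {C : NNReal} {p : ℝ}

theorem isTestFunction_mollify (ρ : ContDiffBump (0 : E D)) (hf : Continuous f)
    (hc : HasCompactSupport f) (hρ : ρ.rOut ≤ δ) (hΩ : Metric.cthickening δ (tsupport f) ⊆ Ω) :
    IsTestFunction Ω (mollify volume ρ f) :=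
  have hsupp := tsupport_mollify_subset volume ρ hρ f
  ⟨contDiff_mollify volume ρ hf.locallyIntegrable,
    HasCompactSupport.of_support_subset_isCompact hc.isCompact.cthickening
      ((subset_tsupport _).trans hsupp),
    hsupp.trans hΩ⟩

theorem integral_le_of_lipschitzWith_of_tsupport_subset [NeZero D] (hp : 1 < p) (ho : IsOpen Ω)
    (hb : Bornology.IsBounded Ω) (hf : LipschitzWith C f) (hc : HasCompactSupport f)
    (hs : tsupport f ⊆ Ω) :
    ∫ x, f x ≤ torsionalRigidity p Ω ^ (1 - 1 / p) * (∫ x, ‖fderiv ℝ f x‖ ^ p) ^ (1 / p) := by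
  have hp0 : 0 < p := by linarith
  obtain ⟨δ, hδ, hδΩ⟩ := hc.isCompact.exists_cthickening_subset_open ho hs
  obtain ⟨ρ, hρδ, hρ, hlim⟩ := exists_contDiffBump_seq (X := E D) hδ
  have henergy := tendsto_integral_norm_fderiv_mollify_rpow volume hp0 hf hc hρδ hρ hlim
  refine ge_of_tendsto' ((henergy.rpow_const (p := 1 / p) (Or.inr (by positivity))).const_mul _)
    fun n => ?_
  have htest := (isTestFunction_mollify (ρ n) hf.continuous hc (hρδ n) hδΩ).integral_le hp hb
  simpa only [integral_mollify volume (ρ n) (hf.continuous.integrable_of_hasCompactSupport hc),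
    norm_gradient] using htest

theorem integral_le_of_lipschitzWith [NeZero D] (hp : 1 < p) (ho : IsOpen Ω)
    (hb : Bornology.IsBounded Ω) (hf : LipschitzWith C f) (hs : ∀ x ∉ Ω, f x = 0) :
    ∫ x, f x ≤ torsionalRigidity p Ω ^ (1 - 1 / p) * (∫ x, ‖fderiv ℝ f x‖ ^ p) ^ (1 / p) := by
  have hp0 : 0 < p := by linarith
  have hc := hasCompactSupport_of_eq_zero hb hs
  have hT := torsionalRigidity_nonneg hp hb
  set R := torsionalRigidity p Ω ^ (1 - 1 / p) * (∫ x, ‖fderiv ℝ f x‖ ^ p) ^ (1 / p)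
  have htrunc : ∀ δ > 0, ∫ x, f x ≤ R + δ * volume.real Ω := fun δ hδ => by
    have hlip : LipschitzWith C fun x => max (f x - δ) 0 :=
      LipschitzWith.max_const (by simpa using hf.sub (LipschitzWith.const δ)) 0
    have hsupp := tsupport_max_sub_zero_subset hf.continuous hs hδ
    have hcompact : HasCompactSupport fun x => max (f x - δ) 0 :=
      hasCompactSupport_of_eq_zero hb fun x hx => by
        rw [hs x hx, zero_sub, max_eq_right (neg_nonpos.2 hδ.le)]
    have henergy : ∫ x, ‖fderiv ℝ (fun y => max (f y - δ) 0) x‖ ^ p ≤ ∫ x, ‖fderiv ℝ f x‖ ^ p := by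
      refine integral_mono_ae (integrable_norm_fderiv_rpow_of_lipschitzWith _ hp0 hlip hcompact)
        (integrable_norm_fderiv_rpow_of_lipschitzWith _ hp0 hf hc) ?_
      filter_upwards [hf.ae_differentiableAt (μ := volume)] with x hx
      exact Real.rpow_le_rpow (norm_nonneg _) (norm_fderiv_max_sub_zero_le δ hx) hp0.le
    calc ∫ x, f x ≤ (∫ x, max (f x - δ) 0) + δ * volume.real Ω :=
          integral_le_integral_max_sub_zero_add volume ho hb hf.continuous hs hδ.le
      _ ≤ torsionalRigidity p Ω ^ (1 - 1 / p) *
            (∫ x, ‖fderiv ℝ (fun y => max (f y - δ) 0) x‖ ^ p) ^ (1 / p) + δ * volume.real Ω := by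
          gcongr
          exact integral_le_of_lipschitzWith_of_tsupport_subset hp ho hb hlip hcompact hsupp
      _ ≤ R + δ * volume.real Ω := by
          unfold R
          gcongr
  have hlim : Tendsto (fun δ : ℝ => R + δ * volume.real Ω) (𝓝[>] 0) (𝓝 R) := by
    have hcont : Continuous fun δ : ℝ => R + δ * volume.real Ω := by fun_prop
    simpa using (hcont.tendsto 0).mono_left nhdsWithin_le_nhds
  exact ge_of_tendsto hlim (eventually_nhdsWithin_of_forall htrunc)

end LipschitzTestFunctions

section HalfSqDist

/-- Half the square of `c - d`, where `d` is the distance to the complement of `Ω`. For convex `Ω`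
and `c > sup d`, its Laplacian is at least one, because `d` is concave with `|∇d| = 1`. -/
def halfSqDist {X : Type*} [PseudoMetricSpace X] (c : ℝ) (Ω : Set X) (x : X) : ℝ :=
  (c - Metric.infDist x Ωᶜ) ^ 2 / 2

theorem abs_halfSqDist_sub_le {X : Type*} [PseudoMetricSpace X] {Ω : Set X} {c : ℝ}
    (hc : ∀ x, Metric.infDist x Ωᶜ ≤ c) (x y : X) :
    |halfSqDist c Ω x - halfSqDist c Ω y| ≤
      (c - (Metric.infDist x Ωᶜ + Metric.infDist y Ωᶜ) / 2) * dist x y := by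
  have hdist : |Metric.infDist y Ωᶜ - Metric.infDist x Ωᶜ| ≤ dist x y := by
    rw [abs_sub_comm]
    simpa [Real.dist_eq] using (Metric.lipschitz_infDist_pt Ωᶜ).dist_le_mul x y
  have hfactor : halfSqDist c Ω x - halfSqDist c Ω y =
      (c - (Metric.infDist x Ωᶜ + Metric.infDist y Ωᶜ) / 2) *
        (Metric.infDist y Ωᶜ - Metric.infDist x Ωᶜ) := by
    unfold halfSqDist
    ring
  have hnonneg : 0 ≤ c - (Metric.infDist x Ωᶜ + Metric.infDist y Ωᶜ) / 2 := by
    linarith [hc x, hc y]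
  rw [hfactor, abs_mul, abs_of_nonneg hnonneg]
  gcongr

theorem lipschitzWith_halfSqDist {X : Type*} [PseudoMetricSpace X] {Ω : Set X} {c : ℝ}
    (hc : ∀ x, Metric.infDist x Ωᶜ ≤ c) : LipschitzWith c.toNNReal (halfSqDist c Ω) := by
  refine LipschitzWith.of_dist_le_mul fun x y => (abs_halfSqDist_sub_le hc x y).trans ?_
  have hx : 0 ≤ Metric.infDist x Ωᶜ := Metric.infDist_nonneg
  have hy : 0 ≤ Metric.infDist y Ωᶜ := Metric.infDist_nonneg
  rw [Real.coe_toNNReal c (hx.trans (hc x))]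
  gcongr
  linarith

variable {F : Type*} [NormedAddCommGroup F] [NormedSpace ℝ F] {Ω : Set F} {c : ℝ}

theorem norm_fderiv_halfSqDist_le (hc : ∀ x, Metric.infDist x Ωᶜ ≤ c) {x : F}
    (hx : DifferentiableAt ℝ (halfSqDist c Ω) x) :
    ‖fderiv ℝ (halfSqDist c Ω) x‖ ≤ c - Metric.infDist x Ωᶜ := by
  refine le_of_forall_pos_le_add fun η hη => ?_
  refine hx.hasFDerivAt.le_of_lip' (by linarith [hc x]) ?_
  filter_upwards [Metric.ball_mem_nhds x hη] with y hy
  refine (abs_halfSqDist_sub_le hc y x).trans ?_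
  have hxy : Metric.infDist x Ωᶜ ≤ Metric.infDist y Ωᶜ + dist x y :=
    Metric.infDist_le_infDist_add_dist
  rw [← dist_eq_norm]
  gcongr
  linarith [Metric.mem_ball'.1 hy]

end HalfSqDist

section SecondDifference

variable {F : Type*} [NormedAddCommGroup F] [InnerProductSpace ℝ F] {Ω : Set F} {x y z ν : F}

theorem exists_norm_eq_one_forall_inner_lt [CompleteSpace F] (ho : IsOpen Ω) (hcv : Convex ℝ Ω)
    (hne : Ω.Nonempty) (hy : y ∉ Ω) :
    ∃ ν : F, ‖ν‖ = 1 ∧ ∀ z ∈ Ω, inner ℝ ν z < inner ℝ ν y := by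
  obtain ⟨f, hf⟩ := geometric_hahn_banach_open_point hcv ho hy
  set w := (InnerProductSpace.toDual ℝ F).symm f
  have hfw : ∀ z, inner ℝ w z = f z := fun z => InnerProductSpace.toDual_symm_apply
  obtain ⟨x, hx⟩ := hne
  have hw : w ≠ 0 := by
    rintro hw
    have hlt := hf x hx
    rw [← hfw, ← hfw, hw, inner_zero_left, inner_zero_left] at hlt
    exact lt_irrefl _ hlt
  refine ⟨‖w‖⁻¹ • w, norm_smul_inv_norm (𝕜 := ℝ) hw, fun z hz => ?_⟩
  rw [real_inner_smul_left, real_inner_smul_left, hfw, hfw]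
  exact mul_lt_mul_of_pos_left (hf z hz) (inv_pos.2 (norm_pos_iff.2 hw))

theorem infDist_compl_le_inner_sub (hν : ‖ν‖ = 1) (hy : ∀ z ∈ Ω, inner ℝ ν z < inner ℝ ν y)
    (hz : z ∈ Ω) : Metric.infDist z Ωᶜ ≤ inner ℝ ν (y - z) := by
  by_contra! hlt
  have hpos : 0 < inner ℝ ν (y - z) := by
    rw [inner_sub_right]
    linarith [hy z hz]
  have hmem : z + inner ℝ ν (y - z) • ν ∈ Ω := by
    refine Metric.ball_infDist_compl_subset (x := z) ?_
    rwa [Metric.mem_ball, dist_eq_norm, add_sub_cancel_left, norm_smul, hν, mul_one,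
      Real.norm_of_nonneg hpos.le]
  have hinner := hy _ hmem
  rw [inner_add_right, real_inner_smul_right, real_inner_self_eq_norm_sq, hν,
    inner_sub_right] at hinner
  linarith

variable [FiniteDimensional ℝ F] {c h : ℝ}

theorem exists_norm_eq_one_forall_infDist_compl_le (ho : IsOpen Ω) (hcv : Convex ℝ Ω)
    (hne : Ωᶜ.Nonempty) (hx : x ∈ Ω) :
    ∃ ν : F, ‖ν‖ = 1 ∧
      ∀ z ∈ Ω, Metric.infDist z Ωᶜ ≤ Metric.infDist x Ωᶜ - inner ℝ ν (z - x) := by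
  obtain ⟨y, hy, hxy⟩ := ho.isClosed_compl.exists_infDist_eq_dist hne x
  obtain ⟨ν, hν, hsep⟩ := exists_norm_eq_one_forall_inner_lt ho hcv ⟨x, hx⟩ hy
  refine ⟨ν, hν, fun z hz => ?_⟩
  have hle : inner ℝ ν (y - x) ≤ Metric.infDist x Ωᶜ := by
    rw [hxy, dist_comm, dist_eq_norm]
    simpa [hν] using real_inner_le_norm ν (y - x)
  calc Metric.infDist z Ωᶜ ≤ inner ℝ ν (y - z) := infDist_compl_le_inner_sub hν hsep hz
    _ = inner ℝ ν (y - x) - inner ℝ ν (z - x) := by rw [← inner_sub_right, sub_sub_sub_cancel_right]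
    _ ≤ Metric.infDist x Ωᶜ - inner ℝ ν (z - x) := by gcongr

theorem exists_norm_eq_one_forall_inner_sq_le_halfSqDist (ho : IsOpen Ω) (hcv : Convex ℝ Ω)
    (hne : Ωᶜ.Nonempty) (hh : 0 ≤ h) (hx : Metric.closedBall x h ⊆ Ω)
    (hc : Metric.infDist x Ωᶜ + h ≤ c) :
    ∃ ν : F, ‖ν‖ = 1 ∧ ∀ v : F, ‖v‖ ≤ h → inner ℝ ν v ^ 2 ≤
      halfSqDist c Ω (x + v) + halfSqDist c Ω (x - v) - 2 * halfSqDist c Ω x := by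
  obtain ⟨ν, hν, hle⟩ := exists_norm_eq_one_forall_infDist_compl_le ho hcv hne
    (hx (Metric.mem_closedBall_self hh))
  refine ⟨ν, hν, fun v hv => ?_⟩
  have hadd := hle (x + v) (hx (by simpa using hv))
  have hsub := hle (x - v) (hx (by simpa using hv))
  rw [add_sub_cancel_left] at hadd
  rw [sub_sub_cancel_left, inner_neg_right] at hsub
  obtain ⟨hlow, hupp⟩ := abs_le.1 ((abs_real_inner_le_norm ν v).trans (by simpa [hν] using hv))
  have hadd_sq : (c - Metric.infDist x Ωᶜ + inner ℝ ν v) ^ 2 ≤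
      (c - Metric.infDist (x + v) Ωᶜ) ^ 2 := pow_le_pow_left₀ (by linarith) (by linarith) 2
  have hsub_sq : (c - Metric.infDist x Ωᶜ - inner ℝ ν v) ^ 2 ≤
      (c - Metric.infDist (x - v) Ωᶜ) ^ 2 := pow_le_pow_left₀ (by linarith) (by linarith) 2
  unfold halfSqDist
  linarith

theorem sq_le_sum_halfSqDist_second_difference {ι : Type*} [Fintype ι]
    (b : OrthonormalBasis ι ℝ F) (ho : IsOpen Ω) (hcv : Convex ℝ Ω) (hne : Ωᶜ.Nonempty)
    (hh : 0 ≤ h) (hx : Metric.closedBall x h ⊆ Ω) (hc : Metric.infDist x Ωᶜ + h ≤ c) :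
    h ^ 2 ≤ ∑ i, (halfSqDist c Ω (x + h • b i) + halfSqDist c Ω (x - h • b i) -
      2 * halfSqDist c Ω x) := by
  obtain ⟨ν, hν, hle⟩ := exists_norm_eq_one_forall_inner_sq_le_halfSqDist ho hcv hne hh hx hc
  calc h ^ 2 = ∑ i, inner ℝ ν (h • b i) ^ 2 := by
        simp only [real_inner_smul_right, mul_pow]
        rw [← Finset.mul_sum, b.sum_sq_inner_left, hν, one_pow, mul_one]
    _ ≤ _ := Finset.sum_le_sum fun i _ => hle _ (by
        rw [norm_smul, b.norm_eq_one, mul_one, Real.norm_of_nonneg hh])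

theorem abs_sum_apply_mul_apply_le {ι : Type*} [Fintype ι] (b : OrthonormalBasis ι ℝ F)
    (L M : F →L[ℝ] ℝ) : |∑ i, L (b i) * M (b i)| ≤ ‖L‖ * ‖M‖ := by
  set u := (InnerProductSpace.toDual ℝ F).symm L
  set v := (InnerProductSpace.toDual ℝ F).symm M
  have hL : ∀ i, L (b i) = inner ℝ u (b i) := fun i => InnerProductSpace.toDual_symm_apply.symm
  have hM : ∀ i, M (b i) = inner ℝ (b i) v := fun i => by
    rw [real_inner_comm]
    exact InnerProductSpace.toDual_symm_apply.symm
  simp only [hL, hM, b.sum_inner_mul_inner]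
  simpa [u, v] using abs_real_inner_le_norm u v

end SecondDifference

section DifferenceQuotient

theorem integral_mul_second_difference {G : Type*} [NormedAddCommGroup G] [MeasurableSpace G]
    [BorelSpace G] (μ : Measure G) [IsFiniteMeasureOnCompacts μ] [μ.IsAddRightInvariant]
    {f ψ : G → ℝ} (hf : Continuous f) (hc : HasCompactSupport f) (hψ : Continuous ψ) (v : G) :
    ∫ x, f x * (ψ (x + v) + ψ (x - v) - 2 * ψ x) ∂μ =
      -∫ x, (f (x + v) - f x) * (ψ (x + v) - ψ x) ∂μ := by
  have hfwd : Integrable (fun x => f x * (ψ (x + v) - ψ x)) μ :=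
    (hf.mul (by fun_prop)).integrable_of_hasCompactSupport hc.mul_right
  have hbwd : Integrable (fun x => f x * (ψ x - ψ (x - v))) μ :=
    (hf.mul (by fun_prop)).integrable_of_hasCompactSupport hc.mul_right
  have hshift : Integrable (fun x => f (x + v) * (ψ (x + v) - ψ x)) μ := by
    simpa using hbwd.comp_add_right v
  have htranslate : ∫ x, f (x + v) * (ψ (x + v) - ψ x) ∂μ = ∫ x, f x * (ψ x - ψ (x - v)) ∂μ := by
    rw [← integral_add_right_eq_self (fun x => f x * (ψ x - ψ (x - v))) v]
    simp
  calc ∫ x, f x * (ψ (x + v) + ψ (x - v) - 2 * ψ x) ∂μ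
      = ∫ x, (f x * (ψ (x + v) - ψ x) - f x * (ψ x - ψ (x - v))) ∂μ := by
        congr 1 with x
        ring
    _ = -((∫ x, f (x + v) * (ψ (x + v) - ψ x) ∂μ) - ∫ x, f x * (ψ (x + v) - ψ x) ∂μ) := by
        rw [integral_sub hfwd hbwd, htranslate, neg_sub]
    _ = -∫ x, (f (x + v) - f x) * (ψ (x + v) - ψ x) ∂μ := by
        simp only [sub_mul]
        rw [integral_sub hshift hfwd]

variable {F : Type*} [NormedAddCommGroup F] [NormedSpace ℝ F] {f ψ : F → ℝ} {v : F}

theorem abs_slope_le_of_lipschitzWith {B : NNReal} (hf : LipschitzWith B f) (hv : ‖v‖ ≤ 1) {t : ℝ}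
    (ht : 0 < t) (x : F) : |t⁻¹ * (f (x + t • v) - f x)| ≤ B := by
  have hlip := hf.dist_le_mul (x + t • v) x
  rw [Real.dist_eq, dist_eq_norm, add_sub_cancel_left, norm_smul, Real.norm_of_nonneg ht.le] at hlip
  rw [abs_mul, abs_of_pos (inv_pos.2 ht), inv_mul_le_iff₀ ht]
  calc |f (x + t • v) - f x| ≤ B * (t * ‖v‖) := hlip
    _ ≤ B * (t * 1) := by gcongr
    _ = t * B := by ring

theorem slope_eq_zero_of_notMem_cthickening (hv : ‖v‖ ≤ 1) {t : ℝ} (ht : t ∈ Set.Ioc (0 : ℝ) 1)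
    {x : F} (hx : x ∉ Metric.cthickening 1 (tsupport f)) : t⁻¹ * (f (x + t • v) - f x) = 0 := by
  have hfx : f x = 0 := image_eq_zero_of_notMem_tsupport fun h =>
    hx (Metric.self_subset_cthickening _ h)
  have hfxv : f (x + t • v) = 0 := image_eq_zero_of_notMem_tsupport fun h => by
    refine hx (Metric.mem_cthickening_of_dist_le x _ 1 _ h ?_)
    rw [dist_eq_norm, sub_add_cancel_left, norm_neg, norm_smul, Real.norm_of_nonneg ht.1.le]
    exact mul_le_one₀ ht.2 (norm_nonneg _) hv
  rw [hfx, hfxv, sub_self, mul_zero]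

theorem tendsto_integral_slope_mul_slope [FiniteDimensional ℝ F] [MeasurableSpace F]
    [BorelSpace F] (μ : Measure F) [μ.IsAddHaarMeasure] {B C : NNReal}
    (hf : LipschitzWith B f) (hc : HasCompactSupport f) (hψ : LipschitzWith C ψ) (hv : ‖v‖ ≤ 1) :
    Tendsto (fun t : ℝ => ∫ x, (t⁻¹ * (f (x + t • v) - f x)) * (t⁻¹ * (ψ (x + t • v) - ψ x)) ∂μ)
      (𝓝[>] 0) (𝓝 (∫ x, fderiv ℝ f x v * fderiv ℝ ψ x v ∂μ)) := by
  have hK : IsCompact (Metric.cthickening 1 (tsupport f)) := hc.isCompact.cthickening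
  have hfc := hf.continuous
  have hψc := hψ.continuous
  refine tendsto_integral_filter_of_dominated_convergence
    ((Metric.cthickening 1 (tsupport f)).indicator fun _ => (B : ℝ) * C)
    (Eventually.of_forall fun t => Continuous.aestronglyMeasurable (by fun_prop)) ?_
    ((integrable_indicator_iff hK.measurableSet).2 (integrableOn_const hK.measure_lt_top.ne)) ?_
  · filter_upwards [Ioc_mem_nhdsGT (zero_lt_one (α := ℝ))] with t ht
    refine Eventually.of_forall fun x => ?_
    by_cases hx : x ∈ Metric.cthickening 1 (tsupport f)
    · rw [Set.indicator_of_mem hx, Real.norm_eq_abs, abs_mul]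
      exact mul_le_mul (abs_slope_le_of_lipschitzWith hf hv ht.1 x)
        (abs_slope_le_of_lipschitzWith hψ hv ht.1 x) (abs_nonneg _) B.2
    · rw [Set.indicator_of_notMem hx, slope_eq_zero_of_notMem_cthickening hv ht hx, zero_mul,
        norm_zero]
  · filter_upwards [hf.ae_differentiableAt (μ := μ), hψ.ae_differentiableAt (μ := μ)]
      with x hfx hψx
    exact (hfx.hasFDerivAt.hasLineDerivAt v).tendsto_slope_zero_right.mul
      (hψx.hasFDerivAt.hasLineDerivAt v).tendsto_slope_zero_right

end DifferenceQuotient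

section HardyInequality

variable {F : Type*} [NormedAddCommGroup F] [InnerProductSpace ℝ F] [FiniteDimensional ℝ F]
  [MeasurableSpace F] [BorelSpace F] (μ : Measure F) [μ.IsAddHaarMeasure]
  {Ω : Set F} {f : F → ℝ} {C : NNReal} {c R h : ℝ}

theorem integral_le_neg_sum_integral_slope_mul_slope {ι : Type*} [Fintype ι]
    (b : OrthonormalBasis ι ℝ F) (ho : IsOpen Ω) (hcv : Convex ℝ Ω) (hne : Ωᶜ.Nonempty)
    (hf : Continuous f) (hfc : HasCompactSupport f) (h0 : ∀ x, 0 ≤ f x) (hh : 0 < h)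
    (hc : ∀ x, Metric.infDist x Ωᶜ + h ≤ c) (hs : Metric.cthickening h (tsupport f) ⊆ Ω) :
    ∫ x, f x ∂μ ≤ -∑ i, ∫ x, (h⁻¹ * (f (x + h • b i) - f x)) *
      (h⁻¹ * (halfSqDist c Ω (x + h • b i) - halfSqDist c Ω x)) ∂μ := by
  set ψ := halfSqDist c Ω
  have hψ : Continuous ψ :=
    (lipschitzWith_halfSqDist fun x => by linarith [hc x]).continuous
  have hle : ∀ x, h ^ 2 * f x ≤ ∑ i, f x * (ψ (x + h • b i) + ψ (x - h • b i) - 2 * ψ x) := by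
    intro x
    rw [← Finset.mul_sum, mul_comm]
    by_cases hx : x ∈ tsupport f
    · refine mul_le_mul_of_nonneg_left ?_ (h0 x)
      exact sq_le_sum_halfSqDist_second_difference b ho hcv hne hh.le
        ((Metric.closedBall_subset_cthickening hx h).trans hs) (hc x)
    · rw [image_eq_zero_of_notMem_tsupport hx, zero_mul, zero_mul]
  have hInt : ∀ i, Integrable
      (fun x => f x * (ψ (x + h • b i) + ψ (x - h • b i) - 2 * ψ x)) μ := fun i =>
    (hf.mul (by fun_prop)).integrable_of_hasCompactSupport hfc.mul_right
  have hsum : h ^ 2 * ∫ x, f x ∂μ ≤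
      -∑ i, ∫ x, (f (x + h • b i) - f x) * (ψ (x + h • b i) - ψ x) ∂μ := by
    have hmono := integral_mono ((hf.integrable_of_hasCompactSupport hfc).const_mul (h ^ 2))
      (integrable_finsetSum Finset.univ fun i _ => hInt i) hle
    rw [integral_const_mul, integral_finsetSum _ fun i _ => hInt i] at hmono
    simpa only [integral_mul_second_difference μ hf hfc hψ, Finset.sum_neg_distrib] using hmono
  have hscale : ∀ x i, (h⁻¹ * (f (x + h • b i) - f x)) * (h⁻¹ * (ψ (x + h • b i) - ψ x)) =
      (h ^ 2)⁻¹ * ((f (x + h • b i) - f x) * (ψ (x + h • b i) - ψ x)) := fun x i => by ring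
  simp only [hscale, integral_const_mul]
  rw [← Finset.mul_sum, ← mul_neg, le_inv_mul_iff₀ (pow_pos hh 2)]
  exact hsum

theorem integrable_fderiv_of_lipschitzWith (hf : LipschitzWith C f) (hfc : HasCompactSupport f) :
    Integrable (fderiv ℝ f) μ := by
  have hnorm := integrable_norm_fderiv_rpow_of_lipschitzWith μ one_pos hf hfc
  simp only [Real.rpow_one] at hnorm
  exact (integrable_norm_iff (measurable_fderiv ℝ f).aestronglyMeasurable).1 hnorm

theorem integrable_norm_fderiv_mul_sub_infDist (hf : LipschitzWith C f)
    (hfc : HasCompactSupport f) (hc : ∀ x, Metric.infDist x Ωᶜ ≤ c) :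
    Integrable (fun x => ‖fderiv ℝ f x‖ * (c - Metric.infDist x Ωᶜ)) μ := by
  have hcont : Continuous fun x => c - Metric.infDist x Ωᶜ :=
    continuous_const.sub (Metric.continuous_infDist_pt _)
  refine (integrable_fderiv_of_lipschitzWith μ hf hfc).norm.mul_bdd (c := c)
    hcont.aestronglyMeasurable (Eventually.of_forall fun x => ?_)
  rw [Real.norm_of_nonneg (sub_nonneg.2 (hc x))]
  exact sub_le_self _ Metric.infDist_nonneg

theorem neg_sum_integral_fderiv_mul_fderiv_halfSqDist_le {ι : Type*} [Fintype ι]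
    (b : OrthonormalBasis ι ℝ F) (hf : LipschitzWith C f) (hfc : HasCompactSupport f)
    (hc : ∀ x, Metric.infDist x Ωᶜ ≤ c) :
    -∑ i, ∫ x, fderiv ℝ f x (b i) * fderiv ℝ (halfSqDist c Ω) x (b i) ∂μ ≤
      ∫ x, ‖fderiv ℝ f x‖ * (c - Metric.infDist x Ωᶜ) ∂μ := by
  set ψ := halfSqDist c Ω
  have hψ : LipschitzWith c.toNNReal ψ := lipschitzWith_halfSqDist hc
  have hInt : ∀ i, Integrable (fun x => fderiv ℝ f x (b i) * fderiv ℝ ψ x (b i)) μ := fun i =>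
    ((integrable_fderiv_of_lipschitzWith μ hf hfc).apply_continuousLinearMap (b i)).mul_bdd
      (measurable_fderiv_apply_const ℝ ψ (b i)).aestronglyMeasurable (Eventually.of_forall fun x =>
        (fderiv ℝ ψ x).le_of_opNorm_le (norm_fderiv_le_of_lipschitz ℝ hψ) (b i))
  rw [← integral_finsetSum _ fun i _ => hInt i, ← integral_neg]
  refine integral_mono_ae (integrable_finsetSum _ fun i _ => hInt i).neg
    (integrable_norm_fderiv_mul_sub_infDist μ hf hfc hc) ?_
  filter_upwards [hψ.ae_differentiableAt (μ := μ)] with x hx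
  calc -∑ i, fderiv ℝ f x (b i) * fderiv ℝ ψ x (b i)
      ≤ ‖fderiv ℝ f x‖ * ‖fderiv ℝ ψ x‖ :=
        (neg_le_abs _).trans (abs_sum_apply_mul_apply_le b _ _)
    _ ≤ ‖fderiv ℝ f x‖ * (c - Metric.infDist x Ωᶜ) := by
        gcongr
        exact norm_fderiv_halfSqDist_le hc hx

theorem integral_le_integral_norm_fderiv_mul_sub_infDist_of_lt (ho : IsOpen Ω)
    (hcv : Convex ℝ Ω) (hne : Ωᶜ.Nonempty) (hf : LipschitzWith C f) (hfc : HasCompactSupport f)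
    (hs : tsupport f ⊆ Ω) (h0 : ∀ x, 0 ≤ f x) (hR : ∀ x, Metric.infDist x Ωᶜ ≤ R) (hRc : R < c) :
    ∫ x, f x ∂μ ≤ ∫ x, ‖fderiv ℝ f x‖ * (c - Metric.infDist x Ωᶜ) ∂μ := by
  obtain ⟨δ, hδ, hsub⟩ := hfc.isCompact.exists_cthickening_subset_open ho hs
  have hc : ∀ x, Metric.infDist x Ωᶜ ≤ c := fun x => (hR x).trans hRc.le
  let b := stdOrthonormalBasis ℝ F
  have hlim := (tendsto_finsetSum Finset.univ fun i _ => tendsto_integral_slope_mul_slope μ hf hfc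
    (lipschitzWith_halfSqDist hc) (b.norm_eq_one i).le).neg
  refine (ge_of_tendsto hlim ?_).trans
    (neg_sum_integral_fderiv_mul_fderiv_halfSqDist_le μ b hf hfc hc)
  filter_upwards [Ioc_mem_nhdsGT hδ, Ioc_mem_nhdsGT (sub_pos.2 hRc)] with h hhδ hhc
  exact integral_le_neg_sum_integral_slope_mul_slope μ b ho hcv hne hf.continuous hfc h0 hhδ.1
    (fun x => by linarith [hR x, hhc.2]) ((Metric.cthickening_mono hhδ.2 _).trans hsub)

theorem integral_le_integral_norm_fderiv_mul_sub_infDist_of_nonneg (ho : IsOpen Ω)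
    (hcv : Convex ℝ Ω) (hne : Ωᶜ.Nonempty) (hf : LipschitzWith C f) (hfc : HasCompactSupport f)
    (hs : tsupport f ⊆ Ω) (h0 : ∀ x, 0 ≤ f x) (hR : ∀ x, Metric.infDist x Ωᶜ ≤ R) :
    ∫ x, f x ∂μ ≤ ∫ x, ‖fderiv ℝ f x‖ * (R - Metric.infDist x Ωᶜ) ∂μ := by
  have hlim : Tendsto (fun c => (∫ x, ‖fderiv ℝ f x‖ * (R - Metric.infDist x Ωᶜ) ∂μ) +
      (∫ x, ‖fderiv ℝ f x‖ ∂μ) * (c - R)) (𝓝[>] R)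
      (𝓝 (∫ x, ‖fderiv ℝ f x‖ * (R - Metric.infDist x Ωᶜ) ∂μ)) := by
    refine tendsto_nhdsWithin_of_tendsto_nhds (Continuous.tendsto' (by fun_prop) _ _ ?_)
    rw [sub_self, mul_zero, add_zero]
  refine ge_of_tendsto hlim ?_
  filter_upwards [self_mem_nhdsWithin] with c hRc
  refine (integral_le_integral_norm_fderiv_mul_sub_infDist_of_lt μ ho hcv hne hf hfc hs h0 hR
    hRc).trans_eq ?_
  rw [← integral_mul_const, ← integral_add (integrable_norm_fderiv_mul_sub_infDist μ hf hfc hR)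
    ((integrable_fderiv_of_lipschitzWith μ hf hfc).norm.mul_const _)]
  congr 1 with x
  ring

theorem integral_le_integral_norm_fderiv_mul_sub_infDist (ho : IsOpen Ω) (hcv : Convex ℝ Ω)
    (hne : Ωᶜ.Nonempty) (hf : LipschitzWith C f) (hfc : HasCompactSupport f)
    (hs : tsupport f ⊆ Ω) (hR : ∀ x, Metric.infDist x Ωᶜ ≤ R) :
    ∫ x, f x ∂μ ≤ ∫ x, ‖fderiv ℝ f x‖ * (R - Metric.infDist x Ωᶜ) ∂μ := by
  have hsupp : Function.support (fun x => max (f x) 0) ⊆ Function.support f := fun x hx hfx =>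
    hx (by simp [hfx])
  have hpc : HasCompactSupport fun x => max (f x) 0 := hfc.mono hsupp
  have hp : LipschitzWith C fun x => max (f x) 0 := hf.max_const 0
  calc ∫ x, f x ∂μ ≤ ∫ x, max (f x) 0 ∂μ :=
        integral_mono (hf.continuous.integrable_of_hasCompactSupport hfc)
          (hp.continuous.integrable_of_hasCompactSupport hpc) fun x => le_max_left _ _
    _ ≤ ∫ x, ‖fderiv ℝ (fun x => max (f x) 0) x‖ * (R - Metric.infDist x Ωᶜ) ∂μ :=
        integral_le_integral_norm_fderiv_mul_sub_infDist_of_nonneg μ ho hcv hne hp hpc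
          ((closure_mono hsupp).trans hs) (fun x => le_max_right _ _) hR
    _ ≤ ∫ x, ‖fderiv ℝ f x‖ * (R - Metric.infDist x Ωᶜ) ∂μ := by
        refine integral_mono_ae (integrable_norm_fderiv_mul_sub_infDist μ hp hpc hR)
          (integrable_norm_fderiv_mul_sub_infDist μ hf hfc hR) ?_
        filter_upwards [hf.ae_differentiableAt (μ := μ)] with x hx
        have hle := norm_fderiv_max_sub_zero_le 0 hx
        simp only [sub_zero] at hle
        exact mul_le_mul_of_nonneg_right hle (sub_nonneg.2 (hR x))

end HardyInequality

section Gauge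

/-- `J` is the gauge of `Ω` with respect to the centre `x₀`: the nonnegative function which is
positively homogeneous about `x₀` and whose open unit ball is `Ω`. -/
structure IsGaugeAt {F : Type*} [AddCommGroup F] [Module ℝ F] (Ω : Set F) (x₀ : F) (J : F → ℝ) :
    Prop where
  nonneg : ∀ x, 0 ≤ J x
  lt_one_iff : ∀ x, J x < 1 ↔ x ∈ Ω
  map_smul : ∀ t : ℝ, 0 < t → ∀ v, J (x₀ + t • v) = t * J (x₀ + v)

/-- The profile `1 - J ^ q` of a gauge `J`, extended by zero outside its unit ball. If `J` is the
Euclidean norm and `q` is conjugate to `p`, this is a multiple of the `p`-torsion function of the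
unit ball. -/
def gaugeProfile {X : Type*} (q : ℝ) (J : X → ℝ) (x : X) : ℝ := 1 - min (J x) 1 ^ q

namespace IsGaugeAt

section Module

variable {F : Type*} [AddCommGroup F] [Module ℝ F] {Ω : Set F} {x₀ x : F} {J : F → ℝ} {q t : ℝ}

theorem setOf_lt (h : IsGaugeAt Ω x₀ J) (ht : 0 < t) :
    {x | J x < t} = AffineMap.homothety x₀ t '' Ω := by
  ext x
  constructor
  · intro hx
    refine ⟨x₀ + t⁻¹ • (x - x₀), (h.lt_one_iff _).1 ?_, ?_⟩
    · rwa [h.map_smul _ (inv_pos.2 ht), add_sub_cancel, inv_mul_lt_iff₀ ht, mul_one]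
    · simp [AffineMap.homothety_apply, smul_smul, mul_inv_cancel₀ ht.ne']
  · rintro ⟨y, hy, rfl⟩
    rw [Set.mem_ofPred_eq, AffineMap.homothety_apply, vsub_eq_sub, vadd_eq_add, add_comm,
      h.map_smul _ ht, add_sub_cancel]
    exact mul_lt_of_lt_one_right ht ((h.lt_one_iff y).2 hy)

theorem isOpen [TopologicalSpace F] (h : IsGaugeAt Ω x₀ J) (hJ : Continuous J) : IsOpen Ω := by
  convert isOpen_lt hJ (continuous_const (y := (1 : ℝ))) using 1
  exact Set.ext fun x => (h.lt_one_iff x).symm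

theorem gaugeProfile_eq (h : IsGaugeAt Ω x₀ J) (q : ℝ) (hx : x ∈ Ω) :
    gaugeProfile q J x = 1 - J x ^ q := by
  rw [gaugeProfile, min_eq_left ((h.lt_one_iff x).2 hx).le]

theorem gaugeProfile_eq_zero (h : IsGaugeAt Ω x₀ J) (q : ℝ) (hx : x ∉ Ω) :
    gaugeProfile q J x = 0 := by
  have hJx : 1 ≤ J x := not_lt.1 fun hlt => hx ((h.lt_one_iff x).1 hlt)
  rw [gaugeProfile, min_eq_right hJx, Real.one_rpow, sub_self]

end Module

end IsGaugeAt

section Normed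

variable {F : Type*} [NormedAddCommGroup F] [NormedSpace ℝ F] {Ω : Set F} {x₀ : F}

theorem exists_isGaugeAt (ho : IsOpen Ω) (hcv : Convex ℝ Ω) {r : ℝ} (hr : 0 < r)
    (hball : Metric.ball x₀ r ⊆ Ω) :
    ∃ J : F → ℝ, IsGaugeAt Ω x₀ J ∧ LipschitzWith (Real.toNNReal r)⁻¹ J := by
  set K : Set F := (fun v => x₀ + v) ⁻¹' Ω with hK
  have hKo : IsOpen K := ho.preimage (by fun_prop)
  have hKc : Convex ℝ K := hcv.translate_preimage_right x₀
  have hKb : Metric.ball (0 : F) (Real.toNNReal r) ⊆ K := by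
    intro v hv
    rw [Real.coe_toNNReal r hr.le, mem_ball_zero_iff] at hv
    exact hball (by simpa [Metric.mem_ball, dist_eq_norm] using hv)
  have h0 : (0 : F) ∈ K := hKb (Metric.mem_ball_self (by simpa using hr))
  have hlt : ∀ v, gauge K v < 1 ↔ v ∈ K :=
    Set.ext_iff.1 (setOfPred_gauge_lt_one_eq_self_of_isOpen hKc h0 hKo)
  refine ⟨fun x => gauge K (x - x₀), ⟨fun x => gauge_nonneg _, fun x => ?_, fun t ht v => ?_⟩, ?_⟩
  · rw [hlt, hK, Set.mem_preimage, add_sub_cancel]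
  · rw [add_sub_cancel_left, add_sub_cancel_left, gauge_smul_of_nonneg ht.le, smul_eq_mul]
  · refine LipschitzWith.of_dist_le_mul fun x y => ?_
    rw [← dist_sub_right x y x₀]
    exact (hKc.lipschitzWith_gauge (by simpa using hr) hKb).dist_le_mul (x - x₀) (y - x₀)

theorem abs_rpow_sub_rpow_le {q : ℝ} (hq : 1 ≤ q) {a b : ℝ} (ha : a ∈ Set.Icc (0 : ℝ) 1)
    (hb : b ∈ Set.Icc (0 : ℝ) 1) : |b ^ q - a ^ q| ≤ q * |b - a| := by
  refine Convex.norm_image_sub_le_of_norm_hasDerivWithin_le (f := fun x : ℝ => x ^ q)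
    (f' := fun x => q * x ^ (q - 1)) (s := Set.Icc 0 1)
    (fun x _ => (Real.hasDerivAt_rpow_const (Or.inr hq)).hasDerivWithinAt) (fun x hx => ?_)
    (convex_Icc 0 1) ha hb
  rw [Real.norm_of_nonneg (mul_nonneg (by linarith) (Real.rpow_nonneg hx.1 _))]
  exact mul_le_of_le_one_right (by linarith) (Real.rpow_le_one hx.1 hx.2 (by linarith))

theorem lipschitzWith_gaugeProfile {X : Type*} [PseudoMetricSpace X] {q : ℝ} (hq : 1 ≤ q)
    {J : X → ℝ} {C : NNReal} (hJ : LipschitzWith C J) (h0 : ∀ x, 0 ≤ J x) :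
    LipschitzWith (q.toNNReal * C) (gaugeProfile q J) := by
  refine LipschitzWith.of_dist_le_mul fun x y => ?_
  have hmem : ∀ z, min (J z) 1 ∈ Set.Icc (0 : ℝ) 1 := fun z =>
    ⟨le_min (h0 z) zero_le_one, min_le_right _ _⟩
  rw [Real.dist_eq, gaugeProfile, gaugeProfile, sub_sub_sub_cancel_left, NNReal.coe_mul,
    Real.coe_toNNReal q (by linarith), mul_assoc, dist_comm x y]
  refine (abs_rpow_sub_rpow_le hq (hmem x) (hmem y)).trans ?_
  gcongr
  exact (hJ.min_const 1).dist_le_mul y x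

namespace IsGaugeAt

variable {J : F → ℝ} {x : F} {q : ℝ}

theorem norm_fderiv_gaugeProfile (h : IsGaugeAt Ω x₀ J) (ho : IsOpen Ω) (hq : 1 ≤ q) (hx : x ∈ Ω)
    (hd : DifferentiableAt ℝ J x) :
    ‖fderiv ℝ (gaugeProfile q J) x‖ = q * J x ^ (q - 1) * ‖fderiv ℝ J x‖ := by
  have hloc : gaugeProfile q J =ᶠ[𝓝 x] fun y => 1 - J y ^ q := by
    filter_upwards [ho.mem_nhds hx] with y hy using h.gaugeProfile_eq q hy
  rw [hloc.fderiv_eq, ((hd.hasFDerivAt.rpow_const (Or.inr hq)).const_sub 1).fderiv, norm_neg,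
    norm_smul,
    Real.norm_of_nonneg (mul_nonneg (by linarith) (Real.rpow_nonneg (h.nonneg x) _))]

theorem fderiv_gaugeProfile_eq_zero (h : IsGaugeAt Ω x₀ J) (hq : 0 ≤ q) (hx : x ∉ Ω) :
    fderiv ℝ (gaugeProfile q J) x = 0 := by
  refine IsLocalMin.fderiv_eq_zero (Eventually.of_forall fun y => ?_)
  rw [h.gaugeProfile_eq_zero q hx, gaugeProfile, sub_nonneg]
  exact Real.rpow_le_one (le_min (h.nonneg y) zero_le_one) (min_le_right _ _) hq

end IsGaugeAt

end Normed

end Gauge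

section GaugeIntegral

theorem integral_Ioc_one_sub_rpow {s : ℝ} (hs : 0 ≤ s) :
    ∫ t in Set.Ioc (0 : ℝ) 1, (1 - t ^ s) = s / (s + 1) := by
  rw [← intervalIntegral.integral_of_le zero_le_one, intervalIntegral.integral_sub
    intervalIntegrable_const (intervalIntegral.intervalIntegrable_rpow' (by linarith)),
    integral_rpow (Or.inl (by linarith)), Real.one_rpow, Real.zero_rpow (by linarith)]
  simp only [integral_one, sub_zero]
  field_simp
  ring

variable {F : Type*} [NormedAddCommGroup F] [NormedSpace ℝ F] [MeasurableSpace F] [BorelSpace F]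
  (μ : Measure F) {Ω : Set F} {x₀ : F} {J : F → ℝ} {C : NNReal} {p q : ℝ}

open Module (finrank)

namespace IsGaugeAt

theorem integrableOn_rpow_mul_norm_fderiv_rpow (h : IsGaugeAt Ω x₀ J) (hJ : LipschitzWith C J)
    (hfin : μ Ω ≠ ⊤) (hq : 0 ≤ q) (hp : 0 ≤ p) :
    IntegrableOn (fun x => J x ^ q * ‖fderiv ℝ J x‖ ^ p) Ω μ := by
  have hcont : Continuous fun x => J x ^ q := hJ.continuous.rpow_const fun x => Or.inr hq
  refine Integrable.mono' (integrableOn_const (C := (C : ℝ) ^ p) hfin)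
    (hcont.aestronglyMeasurable.mul
      ((measurable_fderiv ℝ J).norm.pow_const p).aestronglyMeasurable) ?_
  filter_upwards [ae_restrict_mem (h.isOpen hJ.continuous).measurableSet] with x hx
  have hJx := Real.rpow_nonneg (h.nonneg x) q
  rw [Real.norm_of_nonneg (mul_nonneg hJx (Real.rpow_nonneg (norm_nonneg _) _))]
  calc J x ^ q * ‖fderiv ℝ J x‖ ^ p ≤ 1 * (C : ℝ) ^ p := by
        gcongr
        · exact Real.rpow_le_one (h.nonneg x) ((h.lt_one_iff x).2 hx).le hq
        · exact norm_fderiv_le_of_lipschitz ℝ hJ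
    _ = (C : ℝ) ^ p := one_mul _

theorem integrableOn_rpow (h : IsGaugeAt Ω x₀ J) (hJ : Continuous J) (hfin : μ Ω ≠ ⊤)
    (hq : 0 ≤ q) : IntegrableOn (fun x => J x ^ q) Ω μ := by
  refine Integrable.mono' (integrableOn_const (C := (1 : ℝ)) hfin)
    (hJ.rpow_const fun x => Or.inr hq).aestronglyMeasurable ?_
  filter_upwards [ae_restrict_mem (h.isOpen hJ).measurableSet] with x hx
  rw [Real.norm_of_nonneg (Real.rpow_nonneg (h.nonneg x) q)]
  exact Real.rpow_le_one (h.nonneg x) ((h.lt_one_iff x).2 hx).le hq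

variable [FiniteDimensional ℝ F] [μ.IsAddHaarMeasure]

theorem measureReal_setOf_lt (h : IsGaugeAt Ω x₀ J) {t : ℝ} (ht : 0 < t) :
    μ.real {x | J x < t} = t ^ finrank ℝ F * μ.real Ω := by
  rw [h.setOf_lt ht, measureReal_def, Measure.addHaar_image_homothety, ENNReal.toReal_mul,
    ENNReal.toReal_ofReal (abs_nonneg _), abs_of_nonneg (pow_nonneg ht.le _), measureReal_def]

theorem measureReal_restrict_setOf_le_rpow (h : IsGaugeAt Ω x₀ J) (hJ : Continuous J)
    (hfin : μ Ω ≠ ⊤) (hq : 0 < q) {t : ℝ} (ht : t ∈ Set.Ioc (0 : ℝ) 1) :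
    (μ.restrict Ω).real {x | t ≤ J x ^ q} = μ.real Ω * (1 - t ^ (finrank ℝ F / q)) := by
  have hset : {x | t ≤ J x ^ q} ∩ Ω = Ω \ {x | J x < t ^ q⁻¹} := by
    ext x
    simp only [Set.mem_inter_iff, Set.mem_ofPred_eq, Set.mem_sdiff, not_lt]
    rw [Real.rpow_inv_le_iff_of_pos ht.1.le (h.nonneg x) hq, and_comm]
  have hsub : {x | J x < t ^ q⁻¹} ⊆ Ω := fun x hx => (h.lt_one_iff x).1
    (lt_of_lt_of_le hx (Real.rpow_le_one ht.1.le ht.2 (inv_nonneg.2 hq.le)))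
  rw [measureReal_restrict_apply' (h.isOpen hJ).measurableSet, hset,
    measureReal_sdiff hsub (isOpen_lt hJ continuous_const).measurableSet hfin,
    h.measureReal_setOf_lt μ (Real.rpow_pos_of_pos ht.1 _), ← Real.rpow_natCast,
    ← Real.rpow_mul ht.1.le, inv_mul_eq_div]
  ring

theorem setIntegral_rpow (h : IsGaugeAt Ω x₀ J) (hJ : Continuous J) (hfin : μ Ω ≠ ⊤)
    (hq : 0 < q) : ∫ x in Ω, J x ^ q ∂μ = μ.real Ω * (finrank ℝ F / (finrank ℝ F + q)) := by
  have hle : ∀ᵐ x ∂μ.restrict Ω, J x ^ q ≤ 1 := by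
    filter_upwards [ae_restrict_mem (h.isOpen hJ).measurableSet] with x hx
    exact Real.rpow_le_one (h.nonneg x) ((h.lt_one_iff x).2 hx).le hq.le
  rw [(h.integrableOn_rpow μ hJ hfin hq.le).integral_eq_integral_Ioc_meas_le
    (Eventually.of_forall fun x => Real.rpow_nonneg (h.nonneg x) q) hle,
    setIntegral_congr_fun measurableSet_Ioc fun t ht =>
      h.measureReal_restrict_setOf_le_rpow μ hJ hfin hq ht,
    integral_const_mul, integral_Ioc_one_sub_rpow (div_nonneg (Nat.cast_nonneg _) hq.le)]
  congr 1
  field_simp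

theorem integral_gaugeProfile (h : IsGaugeAt Ω x₀ J) (hJ : Continuous J) (hfin : μ Ω ≠ ⊤)
    (hq : 0 < q) : ∫ x, gaugeProfile q J x ∂μ = μ.real Ω * (q / (finrank ℝ F + q)) := by
  rw [← setIntegral_eq_integral_of_forall_compl_eq_zero
      (s := Ω) fun x hx => h.gaugeProfile_eq_zero q hx,
    setIntegral_congr_fun (h.isOpen hJ).measurableSet fun x hx => h.gaugeProfile_eq q hx,
    integral_sub (integrableOn_const hfin).integrable (h.integrableOn_rpow μ hJ hfin hq.le),
    h.setIntegral_rpow μ hJ hfin hq, setIntegral_const, smul_eq_mul, ← mul_sub]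
  congr 1
  have hpos : (0 : ℝ) < finrank ℝ F + q := add_pos_of_nonneg_of_pos (Nat.cast_nonneg _) hq
  rw [one_sub_div hpos.ne', add_sub_cancel_left]

theorem integral_norm_fderiv_gaugeProfile_rpow (h : IsGaugeAt Ω x₀ J) (hJ : LipschitzWith C J)
    (hpq : p.HolderConjugate q) :
    ∫ x, ‖fderiv ℝ (gaugeProfile q J) x‖ ^ p ∂μ =
      q ^ p * ∫ x in Ω, J x ^ q * ‖fderiv ℝ J x‖ ^ p ∂μ := by
  have ho := h.isOpen hJ.continuous
  rw [← setIntegral_eq_integral_of_forall_compl_eq_zero (s := Ω) (fun x hx => by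
      rw [h.fderiv_gaugeProfile_eq_zero hpq.symm.nonneg hx, norm_zero, Real.zero_rpow hpq.ne_zero]),
    ← integral_const_mul]
  refine integral_congr_ae ?_
  filter_upwards [ae_restrict_mem ho.measurableSet,
    ae_restrict_of_ae (hJ.ae_differentiableAt (μ := μ))] with x hx hd
  have hJx := Real.rpow_nonneg (h.nonneg x) (q - 1)
  rw [h.norm_fderiv_gaugeProfile ho hpq.symm.lt.le hx hd,
    Real.mul_rpow (mul_nonneg hpq.symm.nonneg hJx) (norm_nonneg _),
    Real.mul_rpow hpq.symm.nonneg hJx, ← Real.rpow_mul (h.nonneg x), hpq.symm.sub_one_mul_conj,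
    mul_assoc]

end IsGaugeAt

end GaugeIntegral

theorem IsGaugeAt.volume_mul_le_torsionalRigidity_rpow {D : ℕ} [NeZero D] {Ω : Set (E D)} {p q : ℝ}
    {x₀ : E D} {J : E D → ℝ} {C : NNReal} (h : IsGaugeAt Ω x₀ J) (hJ : LipschitzWith C J)
    (hpq : p.HolderConjugate q) (hb : Bornology.IsBounded Ω) :
    volume.real Ω * (1 / (D + q)) ≤ torsionalRigidity p Ω ^ (1 - 1 / p) *
      (∫ x in Ω, J x ^ q * ‖fderiv ℝ J x‖ ^ p) ^ (1 / p) := by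
  have hq := hpq.symm.pos
  have hprofile := integral_le_of_lipschitzWith hpq.lt (h.isOpen hJ.continuous) hb
    (lipschitzWith_gaugeProfile hpq.symm.lt.le hJ h.nonneg) fun x => h.gaugeProfile_eq_zero q
  have hInt : 0 ≤ ∫ x in Ω, J x ^ q * ‖fderiv ℝ J x‖ ^ p := integral_nonneg fun x =>
    mul_nonneg (Real.rpow_nonneg (h.nonneg x) _) (Real.rpow_nonneg (norm_nonneg _) _)
  rw [h.integral_gaugeProfile volume hJ.continuous (hb.measure_lt_top (μ := volume)).ne hq,
    h.integral_norm_fderiv_gaugeProfile_rpow volume hJ hpq, finrank_euclideanSpace_fin,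
    Real.mul_rpow (Real.rpow_nonneg hq.le _) hInt, ← Real.rpow_mul hq.le,
    mul_one_div_cancel hpq.ne_zero, Real.rpow_one] at hprofile
  refine le_of_mul_le_mul_left (le_of_eq_of_le ?_ (hprofile.trans_eq ?_)) hq <;> ring

section Inradius

theorem nonempty_compl_of_isBounded {F : Type*} [NormedAddCommGroup F] [NormedSpace ℝ F]
    [Nontrivial F] {s : Set F} (hb : Bornology.IsBounded s) : sᶜ.Nonempty := by
  by_contra hne
  rw [Set.not_nonempty_iff_eq_empty, Set.compl_empty_iff] at hne
  exact NormedSpace.unbounded_univ ℝ F (hne ▸ hb)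

theorem le_infDist_compl_of_ball_subset {X : Type*} [PseudoMetricSpace X] {s : Set X} {x : X}
    {r : ℝ} (hne : sᶜ.Nonempty) (hball : Metric.ball x r ⊆ s) : r ≤ Metric.infDist x sᶜ := by
  rw [Metric.le_infDist hne]
  intro y hy
  by_contra! hlt
  exact hy (hball (Metric.mem_ball'.2 hlt))

variable {D : ℕ} [NeZero D] {Ω : Set (E D)}

theorem exists_isMaxOn_infDist_compl (hb : Bornology.IsBounded Ω) (hne : Ω.Nonempty) :
    ∃ x₀, inradius Ω = Metric.infDist x₀ Ωᶜ ∧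
      ∀ x, Metric.infDist x Ωᶜ ≤ Metric.infDist x₀ Ωᶜ := by
  obtain ⟨x₀, -, hmax⟩ := hb.isCompact_closure.exists_isMaxOn hne.closure
    (Metric.continuous_infDist_pt Ωᶜ).continuousOn
  have hle : ∀ x, Metric.infDist x Ωᶜ ≤ Metric.infDist x₀ Ωᶜ := by
    intro x
    by_cases hx : x ∈ Ω
    · exact hmax (subset_closure hx)
    · rw [Metric.infDist_zero_of_mem (Set.mem_compl hx)]
      exact Metric.infDist_nonneg
  have hgreatest : IsGreatest {r : ℝ | 0 ≤ r ∧ ∃ x : E D, Metric.ball x r ⊆ Ω}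
      (Metric.infDist x₀ Ωᶜ) :=
    ⟨⟨Metric.infDist_nonneg, x₀, Metric.ball_infDist_compl_subset⟩, fun r ⟨_, x, hx⟩ =>
      (le_infDist_compl_of_ball_subset (nonempty_compl_of_isBounded hb) hx).trans (hle x)⟩
  exact ⟨x₀, hgreatest.csSup_eq, hle⟩

theorem infDist_compl_le_inradius (hb : Bornology.IsBounded Ω) (hne : Ω.Nonempty) (x : E D) :
    Metric.infDist x Ωᶜ ≤ inradius Ω := by
  obtain ⟨x₀, hx₀, hle⟩ := exists_isMaxOn_infDist_compl hb hne
  exact hx₀ ▸ hle x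

theorem le_inradius_of_ball_subset {x : E D} {r : ℝ} (hb : Bornology.IsBounded Ω)
    (hne : Ω.Nonempty) (hball : Metric.ball x r ⊆ Ω) : r ≤ inradius Ω :=
  (le_infDist_compl_of_ball_subset (nonempty_compl_of_isBounded hb) hball).trans
    (infDist_compl_le_inradius hb hne x)

theorem exists_ball_inradius_subset (hb : Bornology.IsBounded Ω) (hne : Ω.Nonempty) :
    ∃ x₀, Metric.ball x₀ (inradius Ω) ⊆ Ω := by
  obtain ⟨x₀, hx₀, -⟩ := exists_isMaxOn_infDist_compl hb hne
  exact ⟨x₀, hx₀ ▸ Metric.ball_infDist_compl_subset⟩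

theorem inradius_pos (ho : IsOpen Ω) (hb : Bornology.IsBounded Ω) (hne : Ω.Nonempty) :
    0 < inradius Ω := by
  obtain ⟨z, hz⟩ := hne
  obtain ⟨ε, hε, hball⟩ := Metric.isOpen_iff.1 ho z hz
  exact hε.trans_le (le_inradius_of_ball_subset hb ⟨z, hz⟩ hball)

end Inradius

section TorsionUpperBound

namespace IsGaugeAt

variable {F : Type*} [NormedAddCommGroup F] [NormedSpace ℝ F] {Ω : Set F} {x₀ x : F} {J : F → ℝ}
  {R : ℝ}

theorem ball_subset (h : IsGaugeAt Ω x₀ J) (hcv : Convex ℝ Ω) (hball : Metric.ball x₀ R ⊆ Ω)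
    {s : ℝ} (hJs : J x < s) (hs : s < 1) : Metric.ball x ((1 - s) * R) ⊆ Ω := by
  have hs0 : 0 < s := (h.nonneg x).trans_lt hJs
  have hs1 : 0 < 1 - s := sub_pos.2 hs
  intro y hy
  have hleft : x₀ + s⁻¹ • (x - x₀) ∈ Ω := by
    rwa [← h.lt_one_iff, h.map_smul _ (inv_pos.2 hs0), add_sub_cancel, inv_mul_lt_iff₀ hs0,
      mul_one]
  have hright : x₀ + (1 - s)⁻¹ • (y - x) ∈ Ω := by
    refine hball ?_
    rwa [Metric.mem_ball, dist_eq_norm, add_sub_cancel_left, norm_smul, norm_inv,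
      Real.norm_of_nonneg hs1.le, inv_mul_lt_iff₀ hs1, ← dist_eq_norm]
  have hcomb : s • (x₀ + s⁻¹ • (x - x₀)) + (1 - s) • (x₀ + (1 - s)⁻¹ • (y - x)) = y := by
    rw [smul_add, smul_add, smul_inv_smul₀ hs0.ne', smul_inv_smul₀ hs1.ne', sub_smul, one_smul]
    abel
  exact hcomb ▸ hcv hleft hright hs0.le hs1.le (add_sub_cancel s 1)

theorem sub_infDist_compl_le (h : IsGaugeAt Ω x₀ J) (hcv : Convex ℝ Ω) (hne : Ωᶜ.Nonempty)
    (hball : Metric.ball x₀ R ⊆ Ω) (hx : x ∈ Ω) : R - Metric.infDist x Ωᶜ ≤ R * J x := by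
  have hlim : Tendsto (fun s : ℝ => (1 - s) * R) (𝓝[>] (J x)) (𝓝 ((1 - J x) * R)) :=
    tendsto_nhdsWithin_of_tendsto_nhds (Continuous.tendsto (by fun_prop) _)
  have hle : (1 - J x) * R ≤ Metric.infDist x Ωᶜ := by
    refine le_of_tendsto hlim ?_
    filter_upwards [Ioo_mem_nhdsGT ((h.lt_one_iff x).2 hx)] with s hs
    exact le_infDist_compl_of_ball_subset hne (h.ball_subset hcv hball hs.1 hs.2)
  linarith

theorem setIntegral_sub_infDist_rpow_le [FiniteDimensional ℝ F] [MeasurableSpace F] [BorelSpace F]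
    (μ : Measure F) [μ.IsAddHaarMeasure] (h : IsGaugeAt Ω x₀ J) (hJ : Continuous J)
    (hcv : Convex ℝ Ω) (hne : Ωᶜ.Nonempty) (hfin : μ Ω ≠ ⊤) (hball : Metric.ball x₀ R ⊆ Ω)
    (hR : ∀ x, Metric.infDist x Ωᶜ ≤ R) {q : ℝ} (hq : 0 < q) :
    (∫ x in Ω, (R - Metric.infDist x Ωᶜ) ^ q ∂μ) ^ (1 / q) ≤
      R * (μ.real Ω * (Module.finrank ℝ F / (Module.finrank ℝ F + q))) ^ (1 / q) := by
  have hR0 : 0 ≤ R := Metric.infDist_nonneg.trans (hR x₀)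
  have hnonneg : ∀ x, 0 ≤ (R - Metric.infDist x Ωᶜ) ^ q := fun x =>
    Real.rpow_nonneg (sub_nonneg.2 (hR x)) q
  calc (∫ x in Ω, (R - Metric.infDist x Ωᶜ) ^ q ∂μ) ^ (1 / q)
      ≤ (∫ x in Ω, R ^ q * J x ^ q ∂μ) ^ (1 / q) := by
        refine Real.rpow_le_rpow (integral_nonneg hnonneg) ?_ (one_div_nonneg.2 hq.le)
        refine integral_mono_of_nonneg (Eventually.of_forall hnonneg)
          ((h.integrableOn_rpow μ hJ hfin hq.le).const_mul _) ?_
        filter_upwards [ae_restrict_mem (h.isOpen hJ).measurableSet] with x hx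
        rw [← Real.mul_rpow hR0 (h.nonneg x)]
        exact Real.rpow_le_rpow (sub_nonneg.2 (hR x))
          (h.sub_infDist_compl_le hcv hne hball hx) hq.le
    _ = R * (μ.real Ω * (Module.finrank ℝ F / (Module.finrank ℝ F + q))) ^ (1 / q) := by
        rw [integral_const_mul, h.setIntegral_rpow μ hJ hfin hq,
          Real.mul_rpow (Real.rpow_nonneg hR0 q) (by positivity), ← Real.rpow_mul hR0,
          mul_one_div_cancel hq.ne', Real.rpow_one]

end IsGaugeAt

variable {D : ℕ} {Ω : Set (E D)} {p q : ℝ}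

theorem IsTestFunction.integral_norm_gradient_mul_le {φ w : E D → ℝ} (hφ : IsTestFunction Ω φ)
    (hpq : p.HolderConjugate q) (ho : IsOpen Ω) (hb : Bornology.IsBounded Ω) (hw : Continuous w)
    (hw0 : ∀ x, 0 ≤ w x) :
    ∫ x, ‖gradient φ x‖ * w x ≤
      (∫ x in Ω, w x ^ q) ^ (1 / q) * (∫ x, ‖gradient φ x‖ ^ p) ^ (1 / p) := by
  have hfin : IsFiniteMeasure (volume.restrict Ω) := ⟨by simpa using hb.measure_lt_top⟩
  have hwL : MemLp w (ENNReal.ofReal q) (volume.restrict Ω) := by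
    obtain ⟨B, hB⟩ := hb.isCompact_closure.exists_bound_of_continuousOn hw.continuousOn
    refine MemLp.of_bound hw.aestronglyMeasurable B ?_
    filter_upwards [ae_restrict_mem ho.measurableSet] with x hx using hB x (subset_closure hx)
  rw [← hφ.setIntegral_norm_gradient_rpow hpq.pos,
    ← setIntegral_eq_integral_of_forall_compl_eq_zero (s := Ω) fun x hx => by
      rw [hφ.gradient_eq_zero hx, norm_zero, zero_mul]]
  simp only [mul_comm ‖gradient φ _‖]
  exact integral_mul_le_Lp_mul_Lq_of_nonneg hpq.symm (Eventually.of_forall hw0)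
    (Eventually.of_forall fun x => norm_nonneg (gradient φ x)) hwL
    ((hφ.memLp_gradient _).restrict Ω).norm

theorem torsionalRigidity_rpow_le_inradius_mul [NeZero D] (hpq : p.HolderConjugate q)
    (hΩ : Ω ∈ convexDomains D) :
    torsionalRigidity p Ω ^ (1 - 1 / p) ≤
      inradius Ω * (volume.real Ω * (D / (D + q))) ^ (1 / q) := by
  obtain ⟨hne, ho, hb, hcv⟩ := hΩ
  have hR := infDist_compl_le_inradius hb hne
  have hR0 := inradius_pos ho hb hne
  have hcompl := nonempty_compl_of_isBounded hb
  obtain ⟨x₀, hball⟩ := exists_ball_inradius_subset hb hne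
  obtain ⟨J, hJ, hJL⟩ := exists_isGaugeAt ho hcv hR0 hball
  have hq := hpq.symm.pos
  refine torsionalRigidity_rpow_le hpq.lt hb (by positivity) fun φ hφ => ?_
  obtain ⟨C, hC⟩ := ContDiff.lipschitzWith_of_hasCompactSupport hφ.2.1 hφ.1 (by simp)
  calc ∫ x, φ x ≤ ∫ x, ‖gradient φ x‖ * (inradius Ω - Metric.infDist x Ωᶜ) := by
        simpa only [norm_gradient] using integral_le_integral_norm_fderiv_mul_sub_infDist volume
          ho hcv hcompl hC hφ.2.1 hφ.2.2 hR
    _ ≤ (∫ x in Ω, (inradius Ω - Metric.infDist x Ωᶜ) ^ q) ^ (1 / q) *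
          (∫ x, ‖gradient φ x‖ ^ p) ^ (1 / p) :=
        hφ.integral_norm_gradient_mul_le hpq ho hb
          (continuous_const.sub (Metric.continuous_infDist_pt _)) fun x => sub_nonneg.2 (hR x)
    _ ≤ inradius Ω * (volume.real Ω * (D / (D + q))) ^ (1 / q) *
          (∫ x, ‖gradient φ x‖ ^ p) ^ (1 / p) := by
        gcongr
        simpa only [finrank_euclideanSpace_fin] using hJ.setIntegral_sub_infDist_rpow_le volume
          hJL.continuous hcv hcompl (hb.measure_lt_top (μ := volume)).ne hball hR hq

end TorsionUpperBound

section GaugeSlope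

namespace IsGaugeAt

variable {F : Type*} [NormedAddCommGroup F] [NormedSpace ℝ F] {Ω : Set F} {x₀ : F} {J : F → ℝ}
  {C : NNReal} {p q : ℝ}

theorem rpow_mul_norm_fderiv_rpow_le (h : IsGaugeAt Ω x₀ J) (hJ : LipschitzWith C J) (hp : 0 ≤ p)
    (x : F) : J x ^ q * ‖fderiv ℝ J x‖ ^ p ≤ C ^ p * J x ^ q := by
  rw [mul_comm]
  exact mul_le_mul_of_nonneg_right
    (Real.rpow_le_rpow (norm_nonneg _) (norm_fderiv_le_of_lipschitz ℝ hJ) hp)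
    (Real.rpow_nonneg (h.nonneg x) q)

variable [MeasurableSpace F] (μ : Measure F)

theorem setIntegral_rpow_mul_norm_fderiv_rpow_nonneg (h : IsGaugeAt Ω x₀ J) :
    0 ≤ ∫ x in Ω, J x ^ q * ‖fderiv ℝ J x‖ ^ p ∂μ :=
  integral_nonneg fun x =>
    mul_nonneg (Real.rpow_nonneg (h.nonneg x) q) (Real.rpow_nonneg (norm_nonneg _) p)

variable [BorelSpace F]

theorem setIntegral_rpow_mul_norm_fderiv_rpow_le (h : IsGaugeAt Ω x₀ J) (hJ : LipschitzWith C J)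
    (hfin : μ Ω ≠ ⊤) (hq : 0 ≤ q) (hp : 0 ≤ p) :
    ∫ x in Ω, J x ^ q * ‖fderiv ℝ J x‖ ^ p ∂μ ≤ C ^ p * ∫ x in Ω, J x ^ q ∂μ := by
  rw [← integral_const_mul]
  exact integral_mono (h.integrableOn_rpow_mul_norm_fderiv_rpow μ hJ hfin hq hp).integrable
    ((h.integrableOn_rpow μ hJ.continuous hfin hq).integrable.const_mul _)
    (h.rpow_mul_norm_fderiv_rpow_le hJ hp)

theorem setIntegral_rpow_mul_norm_fderiv_rpow_lt [μ.IsOpenPosMeasure] (h : IsGaugeAt Ω x₀ J)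
    (hJ : LipschitzWith 1 J) (hfin : μ Ω ≠ ⊤) (hq : 0 ≤ q) (hp : 0 < p) {U : Set F}
    (hU : IsOpen U) (hUne : U.Nonempty) (hUΩ : U ⊆ Ω)
    (hJU : ∀ x ∈ U, 0 < J x ∧ ‖fderiv ℝ J x‖ < 1) :
    ∫ x in Ω, J x ^ q * ‖fderiv ℝ J x‖ ^ p ∂μ < ∫ x in Ω, J x ^ q ∂μ := by
  have hInt := (h.integrableOn_rpow μ hJ.continuous hfin hq).integrable
  have hInt' := (h.integrableOn_rpow_mul_norm_fderiv_rpow μ hJ hfin hq hp.le).integrable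
  have hdefect : ∀ x, 0 ≤ J x ^ q - J x ^ q * ‖fderiv ℝ J x‖ ^ p := fun x => by
    simpa using h.rpow_mul_norm_fderiv_rpow_le hJ hp.le x (q := q)
  rw [← sub_pos, ← integral_sub hInt hInt',
    integral_pos_iff_support_of_nonneg hdefect (hInt.sub hInt')]
  refine (hU.measure_pos μ hUne).trans_le ?_
  rw [← Measure.restrict_eq_self μ hUΩ]
  refine measure_mono fun x hx => ?_
  obtain ⟨hpos, hslope⟩ := hJU x hx
  rw [Function.mem_support, ← mul_one_sub]
  exact (mul_pos (Real.rpow_pos_of_pos hpos q)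
    (sub_pos.2 (Real.rpow_lt_one (norm_nonneg _) hslope hp))).ne'

end IsGaugeAt

end GaugeSlope

section TorsionRatio

/-- A multiple of `Q p Ω` (`q` being conjugate to `p`), normalized so that its values lie between
`1` and the dimension. -/
def torsionRatio {D : ℕ} (p q : ℝ) (Ω : Set (E D)) : ℝ :=
  inradius Ω * (volume.real Ω * (D / (D + q))) ^ (1 / q) / torsionalRigidity p Ω ^ (1 - 1 / p)

variable {D : ℕ} {Ω : Set (E D)} {p q : ℝ}

theorem volume_pos (hΩ : Ω ∈ convexDomains D) : 0 < volume.real Ω :=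
  ENNReal.toReal_pos (hΩ.2.1.measure_pos volume hΩ.1).ne' hΩ.2.2.1.measure_lt_top.ne

variable [NeZero D]

theorem inradius_pos_of_mem (hΩ : Ω ∈ convexDomains D) : 0 < inradius Ω :=
  inradius_pos hΩ.2.1 hΩ.2.2.1 hΩ.1

theorem exists_lipschitzWith_isGaugeAt (hΩ : Ω ∈ convexDomains D) :
    ∃ x₀ J, IsGaugeAt Ω x₀ J ∧ LipschitzWith (Real.toNNReal (inradius Ω))⁻¹ J := by
  obtain ⟨x₀, hball⟩ := exists_ball_inradius_subset hΩ.2.2.1 hΩ.1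
  exact ⟨x₀, exists_isGaugeAt hΩ.2.1 hΩ.2.2.2 (inradius_pos_of_mem hΩ) hball⟩

theorem torsionalRigidity_pos (hp : 1 < p) (hΩ : Ω ∈ convexDomains D) :
    0 < torsionalRigidity p Ω := by
  have hpq := Real.HolderConjugate.conjExponent hp
  obtain ⟨x₀, J, hJ, hJL⟩ := exists_lipschitzWith_isGaugeAt hΩ
  refine (torsionalRigidity_nonneg hp hΩ.2.2.1).lt_of_ne' fun hzero => ?_
  have hle := hJ.volume_mul_le_torsionalRigidity_rpow hJL hpq hΩ.2.2.1
  rw [hzero, Real.zero_rpow (sub_pos.2 ((div_lt_one hpq.pos).2 hp)).ne', zero_mul] at hle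
  have hV := volume_pos hΩ
  have hq := hpq.symm.pos
  exact hle.not_gt (by positivity)

theorem torsionalRigidity_rpow_pos (hp : 1 < p) (hΩ : Ω ∈ convexDomains D) :
    0 < torsionalRigidity p Ω ^ (1 - 1 / p) :=
  Real.rpow_pos_of_pos (torsionalRigidity_pos hp hΩ) _

theorem one_le_torsionRatio (hpq : p.HolderConjugate q) (hΩ : Ω ∈ convexDomains D) :
    1 ≤ torsionRatio p q Ω :=
  (one_le_div (torsionalRigidity_rpow_pos hpq.lt hΩ)).2
    (torsionalRigidity_rpow_le_inradius_mul hpq hΩ)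

namespace IsGaugeAt

variable {x₀ : E D} {J : E D → ℝ}

theorem setIntegral_rpow_pos (h : IsGaugeAt Ω x₀ J) (hJ : Continuous J) (hq : 0 < q)
    (hΩ : Ω ∈ convexDomains D) : 0 < ∫ x in Ω, J x ^ q := by
  rw [h.setIntegral_rpow volume hJ (hΩ.2.2.1.measure_lt_top (μ := volume)).ne hq,
    finrank_euclideanSpace_fin]
  have hV := volume_pos hΩ
  have hD : (0 : ℝ) < D := Nat.cast_pos.2 (NeZero.pos D)
  positivity

theorem torsionRatio_le (h : IsGaugeAt Ω x₀ J) {C : NNReal} (hJ : LipschitzWith C J)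
    (hpq : p.HolderConjugate q) (hΩ : Ω ∈ convexDomains D) :
    torsionRatio p q Ω ≤ D * (inradius Ω *
      ((∫ x in Ω, J x ^ q * ‖fderiv ℝ J x‖ ^ p) / ∫ x in Ω, J x ^ q) ^ (1 / p)) := by
  have hD : (0 : ℝ) < D := Nat.cast_pos.2 (NeZero.pos D)
  have hR := inradius_pos_of_mem hΩ
  have hτ := torsionalRigidity_rpow_pos hpq.lt hΩ
  have hA := h.setIntegral_rpow_mul_norm_fderiv_rpow_nonneg volume (p := p) (q := q)
  have hW := h.setIntegral_rpow_pos hJ.continuous hpq.symm.pos hΩ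
  have hle := h.volume_mul_le_torsionalRigidity_rpow hJ hpq hΩ.2.2.1
  have hWeq := h.setIntegral_rpow volume hJ.continuous
    (hΩ.2.2.1.measure_lt_top (μ := volume)).ne hpq.symm.pos
  rw [finrank_euclideanSpace_fin] at hWeq
  rw [torsionRatio, ← hWeq]
  set A := ∫ x in Ω, J x ^ q * ‖fderiv ℝ J x‖ ^ p
  set W := ∫ x in Ω, J x ^ q
  set τ := torsionalRigidity p Ω ^ (1 - 1 / p)
  have hsplit : W ^ (1 / q) * W ^ (1 / p) = W := by
    rw [← Real.rpow_add hW, one_div, one_div, add_comm, hpq.inv_add_inv_eq_one, Real.rpow_one]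
  have hWle : W ≤ D * (τ * A ^ (1 / p)) := by
    calc W = D * (volume.real Ω * (1 / (D + q))) := by rw [hWeq]; ring
      _ ≤ D * (τ * A ^ (1 / p)) := by gcongr
  rw [Real.div_rpow hA hW.le, div_le_iff₀ hτ]
  refine le_of_mul_le_mul_right ?_ (Real.rpow_pos_of_pos hW (1 / p))
  calc inradius Ω * W ^ (1 / q) * W ^ (1 / p) = inradius Ω * W := by rw [mul_assoc, hsplit]
    _ ≤ inradius Ω * (D * (τ * A ^ (1 / p))) := by gcongr
    _ = D * (inradius Ω * (A ^ (1 / p) / W ^ (1 / p))) * τ * W ^ (1 / p) := by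
        field_simp [(Real.rpow_pos_of_pos hW (1 / p)).ne']

theorem torsionRatio_lt (h : IsGaugeAt Ω x₀ J) (hJ : LipschitzWith 1 J)
    (hpq : p.HolderConjugate q) (hΩ : Ω ∈ convexDomains D) (hR : inradius Ω = 1) {U : Set (E D)}
    (hU : IsOpen U) (hUne : U.Nonempty) (hUΩ : U ⊆ Ω)
    (hJU : ∀ x ∈ U, 0 < J x ∧ ‖fderiv ℝ J x‖ < 1) : torsionRatio p q Ω < D := by
  have hslope : ((∫ x in Ω, J x ^ q * ‖fderiv ℝ J x‖ ^ p) / ∫ x in Ω, J x ^ q) ^ (1 / p) < 1 := by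
    have hW := h.setIntegral_rpow_pos hJ.continuous hpq.symm.pos hΩ
    refine Real.rpow_lt_one
      (div_nonneg (h.setIntegral_rpow_mul_norm_fderiv_rpow_nonneg volume) hW.le)
      ((div_lt_one hW).2 ?_) (one_div_pos.2 hpq.pos)
    exact h.setIntegral_rpow_mul_norm_fderiv_rpow_lt volume hJ
      (hΩ.2.2.1.measure_lt_top (μ := volume)).ne hpq.symm.nonneg hpq.pos hU hUne hUΩ hJU
  refine (h.torsionRatio_le hJ hpq hΩ).trans_lt ?_
  rw [hR, one_mul]
  exact mul_lt_of_lt_one_right (Nat.cast_pos.2 (NeZero.pos D)) hslope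

end IsGaugeAt

theorem torsionRatio_le_dim (hpq : p.HolderConjugate q) (hΩ : Ω ∈ convexDomains D) :
    torsionRatio p q Ω ≤ D := by
  have hR := inradius_pos_of_mem hΩ
  obtain ⟨x₀, J, hJ, hJL⟩ := exists_lipschitzWith_isGaugeAt hΩ
  have hW := hJ.setIntegral_rpow_pos hJL.continuous hpq.symm.pos hΩ
  have hA := hJ.setIntegral_rpow_mul_norm_fderiv_rpow_le volume hJL
    (hΩ.2.2.1.measure_lt_top (μ := volume)).ne hpq.symm.nonneg hpq.nonneg
  rw [NNReal.coe_inv, Real.coe_toNNReal _ hR.le, ← div_le_iff₀ hW] at hA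
  calc torsionRatio p q Ω
      ≤ D * (inradius Ω *
          ((∫ x in Ω, J x ^ q * ‖fderiv ℝ J x‖ ^ p) / ∫ x in Ω, J x ^ q) ^ (1 / p)) :=
        hJ.torsionRatio_le hJL hpq hΩ
    _ ≤ D * (inradius Ω * ((inradius Ω)⁻¹ ^ p) ^ (1 / p)) := by
        have := div_nonneg
          (hJ.setIntegral_rpow_mul_norm_fderiv_rpow_nonneg volume (p := p) (q := q)) hW.le
        have := one_div_nonneg.2 hpq.nonneg
        gcongr
    _ = D := by
        rw [← Real.rpow_mul (inv_nonneg.2 hR.le), mul_one_div_cancel hpq.ne_zero, Real.rpow_one,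
          mul_inv_cancel₀ hR.ne', mul_one]

end TorsionRatio

section Balls

variable {D : ℕ} {Ω : Set (E D)} {p q : ℝ}

theorem abs_apply_le_norm (x : E D) (i : Fin D) : |x i| ≤ ‖x‖ := by
  simpa using PiLp.norm_apply_le x i

theorem unitBall_mem_convexDomains : Metric.ball (0 : E D) 1 ∈ convexDomains D :=
  ⟨⟨0, Metric.mem_ball_self one_pos⟩, Metric.isOpen_ball, Metric.isBounded_ball, convex_ball _ _⟩

theorem isGaugeAt_norm {F : Type*} [NormedAddCommGroup F] [NormedSpace ℝ F] :
    IsGaugeAt (Metric.ball (0 : F) 1) 0 fun x => ‖x‖ where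
  nonneg := norm_nonneg
  lt_one_iff x := mem_ball_zero_iff.symm
  map_smul t ht v := by simp [norm_smul, abs_of_pos ht]

/-- The ball of radius two truncated to the slab `|x i| < 1`: it has the same inradius as the unit
ball, but its gauge is less steep. -/
def truncatedBall (i : Fin D) : Set (E D) := {x | max |x i| (‖x‖ / 2) < 1}

theorem continuous_max_abs_apply_norm (i : Fin D) :
    Continuous fun x : E D => max |x i| (‖x‖ / 2) := by
  fun_prop

theorem isGaugeAt_truncatedBall (i : Fin D) :
    IsGaugeAt (truncatedBall i) 0 fun x => max |x i| (‖x‖ / 2) where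
  nonneg x := le_max_of_le_left (abs_nonneg _)
  lt_one_iff x := Iff.rfl
  map_smul t ht v := by
    rw [mul_max_of_nonneg _ _ ht.le]
    simp [norm_smul, abs_mul, abs_of_pos ht, mul_div_assoc]

theorem truncatedBall_eq (i : Fin D) :
    truncatedBall i = {x | -1 < x i} ∩ {x | x i < 1} ∩ Metric.ball 0 2 := by
  ext x
  simp only [truncatedBall, Set.mem_ofPred_eq, max_lt_iff, abs_lt, Set.mem_inter_iff,
    mem_ball_zero_iff, div_lt_one (two_pos : (0 : ℝ) < 2)]

theorem truncatedBall_mem_convexDomains (i : Fin D) : truncatedBall i ∈ convexDomains D := by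
  have hlin : IsLinearMap ℝ fun x : E D => x i := ⟨fun _ _ => rfl, fun _ _ => rfl⟩
  refine ⟨⟨0, by simp [truncatedBall]⟩,
    (isGaugeAt_truncatedBall i).isOpen (continuous_max_abs_apply_norm i), ?_, ?_⟩ <;>
  rw [truncatedBall_eq]
  · exact Metric.isBounded_ball.subset Set.inter_subset_right
  · exact ((convex_halfSpace_gt hlin _).inter (convex_halfSpace_lt hlin _)).inter (convex_ball _ _)

theorem lipschitzWith_norm_div_two {F : Type*} [SeminormedAddCommGroup F] :
    LipschitzWith 2⁻¹ fun x : F => ‖x‖ / 2 := by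
  refine LipschitzWith.of_dist_le_mul fun x y => ?_
  rw [Real.dist_eq, dist_eq_norm, ← sub_div, abs_div, abs_two, div_eq_inv_mul]
  exact mul_le_mul_of_nonneg_left (abs_norm_sub_norm_le x y) (by norm_num)

theorem lipschitzWith_max_abs_apply_norm (i : Fin D) :
    LipschitzWith 1 fun x : E D => max |x i| (‖x‖ / 2) := by
  have hcoord : LipschitzWith 1 fun x : E D => |x i| := LipschitzWith.of_dist_le_mul fun x y => by
    rw [NNReal.coe_one, one_mul, Real.dist_eq, dist_eq_norm]
    exact (abs_abs_sub_abs_le _ _).trans (abs_apply_le_norm (x - y) i)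
  simpa using hcoord.max (lipschitzWith_norm_div_two.weaken (by norm_num : (2⁻¹ : NNReal) ≤ 1))

variable [NeZero D]

theorem inradius_le_of_abs_apply_lt (hΩ : Ω ∈ convexDomains D) {i : Fin D} {r : ℝ}
    (hi : ∀ x ∈ Ω, |x i| < r) : inradius Ω ≤ r := by
  obtain ⟨x₀, hx₀⟩ := exists_ball_inradius_subset hΩ.2.2.1 hΩ.1
  obtain ⟨z, hz⟩ := hΩ.1
  have hr : 0 < r := (abs_nonneg _).trans_lt (hi z hz)
  by_contra! hlt
  have hmem : ∀ c : ℝ, |c| = r → |x₀ i + c| < r := fun c hc => by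
    have hc' : x₀ + EuclideanSpace.single i c ∈ Metric.ball x₀ (inradius Ω) := by
      simpa [hc] using hlt
    simpa using hi _ (hx₀ hc')
  have hright := (abs_lt.1 (hmem r (abs_of_pos hr))).2
  have hleft := (abs_lt.1 (hmem (-r) (by rw [abs_neg, abs_of_pos hr]))).1
  linarith

theorem inradius_unitBall : inradius (Metric.ball (0 : E D) 1) = 1 :=
  le_antisymm
    (inradius_le_of_abs_apply_lt unitBall_mem_convexDomains (i := 0) fun x hx =>
      (abs_apply_le_norm x 0).trans_lt (mem_ball_zero_iff.1 hx))
    (le_inradius_of_ball_subset Metric.isBounded_ball unitBall_mem_convexDomains.1 subset_rfl)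

theorem inradius_truncatedBall (i : Fin D) : inradius (truncatedBall i) = 1 := by
  have hΩ := truncatedBall_mem_convexDomains i
  refine le_antisymm (inradius_le_of_abs_apply_lt hΩ fun x hx => (max_lt_iff.1 hx).1)
    (le_inradius_of_ball_subset (x := 0) hΩ.2.2.1 hΩ.1 fun x hx => ?_)
  rw [mem_ball_zero_iff] at hx
  exact max_lt ((abs_apply_le_norm x i).trans_lt hx) (by linarith)

theorem dim_le_torsionRatio_unitBall (hpq : p.HolderConjugate q) :
    D ≤ torsionRatio p q (Metric.ball (0 : E D) 1) := by
  have hD : (0 : ℝ) < D := Nat.cast_pos.2 (NeZero.pos D)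
  have hB : Metric.ball (0 : E D) 1 ∈ convexDomains D := unitBall_mem_convexDomains
  have hweight := isGaugeAt_norm.setIntegral_rpow volume continuous_norm
    (hB.2.2.1.measure_lt_top (μ := volume)).ne hpq.symm.pos
  rw [finrank_euclideanSpace_fin] at hweight
  rw [torsionRatio, inradius_unitBall, one_mul, ← hweight,
    le_div_iff₀ (torsionalRigidity_rpow_pos hpq.lt hB), ← le_div_iff₀' hD]
  refine torsionalRigidity_rpow_le hpq.lt hB.2.2.1
    (div_nonneg (Real.rpow_nonneg (integral_nonneg fun x => by positivity) _) hD.le) fun φ hφ => ?_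
  rw [div_mul_eq_mul_div, le_div_iff₀' hD]
  calc D * ∫ x, φ x ≤ ∫ x, ‖gradient φ x‖ * ‖x‖ := by
        simpa using finrank_mul_integral_le_integral_norm_gradient_mul (μ := volume)
          hφ.contDiff_one hφ.2.1
    _ ≤ _ := hφ.integral_norm_gradient_mul_le hpq hB.2.1 hB.2.2.1 continuous_norm norm_nonneg

theorem torsionRatio_truncatedBall_lt (hpq : p.HolderConjugate q) {i j : Fin D} (hij : i ≠ j) :
    torsionRatio p q (truncatedBall i) < D := by
  have hU : IsOpen {x : E D | |x i| < ‖x‖ / 2} := isOpen_lt (by fun_prop) (by fun_prop)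
  refine (isGaugeAt_truncatedBall i).torsionRatio_lt (lipschitzWith_max_abs_apply_norm i) hpq
    (truncatedBall_mem_convexDomains i) (inradius_truncatedBall i)
    (hU.inter (Metric.isOpen_ball (x := 0) (ε := 2))) ⟨EuclideanSpace.single j 1, ?_, ?_⟩ ?_ ?_
  · simp [hij]
  · simp
  · rintro x ⟨hx, hx2⟩
    have hhalf : ‖x‖ / 2 < 1 := (div_lt_one two_pos).2 (mem_ball_zero_iff.1 hx2)
    exact max_lt (LT.lt.trans hx hhalf) hhalf
  · rintro x ⟨hx, -⟩
    have hpos : 0 < ‖x‖ / 2 := (abs_nonneg _).trans_lt hx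
    have hloc : (fun y : E D => max |y i| (‖y‖ / 2)) =ᶠ[𝓝 x] fun y => ‖y‖ / 2 := by
      filter_upwards [hU.mem_nhds hx] with y hy using max_eq_right (le_of_lt hy)
    refine ⟨lt_max_of_lt_right hpos, ?_⟩
    rw [hloc.fderiv_eq]
    exact (norm_fderiv_le_of_lipschitz ℝ lipschitzWith_norm_div_two).trans_lt (by norm_num)

end Balls

section Dilation

open scoped Pointwise

theorem norm_gradient_comp_smul {F : Type*} [NormedAddCommGroup F] [InnerProductSpace ℝ F]
    [CompleteSpace F] (f : F → ℝ) (t : ℝ) (x : F) :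
    ‖gradient (fun y => f (t • y)) x‖ = |t| * ‖gradient f (t • x)‖ := by
  have hderiv : fderiv ℝ (fun y => f (t • y)) x = t • fderiv ℝ f (t • x) := fderiv_comp_smul t
  rw [norm_gradient, norm_gradient, hderiv, norm_smul, Real.norm_eq_abs]

variable {D : ℕ} {Ω : Set (E D)} {p q t : ℝ}

theorem smul_mem_convexDomains (ht : t ≠ 0) (hΩ : Ω ∈ convexDomains D) :
    t • Ω ∈ convexDomains D :=
  ⟨hΩ.1.smul_set, hΩ.2.1.smul₀ ht, hΩ.2.2.1.smul₀ t, hΩ.2.2.2.smul t⟩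

theorem volume_smul (ht : 0 ≤ t) : volume.real (t • Ω) = t ^ D * volume.real Ω := by
  rw [measureReal_def, Measure.addHaar_smul_of_nonneg _ ht, ENNReal.toReal_mul,
    ENNReal.toReal_ofReal (pow_nonneg ht _), finrank_euclideanSpace_fin, measureReal_def]

theorem IsTestFunction.comp_smul {φ : E D → ℝ} (hφ : IsTestFunction (t • Ω) φ) (ht : t ≠ 0) :
    IsTestFunction Ω fun x => φ (t • x) := by
  refine ⟨hφ.1.comp (contDiff_const_smul t), hφ.2.1.comp_smul ht, fun x hx => ?_⟩
  have hmem : t • x ∈ tsupport φ := tsupport_comp_subset_preimage φ (continuous_const_smul t) hx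
  exact (Set.smul_mem_smul_set_iff₀ ht _ _).1 (hφ.2.2 hmem)

variable [NeZero D]

theorem mul_inradius_le_inradius_smul (ht : 0 < t) (hΩ : Ω ∈ convexDomains D) :
    t * inradius Ω ≤ inradius (t • Ω) := by
  have hΩ' := smul_mem_convexDomains ht.ne' hΩ
  obtain ⟨x₀, hx₀⟩ := exists_ball_inradius_subset hΩ.2.2.1 hΩ.1
  refine le_inradius_of_ball_subset (x := t • x₀) hΩ'.2.2.1 hΩ'.1 ?_
  have hball := smul_ball ht.ne' x₀ (inradius Ω)
  rw [Real.norm_of_nonneg ht.le] at hball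
  exact hball ▸ Set.smul_set_mono hx₀

theorem inradius_smul (ht : 0 < t) (hΩ : Ω ∈ convexDomains D) :
    inradius (t • Ω) = t * inradius Ω := by
  refine le_antisymm ?_ (mul_inradius_le_inradius_smul ht hΩ)
  have hle := mul_inradius_le_inradius_smul (inv_pos.2 ht) (smul_mem_convexDomains ht.ne' hΩ)
  rwa [inv_smul_smul₀ ht.ne', inv_mul_le_iff₀ ht] at hle

theorem torsionalRigidity_smul_rpow_le (hp : 1 < p) (ht : 0 < t)
    (hb : Bornology.IsBounded Ω) :
    torsionalRigidity p (t • Ω) ^ (1 - 1 / p) ≤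
      t * (t ^ D) ^ (1 - 1 / p) * torsionalRigidity p Ω ^ (1 - 1 / p) := by
  have hp0 : 0 < p := by linarith
  have htD : 0 < t ^ D := pow_pos ht D
  have hT := Real.rpow_nonneg (torsionalRigidity_nonneg hp hb) (1 - 1 / p)
  refine torsionalRigidity_rpow_le hp (hb.smul₀ t) (by positivity) fun φ hφ => ?_
  have hmass : ∫ x, φ (t • x) = (t ^ D)⁻¹ * ∫ x, φ x := by
    rw [Measure.integral_comp_smul, finrank_euclideanSpace_fin, abs_of_pos (inv_pos.2 htD),
      smul_eq_mul]
  have henergy : ∫ x, ‖gradient (fun y => φ (t • y)) x‖ ^ p =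
      t ^ p * ((t ^ D)⁻¹ * ∫ x, ‖gradient φ x‖ ^ p) := by
    simp only [norm_gradient_comp_smul, abs_of_pos ht, Real.mul_rpow ht.le (norm_nonneg _)]
    rw [integral_const_mul, Measure.integral_comp_smul volume (fun x => ‖gradient φ x‖ ^ p),
      finrank_euclideanSpace_fin, abs_of_pos (inv_pos.2 htD), smul_eq_mul]
  have hI : 0 ≤ ∫ x, ‖gradient φ x‖ ^ p := integral_nonneg fun x => by positivity
  have hle := (hφ.comp_smul ht.ne').integral_le hp hb
  rw [hmass, henergy, Real.mul_rpow (by positivity) (by positivity), ← Real.rpow_mul ht.le,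
    mul_one_div_cancel hp0.ne', Real.rpow_one, Real.mul_rpow (inv_nonneg.2 htD.le) hI,
    inv_mul_le_iff₀ htD] at hle
  refine hle.trans_eq ?_
  rw [Real.rpow_sub htD, Real.rpow_one, Real.inv_rpow htD.le]
  ring

theorem torsionRatio_le_torsionRatio_smul (hpq : p.HolderConjugate q) (ht : 0 < t)
    (hΩ : Ω ∈ convexDomains D) : torsionRatio p q Ω ≤ torsionRatio p q (t • Ω) := by
  have hexp : 1 - 1 / p = 1 / q := by
    rw [one_div, one_div, sub_eq_iff_eq_add', hpq.inv_add_inv_eq_one]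
  have hτ := torsionalRigidity_rpow_pos hpq.lt hΩ
  have hτ' := torsionalRigidity_rpow_pos hpq.lt (smul_mem_convexDomains ht.ne' hΩ)
  have hle := torsionalRigidity_smul_rpow_le hpq.lt ht hΩ.2.2.1
  have hR := inradius_pos_of_mem hΩ
  have hq := hpq.symm.pos
  rw [torsionRatio, torsionRatio, inradius_smul ht hΩ, volume_smul ht.le, mul_assoc (t ^ D),
    Real.mul_rpow (pow_nonneg ht.le D) (by positivity), div_le_div_iff₀ hτ hτ']
  rw [hexp] at hle ⊢
  calc _ ≤ inradius Ω * (volume.real Ω * (D / (D + q))) ^ (1 / q) *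
        (t * (t ^ D) ^ (1 / q) * torsionalRigidity p Ω ^ (1 / q)) := by gcongr
    _ = _ := by ring

theorem torsionRatio_smul (hpq : p.HolderConjugate q) (ht : 0 < t) (hΩ : Ω ∈ convexDomains D) :
    torsionRatio p q (t • Ω) = torsionRatio p q Ω := by
  refine le_antisymm ?_ (torsionRatio_le_torsionRatio_smul hpq ht hΩ)
  have hle := torsionRatio_le_torsionRatio_smul hpq (inv_pos.2 ht)
    (smul_mem_convexDomains ht.ne' hΩ)
  rwa [inv_smul_smul₀ ht.ne'] at hle

end Dilation

section Comparison

variable {D : ℕ} {Ω Ωa Ωb : Set (E D)} {p q a b : ℝ}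

theorem image_Q_nonempty : (Q p '' convexDomains D).Nonempty :=
  ⟨_, _, unitBall_mem_convexDomains, rfl⟩

theorem two_mul_sub_one_div_sub_one_rpow_pos (hp : 1 < p) :
    0 < ((2 * p - 1) / (p - 1)) ^ (p - 1) :=
  Real.rpow_pos_of_pos (div_pos (by linarith) (by linarith)) _

variable [NeZero D]

theorem normTorsion_pos (hp : 1 < p) (hΩ : Ω ∈ convexDomains D) : 0 < normTorsion p Ω :=
  mul_pos (Real.rpow_pos_of_pos (volume_pos hΩ) _)
    (Real.rpow_pos_of_pos (torsionalRigidity_pos hp hΩ) _)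

theorem Q_pos (hp : 1 < p) (hΩ : Ω ∈ convexDomains D) : 0 < Q p Ω :=
  Real.rpow_pos_of_pos (div_pos
    (mul_pos (normTorsion_pos hp hΩ) (Real.rpow_pos_of_pos (inradius_pos_of_mem hΩ) p))
    (two_mul_sub_one_div_sub_one_rpow_pos hp)) _

theorem normTorsion_eq (hp : 1 < p) (hΩ : Ω ∈ convexDomainsOfInradius D a) :
    normTorsion p Ω = ((2 * p - 1) / (p - 1)) ^ (p - 1) * (Q p Ω / a) ^ p := by
  obtain ⟨hΩ, rfl⟩ := hΩ
  have hp0 : 0 < p := by linarith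
  have hN := normTorsion_pos hp hΩ
  have hR := inradius_pos_of_mem hΩ
  have hc := two_mul_sub_one_div_sub_one_rpow_pos hp
  rw [Q, Real.div_rpow (by positivity) hR.le, ← Real.rpow_mul (by positivity),
    one_div_mul_cancel hp0.ne', Real.rpow_one]
  field_simp

theorem normTorsion_le_normTorsion_iff (hp : 1 < p) (ha : 0 < a) (hb : 0 < b)
    (hΩa : Ωa ∈ convexDomainsOfInradius D a) (hΩb : Ωb ∈ convexDomainsOfInradius D b) :
    normTorsion p Ωb ≤ normTorsion p Ωa ↔ Q p Ωb * a ≤ Q p Ωa * b := by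
  rw [normTorsion_eq hp hΩa, normTorsion_eq hp hΩb,
    mul_le_mul_iff_right₀ (two_mul_sub_one_div_sub_one_rpow_pos hp),
    Real.rpow_le_rpow_iff (div_nonneg (Q_pos hp hΩb.1).le hb.le)
      (div_nonneg (Q_pos hp hΩa.1).le ha.le) (by linarith), div_le_div_iff₀ hb ha]

theorem exists_Q_eq_mul_torsionRatio (D : ℕ) [NeZero D] (hpq : p.HolderConjugate q) :
    ∃ k, 0 < k ∧ ∀ Ω ∈ convexDomains D, Q p Ω = k * torsionRatio p q Ω := by
  have hp := hpq.lt
  have hq0 := hpq.symm.pos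
  have hD : (0 : ℝ) < D := Nat.cast_pos.2 (NeZero.pos D)
  have hexp : 1 - 1 / p = 1 / q := by
    rw [one_div, one_div, sub_eq_iff_eq_add', hpq.inv_add_inv_eq_one]
  have hexp' : p - 1 = 1 / q * p := by rw [← hexp, sub_mul, one_div_mul_cancel hpq.ne_zero, one_mul]
  have hc := two_mul_sub_one_div_sub_one_rpow_pos hp
  set c := ((2 * p - 1) / (p - 1)) ^ (p - 1) with hcdef
  refine ⟨((D / (D + q) : ℝ) ^ (1 / q))⁻¹ / c ^ (1 / p), by positivity, fun Ω hΩ => ?_⟩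
  have hV := volume_pos hΩ
  have hR := inradius_pos_of_mem hΩ
  have hT := torsionalRigidity_pos hp hΩ
  have hτ := torsionalRigidity_rpow_pos hp hΩ
  have hN : normTorsion p Ω =
      (volume.real Ω ^ (1 / q) / torsionalRigidity p Ω ^ (1 - 1 / p)) ^ p := by
    rw [Real.div_rpow (by positivity) hτ.le, ← Real.rpow_mul hV.le, ← Real.rpow_mul hT.le, hexp,
      ← hexp', normTorsion, div_eq_mul_inv, ← Real.rpow_neg hT.le, neg_sub]
  rw [Q, hN, ← hcdef, ← Real.mul_rpow (by positivity) hR.le,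
    Real.div_rpow (by positivity) hc.le, ← Real.rpow_mul (by positivity),
    mul_one_div_cancel hpq.ne_zero, Real.rpow_one, torsionRatio,
    Real.mul_rpow hV.le (by positivity)]
  field_simp

theorem exists_mem_convexDomainsOfInradius_Q_eq (hp : 1 < p) (ha : 0 < a)
    (hΩ : Ω ∈ convexDomains D) : ∃ Ω' ∈ convexDomainsOfInradius D a, Q p Ω' = Q p Ω := by
  have hpq := Real.HolderConjugate.conjExponent hp
  obtain ⟨k, -, hk⟩ := exists_Q_eq_mul_torsionRatio D hpq
  have hR := inradius_pos_of_mem hΩ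
  have ht : 0 < a / inradius Ω := div_pos ha hR
  have hΩ' := smul_mem_convexDomains ht.ne' hΩ
  refine ⟨_, ⟨hΩ', ?_⟩, ?_⟩
  · rw [inradius_smul ht hΩ, div_mul_cancel₀ _ hR.ne']
  · rw [hk _ hΩ, hk _ hΩ', torsionRatio_smul hpq ht hΩ]

theorem exists_Q_mem_Icc (D : ℕ) [NeZero D] (hp : 1 < p) :
    ∃ k : ℝ, 0 < k ∧ ∀ Ω ∈ convexDomains D, Q p Ω ∈ Set.Icc k (k * D) := by
  have hpq := Real.HolderConjugate.conjExponent hp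
  obtain ⟨k, hk, hQ⟩ := exists_Q_eq_mul_torsionRatio D hpq
  refine ⟨k, hk, fun Ω hΩ => ?_⟩
  rw [hQ Ω hΩ]
  exact ⟨le_mul_of_one_le_right hk.le (one_le_torsionRatio hpq hΩ),
    mul_le_mul_of_nonneg_left (torsionRatio_le_dim hpq hΩ) hk.le⟩

theorem bddAbove_image_Q (D : ℕ) [NeZero D] (hp : 1 < p) : BddAbove (Q p '' convexDomains D) := by
  obtain ⟨k, -, hQ⟩ := exists_Q_mem_Icc D hp
  exact ⟨k * D, Set.forall_mem_image.2 fun Ω hΩ => (hQ Ω hΩ).2⟩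

theorem bddBelow_image_Q (D : ℕ) [NeZero D] (hp : 1 < p) : BddBelow (Q p '' convexDomains D) := by
  obtain ⟨k, -, hQ⟩ := exists_Q_mem_Icc D hp
  exact ⟨k, Set.forall_mem_image.2 fun Ω hΩ => (hQ Ω hΩ).1⟩

theorem Q_le_sSup (hp : 1 < p) (hΩ : Ω ∈ convexDomains D) :
    Q p Ω ≤ sSup (Q p '' convexDomains D) :=
  le_csSup (bddAbove_image_Q D hp) ⟨Ω, hΩ, rfl⟩

theorem sInf_le_Q (hp : 1 < p) (hΩ : Ω ∈ convexDomains D) :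
    sInf (Q p '' convexDomains D) ≤ Q p Ω :=
  csInf_le (bddBelow_image_Q D hp) ⟨Ω, hΩ, rfl⟩

theorem sSup_image_Q_pos (D : ℕ) [NeZero D] (hp : 1 < p) : 0 < sSup (Q p '' convexDomains D) :=
  (Q_pos hp unitBall_mem_convexDomains).trans_le (Q_le_sSup hp unitBall_mem_convexDomains)

theorem one_div_le_gammaConst (D : ℕ) [NeZero D] (hp : 1 < p) : 1 / (D : ℝ) ≤ gammaConst D p := by
  obtain ⟨k, hk, hQ⟩ := exists_Q_mem_Icc D hp
  have hinf : k ≤ sInf (Q p '' convexDomains D) :=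
    le_csInf image_Q_nonempty (Set.forall_mem_image.2 fun Ω hΩ => (hQ Ω hΩ).1)
  have hsup : sSup (Q p '' convexDomains D) ≤ k * D :=
    csSup_le image_Q_nonempty (Set.forall_mem_image.2 fun Ω hΩ => (hQ Ω hΩ).2)
  calc 1 / (D : ℝ) = k / (k * D) := by rw [div_mul_cancel_left₀ hk.ne', one_div]
    _ ≤ gammaConst D p := div_le_div₀ (hk.le.trans hinf) hinf (sSup_image_Q_pos D hp) hsup

theorem gammaConst_lt_one (hD : 2 ≤ D) (hp : 1 < p) : gammaConst D p < 1 := by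
  have hpq := Real.HolderConjugate.conjExponent hp
  obtain ⟨k, hk, hQ⟩ := exists_Q_eq_mul_torsionRatio D hpq
  let i : Fin D := ⟨0, by lia⟩
  let j : Fin D := ⟨1, hD⟩
  have hij : i ≠ j := by simp [i, j]
  have htruncated := truncatedBall_mem_convexDomains i
  refine (div_lt_one (sSup_image_Q_pos D hp)).2 ?_
  calc sInf (Q p '' convexDomains D) ≤ Q p (truncatedBall i) := sInf_le_Q hp htruncated
    _ < Q p (Metric.ball (0 : E D) 1) := by
      rw [hQ _ htruncated, hQ _ unitBall_mem_convexDomains]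
      exact mul_lt_mul_of_pos_left ((torsionRatio_truncatedBall_lt hpq hij).trans_le
        (dim_le_torsionRatio_unitBall hpq)) hk
    _ ≤ sSup (Q p '' convexDomains D) := Q_le_sSup hp unitBall_mem_convexDomains

theorem gammaConst_mul_le (hp : 1 < p) (hb : 0 ≤ b) (hΩ : Ω ∈ convexDomains D) :
    sSup (Q p '' convexDomains D) * (gammaConst D p * b) ≤ Q p Ω * b := by
  rw [gammaConst, ← mul_assoc, mul_div_cancel₀ _ (sSup_image_Q_pos D hp).ne']
  exact mul_le_mul_of_nonneg_right (sInf_le_Q hp hΩ) hb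

theorem forall_normTorsion_le_iff (hp : 1 < p) (ha : 0 < a) (hb : 0 < b) :
    (∀ Ωa ∈ convexDomainsOfInradius D a, ∀ Ωb ∈ convexDomainsOfInradius D b,
      normTorsion p Ωb ≤ normTorsion p Ωa) ↔ a ≤ gammaConst D p * b := by
  have hsup := sSup_image_Q_pos D hp
  refine ⟨fun h => ?_, fun h Ωa hΩa Ωb hΩb => ?_⟩
  · have hQ : ∀ Ω₁ ∈ convexDomains D, ∀ Ω₂ ∈ convexDomains D, Q p Ω₁ * a ≤ Q p Ω₂ * b := by
      intro Ω₁ h₁ Ω₂ h₂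
      obtain ⟨Ωb, hΩb, hQb⟩ := exists_mem_convexDomainsOfInradius_Q_eq hp hb h₁
      obtain ⟨Ωa, hΩa, hQa⟩ := exists_mem_convexDomainsOfInradius_Q_eq hp ha h₂
      rw [← hQb, ← hQa]
      exact (normTorsion_le_normTorsion_iff hp ha hb hΩa hΩb).1 (h Ωa hΩa Ωb hΩb)
    rw [gammaConst, div_mul_eq_mul_div, le_div_iff₀ hsup, mul_comm, ← le_div_iff₀ ha]
    refine csSup_le image_Q_nonempty (Set.forall_mem_image.2 fun Ω₁ h₁ => ?_)
    rw [le_div_iff₀ ha, ← div_le_iff₀ hb]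
    exact le_csInf image_Q_nonempty
      (Set.forall_mem_image.2 fun Ω₂ h₂ => (div_le_iff₀ hb).2 (hQ Ω₁ h₁ Ω₂ h₂))
  · rw [normTorsion_le_normTorsion_iff hp ha hb hΩa hΩb]
    calc Q p Ωb * a ≤ sSup (Q p '' convexDomains D) * (gammaConst D p * b) :=
          mul_le_mul (Q_le_sSup hp hΩb.1) h ha.le hsup.le
      _ ≤ Q p Ωa * b := gammaConst_mul_le hp hb.le hΩa.1

theorem normTorsion_lt_of_lt_gammaConst_mul (hp : 1 < p) (ha : 0 < a) (hb : 0 < b)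
    (h : a < gammaConst D p * b) (hΩa : Ωa ∈ convexDomainsOfInradius D a)
    (hΩb : Ωb ∈ convexDomainsOfInradius D b) : normTorsion p Ωb < normTorsion p Ωa := by
  rw [← not_le, normTorsion_le_normTorsion_iff hp hb ha hΩb hΩa, not_le]
  calc Q p Ωb * a < sSup (Q p '' convexDomains D) * (gammaConst D p * b) :=
        mul_lt_mul' (Q_le_sSup hp hΩb.1) h ha.le (sSup_image_Q_pos D hp)
    _ ≤ Q p Ωa * b := gammaConst_mul_le hp hb.le hΩa.1

theorem exists_seq_tendsto_normTorsion (hp : 1 < p) (ha : 0 < a) {Q₀ : ℝ} {y : ℕ → ℝ}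
    (hy : Tendsto y atTop (𝓝 Q₀)) (hyQ : ∀ n, y n ∈ Q p '' convexDomains D) :
    ∃ U : ℕ → Set (E D), (∀ n, U n ∈ convexDomainsOfInradius D a) ∧
      Tendsto (fun n => normTorsion p (U n)) atTop
        (𝓝 (((2 * p - 1) / (p - 1)) ^ (p - 1) * (Q₀ / a) ^ p)) := by
  have hU : ∀ n, ∃ Ω ∈ convexDomainsOfInradius D a, Q p Ω = y n := fun n => by
    obtain ⟨Ω, hΩ, hn⟩ := hyQ n
    exact hn ▸ exists_mem_convexDomainsOfInradius_Q_eq hp ha hΩ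
  choose U hUa hUy using hU
  refine ⟨U, hUa, (((hy.div_const a).rpow_const (Or.inr (by linarith))).const_mul _).congr
    fun n => ?_⟩
  rw [normTorsion_eq hp (hUa n), hUy]

theorem exists_seq_tendsto_normTorsion_of_gammaConst_mul_eq (hp : 1 < p) (ha : 0 < a) (hb : 0 < b)
    (h : gammaConst D p * b = a) :
    ∃ U V : ℕ → Set (E D), (∀ n, U n ∈ convexDomainsOfInradius D a) ∧
      (∀ n, V n ∈ convexDomainsOfInradius D b) ∧
      ∃ l : ℝ, Tendsto (fun n => normTorsion p (V n)) atTop (𝓝 l) ∧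
        Tendsto (fun n => normTorsion p (U n)) atTop (𝓝 l) := by
  obtain ⟨y, -, hy, hyQ⟩ := exists_seq_tendsto_sSup image_Q_nonempty (bddAbove_image_Q D hp)
  obtain ⟨z, -, hz, hzQ⟩ := exists_seq_tendsto_sInf image_Q_nonempty (bddBelow_image_Q D hp)
  obtain ⟨V, hVb, hV⟩ := exists_seq_tendsto_normTorsion hp hb hy hyQ
  obtain ⟨U, hUa, hU⟩ := exists_seq_tendsto_normTorsion hp ha hz hzQ
  have hlimit : sSup (Q p '' convexDomains D) / b = sInf (Q p '' convexDomains D) / a := by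
    have hsup := sSup_image_Q_pos D hp
    rw [gammaConst, div_mul_eq_mul_div, div_eq_iff hsup.ne'] at h
    rw [div_eq_div_iff hb.ne' ha.ne', h, mul_comm]
  exact ⟨U, V, hUa, hVb, _, hV, hlimit ▸ hU⟩

end Comparison

end PTorsion

end

theorem mainTheorem1 (D : ℕ) (hD : 2 ≤ D) (p : ℝ) (hp : 1 < p) :
    BddAbove (PTorsion.Q p '' PTorsion.convexDomains D) ∧
    1 / (D : ℝ) ≤ PTorsion.gammaConst D p ∧ PTorsion.gammaConst D p < 1 ∧
    ∀ a b : ℝ, 0 < a → a < b →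
      ((∀ Ωa ∈ PTorsion.convexDomainsOfInradius D a,
          ∀ Ωb ∈ PTorsion.convexDomainsOfInradius D b,
            PTorsion.normTorsion p Ωb ≤ PTorsion.normTorsion p Ωa) ↔
        PTorsion.gammaConst D p * b ≥ a) ∧
      (PTorsion.gammaConst D p * b > a →
        ∀ Ωa ∈ PTorsion.convexDomainsOfInradius D a,
          ∀ Ωb ∈ PTorsion.convexDomainsOfInradius D b,
            PTorsion.normTorsion p Ωb < PTorsion.normTorsion p Ωa) ∧
      (PTorsion.gammaConst D p * b = a →
        ∃ U V : ℕ → Set (PTorsion.E D),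
          (∀ n, U n ∈ PTorsion.convexDomainsOfInradius D a) ∧
          (∀ n, V n ∈ PTorsion.convexDomainsOfInradius D b) ∧
          ∃ l : ℝ,
            Tendsto (fun n => PTorsion.normTorsion p (V n)) atTop (𝓝 l) ∧
            Tendsto (fun n => PTorsion.normTorsion p (U n)) atTop (𝓝 l)) := by
  have : NeZero D := ⟨by lia⟩
  refine ⟨PTorsion.bddAbove_image_Q D hp, PTorsion.one_div_le_gammaConst D hp,
    PTorsion.gammaConst_lt_one hD hp, fun a b ha hab => ?_⟩
  have hb : 0 < b := ha.trans hab
  exact ⟨PTorsion.forall_normTorsion_le_iff hp ha hb,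
    fun h Ωa hΩa Ωb hΩb => PTorsion.normTorsion_lt_of_lt_gammaConst_mul hp ha hb h hΩa hΩb,
    PTorsion.exists_seq_tendsto_normTorsion_of_gammaConst_mul_eq hp ha hb⟩
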